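/- Call the following data an instance: a finite simple bipartite graph $G=(U\cup V,E)$; values $y\in[0,1]^E$ with $y(\delta(v))=1$ for every $v\in V$; and, for every $u\in U$, a family of pairwise disjoint sets $E_u^{(1)},\dots,E_u^{(\kappa_u)}\subseteq\delta(u)$ with $y(E_u^{(\ell)})\le 1$ for $\ell=1,\dots,\kappa_u$. Here $\delta(w)$ is the set of edges incident to the vertex $w$, and $y(F)=\sum_{e\in F}y_e$ for $F\subseteq E$. There is a randomized polynomial-time algorithm that, given any instance, outputs a random set $E^*\subseteq E$ such that (a) for every $v\in V$, $|E^*\cap\delta(v)|=1$ with probability $1$; (b) for every $e\in E$, $\Pr[e\in E^*]=y_e$; (c) for every $u\in U$ and all $e\ne e'$ in $\delta(u)$, $$\Pr[e\in E^*\wedge e'\in E^*]\le\begin{cases}(1-\zeta)\,y_e y_{e'} & \text{if } e,e'\in E_u^{(\ell)}\text{ for some }\ell\in\{1,\dots,\kappa_u\},\\ y_e y_{e'} & \text{otherwise,}\end{cases}\qquad \zeta=\tfrac1{108}.$$ Here "randomized polynomial-time algorithm" means one fixed program for a random access machine with memory cells for natural numbers (addition, truncated subtraction, comparison) and for real numbers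 (rational constants, field operations, comparison), which can also toss a coin that shows $1$ with a computed probability $r\in[0,1]$. For every outcome of the coins it halts after a number of steps that is bounded by a polynomial in $|U|+|V|+|E|+\sum_{u\in U}\kappa_u$; and if all $y_e$ are rational, then for every outcome of the coins all numbers in its memory are at all times rational, with a number of bits that is bounded by a polynomial in $|U|+|V|+|E|+\sum_{u\in U}\kappa_u$ plus the total number of bits of the $y_e$. -/

import Mathlib

open scoped NNReal ENNReal

noncomputable section

/-! ### Bipartite rounding instances -/

/-- A finite simple bipartite graph `G = (U ∪ V, E)` with `U = {0, …, nU - 1}`,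
`V = {0, …, nV - 1}` and edges numbered `0, …, nE - 1`, fractional values `y ∈ [0,1]^E` with
`y(δ(v)) = 1` for all `v ∈ V`, and for every `u ∈ U` a family of `κ u` disjoint subsets of `δ(u)`,
each of `y`-mass at most `1`. -/
structure RoundingInstance where
  nU : ℕ
  nV : ℕ
  nE : ℕ
  /-- the end points of an edge; injective, as the graph is simple -/
  ends : Fin nE ↪ Fin nU × Fin nV
  y : Fin nE → ℝ
  y_mem : ∀ e, y e ∈ Set.Icc (0 : ℝ) 1
  y_sum : ∀ v, ∑ e with (ends e).2 = v, y e = 1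
  /-- the number of groups at `u` -/
  κ : Fin nU → ℕ
  grp : (u : Fin nU) → Fin (κ u) → Finset (Fin nE)
  grp_subset : ∀ u l, ∀ e ∈ grp u l, (ends e).1 = u
  grp_disjoint : ∀ u l l', l ≠ l' → Disjoint (grp u l) (grp u l')
  grp_mass : ∀ u l, ∑ e ∈ grp u l, y e ≤ 1

namespace RoundingInstance

variable (I : RoundingInstance)

/-- `δ(u)` for `u ∈ U`. -/
def deltaU (u : Fin I.nU) : Finset (Fin I.nE) := {e | (I.ends e).1 = u}

/-- `δ(v)` for `v ∈ V`. -/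
def deltaV (v : Fin I.nV) : Finset (Fin I.nE) := {e | (I.ends e).2 = v}

/-- The combinatorial size of the instance: vertices, edges and groups. -/
def size : ℕ := I.nU + I.nV + I.nE + ∑ u, I.κ u

/-- The label of an edge `e ∈ δ(u)`: `l + 1` if `e` lies in the (unique) group with index `l` at
`u`, and `0` if it lies in no group. -/
def label (e : Fin I.nE) : ℕ :=
  ∑ l : Fin (I.κ (I.ends e).1), if e ∈ I.grp (I.ends e).1 l then (l : ℕ) + 1 else 0

end RoundingInstance

/-! ### Randomized random access machines over the reals -/

namespace RandRAM

/-- The memory: arrays of natural numbers and arrays of real numbers. The first argument is the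
name of the array (a literal in the program), the second one the index of the cell. -/
structure Mem where
  nat : ℕ → ℕ → ℕ
  real : ℕ → ℕ → ℝ

def Mem.setNat (m : Mem) (a i k : ℕ) : Mem :=
  { m with nat := fun b j => if b = a ∧ j = i then k else m.nat b j }

def Mem.setReal (m : Mem) (a i : ℕ) (x : ℝ) : Mem :=
  { m with real := fun b j => if b = a ∧ j = i then x else m.real b j }

/-- Expressions for natural numbers. There is no multiplication, so that in `t` steps numbers can
only grow by `O(t)` bits. -/
inductive NExp
  | const (k : ℕ)
  | get (a : ℕ) (i : NExp)
  | add (e f : NExp)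
  | sub (e f : NExp)

/-- Expressions for real numbers: rational constants and the field operations. -/
inductive RExp
  | const (q : ℚ)
  | get (a : ℕ) (i : NExp)
  | add (e f : RExp)
  | sub (e f : RExp)
  | mul (e f : RExp)
  | div (e f : RExp)

/-- Tests. -/
inductive BExp
  | nlt (e f : NExp)
  | neq (e f : NExp)
  | rlt (e f : RExp)
  | not (b : BExp)
  | and (b c : BExp)

/-- Subtraction of natural numbers is truncated at `0`. -/
def NExp.eval (m : Mem) : NExp → ℕ
  | .const k => k
  | .get a i => m.nat a (i.eval m)
  | .add e f => e.eval m + f.eval m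
  | .sub e f => e.eval m - f.eval m

/-- The machine computes `x / 0` as `0`. -/
def RExp.eval (m : Mem) : RExp → ℝ
  | .const q => (q : ℝ)
  | .get a i => m.real a (i.eval m)
  | .add e f => e.eval m + f.eval m
  | .sub e f => e.eval m - f.eval m
  | .mul e f => e.eval m * f.eval m
  | .div e f => e.eval m / f.eval m

def BExp.eval (m : Mem) : BExp → Prop
  | .nlt e f => e.eval m < f.eval m
  | .neq e f => e.eval m = f.eval m
  | .rlt e f => e.eval m < f.eval m
  | .not b => ¬ b.eval m
  | .and b c => b.eval m ∧ c.eval m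

/-- Programs. `flip a i r` tosses a coin that shows `1` with probability `r`, independently of
everything before, and stores the outcome (`1` or `0`) in cell `i` of the array `a`. -/
inductive Cmd
  | skip
  | setNat (a : ℕ) (i : NExp) (e : NExp)
  | setReal (a : ℕ) (i : NExp) (e : RExp)
  | flip (a : ℕ) (i : NExp) (r : RExp)
  | seq (c d : Cmd)
  | ite (b : BExp) (c d : Cmd)
  | loop (b : BExp) (c : Cmd)

/-- A configuration: the commands that remain to be executed, and the memory. -/
abbrev Config := List Cmd × Mem

/-- The coin that shows `true` with probability `r` (with `r` replaced by the nearest point of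
`[0,1]` if it lies outside). -/
def coin (r : ℝ) : PMF Bool :=
  PMF.ofFintype (fun b => if b = true then ((min r.toNNReal 1 : ℝ≥0) : ℝ≥0∞)
    else ((1 - min r.toNNReal 1 : ℝ≥0) : ℝ≥0∞)) <| by
      rw [Fintype.sum_bool, if_pos rfl, if_neg Bool.false_ne_true, ← ENNReal.coe_add,
        add_tsub_cancel_of_le (min_le_right _ _), ENNReal.coe_one]

open Classical in
/-- One step of the machine: one assignment, one coin toss or one branching. The expressions in a
step are part of the program, so that a step takes a number of arithmetic operations and memory
accesses that is bounded by a constant of the program. A configuration without remaining commands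
has halted, and does not change any more. -/
def step : Config → PMF Config
  | ([], m) => PMF.pure ([], m)
  | (.skip :: k, m) => PMF.pure (k, m)
  | (.setNat a i e :: k, m) => PMF.pure (k, m.setNat a (i.eval m) (e.eval m))
  | (.setReal a i e :: k, m) => PMF.pure (k, m.setReal a (i.eval m) (e.eval m))
  | (.flip a i r :: k, m) =>
      (coin (r.eval m)).map fun b => (k, m.setNat a (i.eval m) (if b = true then 1 else 0))
  | (.seq c d :: k, m) => PMF.pure (c :: d :: k, m)
  | (.ite b c d :: k, m) => PMF.pure ((if b.eval m then c else d) :: k, m)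
  | (.loop b c :: k, m) => PMF.pure (if b.eval m then c :: .loop b c :: k else k, m)

/-- The distribution of the configuration after `t` steps. -/
def run : ℕ → Config → PMF Config
  | 0, x => PMF.pure x
  | t + 1, x => (step x).bind (run t)

/-- Whatever the coins show, the program `P`, started in the memory `m`, halts within `t` steps. -/
def HaltsWithin (P : Cmd) (m : Mem) (t : ℕ) : Prop :=
  ∀ x ∈ (run t ([P], m)).support, x.1 = []

/-- The number of bits of numerator and denominator of a rational number. -/
def ratBits (q : ℚ) : ℕ := q.num.natAbs.size + q.den.size

/-- All numbers in the memory are rational, with at most `B` bits. -/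
def Mem.BitsLE (m : Mem) (B : ℕ) : Prop :=
  ∀ a i, (m.nat a i).size ≤ B ∧ ∃ q : ℚ, m.real a i = (q : ℝ) ∧ ratBits q ≤ B

/-- At all times, and whatever the coins show, all numbers in the memory are rational with at most
`B` bits, when the program `P` is started in the memory `m`. -/
def BitsLE (P : Cmd) (m : Mem) (B : ℕ) : Prop :=
  ∀ t, ∀ x ∈ (run t ([P], m)).support, x.2.BitsLE B

/-- The probability of the event `A`. -/
def prob {α : Type*} (μ : PMF α) (A : Set α) : ℝ := (μ.toOuterMeasure A).toReal

end RandRAM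

namespace RoundingInstance

variable (I : RoundingInstance)

/-- The initial memory. Array `0` of natural numbers holds the numbers of vertices of both kinds
and of edges, arrays `1` and `2` the end points of the edges in `U` and in `V`, array `3` the labels
of the edges (which describe the groups), array `4` the numbers of groups; array `0` of real numbers
holds the values `y`. Everything else is zero. -/
def input : RandRAM.Mem where
  nat a i :=
    match a with
    | 0 => if i = 0 then I.nU else if i = 1 then I.nV else if i = 2 then I.nE else 0
    | 1 => if h : i < I.nE then ((I.ends ⟨i, h⟩).1 : ℕ) else 0
    | 2 => if h : i < I.nE then ((I.ends ⟨i, h⟩).2 : ℕ) else 0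
    | 3 => if h : i < I.nE then I.label ⟨i, h⟩ else 0
    | 4 => if h : i < I.nU then I.κ ⟨i, h⟩ else 0
    | _ => 0
  real a i :=
    match a with
    | 0 => if h : i < I.nE then I.y ⟨i, h⟩ else 0
    | _ => 0

/-- The set of edges that is read off the final memory: those whose cell in array `5` of natural
numbers is not zero. -/
def output (m : RandRAM.Mem) : Finset (Fin I.nE) := {e | m.nat 5 e ≠ 0}

/-- The distribution of the set of edges that is present after `t` steps of the program `P` on the
instance `I`; if `P` halts within `t` steps then this is the output. -/
def outputDist (P : RandRAM.Cmd) (t : ℕ) : PMF (Finset (Fin I.nE)) :=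
  (RandRAM.run t ([P], I.input)).map fun x => I.output x.2

end RoundingInstance

end

/-! Each vertex `v ∈ V` ends with at most one edge. In the first loop `v` gets a candidate edge `a`
with probability `y a / 3`, to be accepted later with probability `lam`, initially `(1 + y a) / 2`;
with probability `2/3` it stays free. In the second loop a free vertex commits to its edge `i` with
probability `y i / 2`, examining its edges in turn with hazard `p = y i / (2 - H)`, where `H` is the
mass already examined. This coin also moves the `lam` of one active candidate in the group of `i`,
the target: down by `(2 - H - y i) / 4` on a hit, after which the target is inactive, and up by `y i
/ 4` on a miss. Then candidates are accepted with probability `lam`, and the remaining vertices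
choose: free ones according to `y`, rejected candidates according to `y` on their other edges.

Marginals: the two moves of `lam` have mean zero, so the conditional probability `commitValue` of an
edge is a martingale (`commitValue_martingale`), and the initial `lam` makes its mean after the
first loop equal to `y` (`candMean_commitValue`). The last two loops treat distinct vertices
independently (`expect_last_loops`), so for two edges at `u` only the product of their conditional
probabilities after the second loop matters. The expected number of chosen edges at `v` is `1`, and
the number never exceeds `1`; hence it is `1` almost surely.

Negative correlation: a coin for edge `i` changes values only at the vertex of `i` and at the vertex
of the target. The target shares its end point in `U` with `i`, and the graph is simple. So two
edges at a common `u`, one at each of these vertices, are either the pair `i`, target, or both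
different from these; in both cases their values move in opposite directions. Hence the product is a
supermartingale (`commitStep_expect_mul_le`).

Strong negative correlation: let `e`, `e'` be in one group, with `y e ≤ 1/2`. If the vertex of `e`
is free in step `e` and the target is `e'`, the product drops by `gain e / (2 - H)`. This happens
whenever `e'` is a candidate and no other edge of the group has been used. A union bound over these
rivals gives the martingale `meeting`, with mean at least `(y e' / 9) * (1 + 2 * y e) / 3`; since
`gain e ≥ y e * (1 - y e) / 4` and `(1 - y e) * (1 + 2 * y e) ≥ 1`, the loss is at least `y e * y e'
/ 108`. Two edges of a group have total mass at most `1`, so one of them qualifies.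

Machine: the random process is a tree of coins (`CoinTree`), and `Sim` says that the program follows
the tree, within a time bound and under an invariant of the memory. Quotients with varying
denominators occur only as coin biases and are never stored; stored reals arise from the `y e`,
quarters of them and halves by addition and subtraction. So they stay bounded multiples of `1 / (4 *
∏ den)`, which gives the bit bound. -/

noncomputable section

/-! ### Trees of coins, and their relation to runs of the machine. -/

namespace RandRAM

/-! ### Trees of coin tosses -/

/-- A finite computation with real-valued coin biases and results in `α`. -/
inductive CoinTree (α : Type) : Type
  | ret (a : α)
  | flip (p : ℝ) (t u : CoinTree α)

namespace CoinTree

variable {α β : Type}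

def bind : CoinTree α → (α → CoinTree β) → CoinTree β
  | ret a, g => g a
  | flip p t u, g => flip p (t.bind g) (u.bind g)

/-- The bias of a coin, moved to the nearest point of `[0,1]`. -/
def clamp (p : ℝ) : ℝ := ((min p.toNNReal 1 : ℝ≥0) : ℝ)

theorem clamp_of_mem {p : ℝ} (h0 : 0 ≤ p) (h1 : p ≤ 1) : clamp p = p := by
  unfold clamp
  rw [NNReal.coe_min, Real.coe_toNNReal p h0, NNReal.coe_one, min_eq_left h1]

theorem clamp_nonneg (p : ℝ) : 0 ≤ clamp p := NNReal.coe_nonneg _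

theorem clamp_le_one (p : ℝ) : clamp p ≤ 1 := by
  unfold clamp
  exact_mod_cast min_le_right _ _

/-- The expectation of `f` at the result. -/
def expect : CoinTree α → (α → ℝ) → ℝ
  | ret a, f => f a
  | flip p t u, f => clamp p * t.expect f + (1 - clamp p) * u.expect f

/-- All results satisfy `P`. -/
def All : CoinTree α → (α → Prop) → Prop
  | ret a, P => P a
  | flip _ t u, P => t.All P ∧ u.All P

@[simp] theorem ret_bind (a : α) (g : α → CoinTree β) : (ret a).bind g = g a := rfl

@[simp] theorem flip_bind (p : ℝ) (t u : CoinTree α) (g : α → CoinTree β) :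
    (flip p t u).bind g = flip p (t.bind g) (u.bind g) := rfl

@[simp] theorem expect_ret (a : α) (f : α → ℝ) : (ret a).expect f = f a := rfl

theorem expect_flip (p : ℝ) (t u : CoinTree α) (f : α → ℝ) (h0 : 0 ≤ p) (h1 : p ≤ 1) :
    (flip p t u).expect f = p * t.expect f + (1 - p) * u.expect f := by
  simp only [expect, clamp_of_mem h0 h1]

theorem expect_bind (t : CoinTree α) (g : α → CoinTree β) (f : β → ℝ) :
    (t.bind g).expect f = t.expect fun a => (g a).expect f := by
  induction t with
  | ret a => rfl
  | flip p t u ht hu => simp only [bind, expect, ht, hu]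

theorem All.bind {t : CoinTree α} {g : α → CoinTree β} {P : α → Prop} {Q : β → Prop} (h : t.All P)
    (hg : ∀ a, P a → (g a).All Q) : (t.bind g).All Q := by
  induction t with
  | ret a => exact hg a h
  | flip p t u ht hu => exact ⟨ht h.1, hu h.2⟩

theorem all_true (t : CoinTree α) : t.All fun _ => True := by
  induction t with
  | ret a => trivial
  | flip p t u ht hu => exact ⟨ht, hu⟩

theorem All.expect_le {t : CoinTree α} {P : α → Prop} (h : t.All P) {f g : α → ℝ}
    (hfg : ∀ a, P a → f a ≤ g a) : t.expect f ≤ t.expect g := by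
  induction t with
  | ret a => exact hfg a h
  | flip p t u ht hu =>
    exact add_le_add (mul_le_mul_of_nonneg_left (ht h.1) (clamp_nonneg p))
      (mul_le_mul_of_nonneg_left (hu h.2) (sub_nonneg.2 (clamp_le_one p)))

theorem All.expect_congr {t : CoinTree α} {P : α → Prop} (h : t.All P) {f g : α → ℝ}
    (hfg : ∀ a, P a → f a = g a) : t.expect f = t.expect g :=
  le_antisymm (h.expect_le fun a ha => (hfg a ha).le) (h.expect_le fun a ha => (hfg a ha).ge)

theorem expect_sub (t : CoinTree α) (f g : α → ℝ) :
    (t.expect fun a => f a - g a) = t.expect f - t.expect g := by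
  induction t with
  | ret a => rfl
  | flip p t u ht hu => simp only [expect, ht, hu]; ring

theorem expect_const (t : CoinTree α) (c : ℝ) : (t.expect fun _ => c) = c := by
  induction t with
  | ret a => rfl
  | flip p t u ht hu => simp only [expect, ht, hu]; ring

theorem expect_const_mul (t : CoinTree α) (c : ℝ) (f : α → ℝ) :
    (t.expect fun a => c * f a) = c * t.expect f := by
  induction t with
  | ret a => rfl
  | flip p t u ht hu => simp only [expect, ht, hu]; ring

theorem expect_sum {ι : Type} (t : CoinTree α) (s : Finset ι) (f : ι → α → ℝ) :
    (t.expect fun a => ∑ i ∈ s, f i a) = ∑ i ∈ s, t.expect (f i) := by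
  induction t with
  | ret a => rfl
  | flip p t u ht hu =>
    simp only [expect, ht, hu, Finset.mul_sum, Finset.sum_add_distrib]

/-- Perform `f i, f (i + 1), …, f (i + k - 1)` in this order. -/
def iter (f : ℕ → α → CoinTree α) : ℕ → ℕ → α → CoinTree α
  | 0, _, s => ret s
  | k + 1, i, s => (f i s).bind (iter f k (i + 1))

section iter

variable {f : ℕ → α → CoinTree α} {n : ℕ} {J : ℕ → α → Prop}

theorem iter_all (hJ : ∀ i < n, ∀ s, J i s → (f i s).All (J (i + 1))) :
    ∀ k i, i + k = n → ∀ s, J i s → (iter f k i s).All (J n)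
  | 0, i, h, s, hs => by
    obtain rfl : i = n := h
    exact hs
  | k + 1, i, h, s, hs =>
    (hJ i (by omega) s hs).bind fun s' hs' => iter_all hJ k (i + 1) (by omega) s' hs'

/-- A potential that does not increase in expectation at any single step does not increase over the
whole loop, by the tower property. The invariant `J` restricts the check to states that can occur.
-/
theorem expect_iter_le (hJ : ∀ i < n, ∀ s, J i s → (f i s).All (J (i + 1)))
    {φ : ℕ → α → ℝ} (hφ : ∀ i < n, ∀ s, J i s → (f i s).expect (φ (i + 1)) ≤ φ i s) :
    ∀ k i, i + k = n → ∀ s, J i s → (iter f k i s).expect (φ n) ≤ φ i s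
  | 0, i, h, s, hs => by
    obtain rfl : i = n := h
    exact le_rfl
  | k + 1, i, h, s, hs => by
    rw [iter, expect_bind]
    refine le_trans ((hJ i (by omega) s hs).expect_le fun s' hs' => ?_) (hφ i (by omega) s hs)
    exact expect_iter_le hJ hφ k (i + 1) (by omega) s' hs'

theorem expect_iter_eq (hJ : ∀ i < n, ∀ s, J i s → (f i s).All (J (i + 1)))
    {φ : ℕ → α → ℝ} (hφ : ∀ i < n, ∀ s, J i s → (f i s).expect (φ (i + 1)) = φ i s) :
    ∀ k i, i + k = n → ∀ s, J i s → (iter f k i s).expect (φ n) = φ i s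
  | 0, i, h, s, hs => by
    obtain rfl : i = n := h
    rfl
  | k + 1, i, h, s, hs => by
    rw [iter, expect_bind, ← hφ i (by omega) s hs]
    refine (hJ i (by omega) s hs).expect_congr fun s' hs' => ?_
    exact expect_iter_eq hJ hφ k (i + 1) (by omega) s' hs'

end iter

end CoinTree

/-! ### Simulation of trees by the machine -/

variable {α β : Type}

/-- From the configuration `x`, the machine halts within `T` steps and performs the coin tosses of
the tree; the memory satisfies `J` throughout, and in the end it is related by `R` to the result. -/
inductive Sim (J : Mem → Prop) (R : α → Mem → Prop) : ℕ → Config → CoinTree α → Prop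
  | ret (T : ℕ) (m : Mem) (s : α) : J m → R s m → Sim J R T ([], m) (.ret s)
  | det (T : ℕ) (x x' : Config) (t : CoinTree α) : J x.2 → step x = PMF.pure x' → Sim J R T x' t →
      Sim J R (T + 1) x t
  | flip (T : ℕ) (a : ℕ) (i : NExp) (r : RExp) (k : List Cmd) (m : Mem) (p : ℝ) (t u : CoinTree α) :
      J m → r.eval m = p → Sim J R T (k, m.setNat a (i.eval m) 1) t →
      Sim J R T (k, m.setNat a (i.eval m) 0) u →
      Sim J R (T + 1) (.flip a i r :: k, m) (.flip p t u)

namespace Sim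

variable {J : Mem → Prop} {R : α → Mem → Prop} {R' : β → Mem → Prop} {T T' : ℕ}
  {k : List Cmd} {m : Mem} {t : CoinTree α}

theorem mono {x : Config} (h : Sim J R T x t) (hT : T ≤ T') : Sim J R T' x t := by
  induction h generalizing T' with
  | ret T m s hm hs => exact .ret _ _ _ hm hs
  | det T x x' t hx hs _ ih =>
    obtain ⟨T'', rfl⟩ : ∃ T'', T' = T'' + 1 := ⟨T' - 1, by omega⟩
    exact .det _ _ _ _ hx hs (ih (by omega))
  | flip T a i r k m p t u hm hp _ _ ih1 ih2 =>
    obtain ⟨T'', rfl⟩ : ∃ T'', T' = T'' + 1 := ⟨T' - 1, by omega⟩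
    exact .flip _ _ _ _ _ _ _ _ _ hm hp (ih1 (by omega)) (ih2 (by omega))

theorem of_eq {x : Config} {u : CoinTree α} (h : Sim J R T x t) (e : t = u) : Sim J R T x u := e ▸ h

theorem imp {x : Config} {Q : α → Mem → Prop} (h : Sim J R T x t)
    (hQ : ∀ s m, J m → R s m → Q s m) : Sim J Q T x t := by
  induction h with
  | ret T m s hm hs => exact .ret _ _ _ hm (hQ _ _ hm hs)
  | det T x x' t hx hs _ ih => exact .det _ _ _ _ hx hs ih
  | flip T a i r k m p t u hm hp _ _ ih1 ih2 => exact .flip _ _ _ _ _ _ _ _ _ hm hp ih1 ih2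

/-- Lets facts that were proved about the results of the tree be used for the final memory. -/
theorem and_all {x : Config} {P : α → Prop} (h : Sim J R T x t) (hP : t.All P) :
    Sim J (fun s m => P s ∧ R s m) T x t := by
  induction h with
  | ret T m s hm hs => exact .ret _ _ _ hm ⟨hP, hs⟩
  | det T x x' t hx hs _ ih => exact .det _ _ _ _ hx hs (ih hP)
  | flip T a i r k m p t u hm hp _ _ ih1 ih2 =>
    exact .flip _ _ _ _ _ _ _ _ _ hm hp (ih1 hP.1) (ih2 hP.2)

theorem skip (hm : J m) (h : Sim J R T (k, m) t) : Sim J R (T + 1) (.skip :: k, m) t :=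
  .det _ _ _ _ hm rfl h

theorem seq {c d : Cmd} (hm : J m) (h : Sim J R T (c :: d :: k, m) t) :
    Sim J R (T + 1) (.seq c d :: k, m) t :=
  .det _ _ _ _ hm rfl h

theorem setNat {a : ℕ} {i e : NExp} (hm : J m)
    (h : Sim J R T (k, m.setNat a (i.eval m) (e.eval m)) t) :
    Sim J R (T + 1) (.setNat a i e :: k, m) t :=
  .det _ _ _ _ hm rfl h

theorem setReal {a : ℕ} {i : NExp} {e : RExp} (hm : J m)
    (h : Sim J R T (k, m.setReal a (i.eval m) (e.eval m)) t) :
    Sim J R (T + 1) (.setReal a i e :: k, m) t :=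
  .det _ _ _ _ hm rfl h

theorem ite {b : BExp} {c d : Cmd} (hm : J m) (h1 : b.eval m → Sim J R T (c :: k, m) t)
    (h2 : ¬ b.eval m → Sim J R T (d :: k, m) t) : Sim J R (T + 1) (.ite b c d :: k, m) t := by
  by_cases hb : b.eval m
  · exact .det _ _ (c :: k, m) _ hm (by simp [step, hb]) (h1 hb)
  · exact .det _ _ (d :: k, m) _ hm (by simp [step, hb]) (h2 hb)

theorem loop_true {b : BExp} {c : Cmd} (hm : J m) (hb : b.eval m)
    (h : Sim J R T (c :: .loop b c :: k, m) t) : Sim J R (T + 1) (.loop b c :: k, m) t :=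
  .det _ _ _ _ hm (by simp only [step, if_pos hb]) h

theorem loop_false {b : BExp} {c : Cmd} (hm : J m) (hb : ¬ b.eval m)
    (h : Sim J R T (k, m) t) : Sim J R (T + 1) (.loop b c :: k, m) t :=
  .det _ _ _ _ hm (by simp only [step, if_neg hb]) h

/-- A step looks only at the first command, so later commands are carried along. A halted
configuration has to be excluded: with commands appended it would start to run. -/
theorem step_append {x x' : Config} (h : step x = PMF.pure x') (hx : x.1 ≠ []) (l : List Cmd) :
    step (x.1 ++ l, x.2) = PMF.pure (x'.1 ++ l, x'.2) := by
  classical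
  obtain ⟨k, m⟩ := x
  cases k with
  | nil => exact absurd rfl hx
  | cons c k =>
    have key : step (c :: k ++ l, m) = (step (c :: k, m)).map fun y => (y.1 ++ l, y.2) := by
      cases c with
      | flip a i r => simp only [List.cons_append, step, PMF.map_comp]; rfl
      | ite b c d => simp only [List.cons_append, step, PMF.pure_map]
      | loop b c =>
        simp only [List.cons_append, step, PMF.pure_map]
        split_ifs <;> rfl
      | skip => simp only [List.cons_append, step, PMF.pure_map]
      | setNat a i e => simp only [List.cons_append, step, PMF.pure_map]
      | setReal a i e => simp only [List.cons_append, step, PMF.pure_map]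
      | seq c d => simp only [List.cons_append, step, PMF.pure_map]
    change step (c :: k ++ l, m) = _
    rw [key, h, PMF.pure_map]

theorem pure_injective {γ : Type} {a b : γ} (h : PMF.pure a = PMF.pure b) : a = b := by
  have := congrArg PMF.support h
  simpa [PMF.support_pure] using this

/-- Running two lists of commands one after the other. -/
theorem append {x : Config} (h : Sim J R T x t) {l : List Cmd} {g : α → CoinTree β}
    (hg : ∀ s m, J m → R s m → Sim J R' T' (l, m) (g s)) :
    Sim J R' (T + T') (x.1 ++ l, x.2) (t.bind g) := by
  induction h with
  | ret T m s hm hs => exact (hg s m hm hs).mono (by omega)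
  | det T x x' t hx hs _ ih =>
    -- `Sim.det` also allows idle steps of a halted configuration. These disappear when `l` is
    -- appended, which costs nothing because time bounds are monotone.
    by_cases hnil : x.1 = []
    · obtain ⟨k, m⟩ := x
      obtain rfl : k = [] := hnil
      obtain rfl : x' = ([], m) := (pure_injective hs).symm
      exact ih.mono (by omega)
    · rw [show T + 1 + T' = T + T' + 1 by omega]
      exact .det _ _ _ _ hx (step_append hs hnil l) ih
  | flip T a i r k m p t u hm hp _ _ ih1 ih2 =>
    rw [show T + 1 + T' = T + T' + 1 by omega]
    exact .flip _ _ _ _ _ _ _ _ _ hm hp ih1 ih2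

theorem cons {c : Cmd} (h : Sim J R T ([c], m) t) {g : α → CoinTree β}
    (hg : ∀ s m, J m → R s m → Sim J R' T' (k, m) (g s)) :
    Sim J R' (T + T') (c :: k, m) (t.bind g) :=
  h.append hg

/-- Appending commands without coin tosses in front. -/
theorem cons_ret {c : Cmd} {s : α} (h : Sim J R T ([c], m) (.ret s)) {u : CoinTree β}
    (hg : ∀ m, J m → R s m → Sim J R' T' (k, m) u) :
    Sim J R' (T + T') (c :: k, m) u := by
  -- The result of a tree `ret s` is known; putting `s' = s` into the relation lets the continuation
  -- be a constant tree.
  have := Sim.append (R := fun s' m => s' = s ∧ R s' m) (g := fun _ => u) (l := k) (R' := R')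
    (T' := T') (by simpa using h.and_all (P := fun s' => s' = s) rfl)
    (by rintro s' m hm ⟨rfl, hR⟩; exact hg m hm hR)
  exact this

/-- A loop that runs a counter from `i` to `n`. -/
theorem loop_iter {b : BExp} {c : Cmd} {n : ℕ} {f : ℕ → α → CoinTree α} {R : ℕ → α → Mem → Prop}
    (hb : ∀ i s m, R i s m → (b.eval m ↔ i < n))
    (hc : ∀ i < n, ∀ s m, J m → R i s m → Sim J (R (i + 1)) T ([c], m) (f i s)) :
    ∀ k i, i + k = n → ∀ s m, J m → R i s m →
      Sim J (R n) (k * (T + 1) + 1) ([.loop b c], m) (CoinTree.iter f k i s)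
  | 0, i, h, s, m, hm, hR => by
    obtain rfl : i = n := h
    exact (loop_false (T := 0) hm (by rw [hb _ _ _ hR]; omega) (.ret _ _ _ hm hR)).mono (by omega)
  | k + 1, i, h, s, m, hm, hR => by
    have := loop_true (k := []) (b := b) (c := c) hm ((hb _ _ _ hR).2 (by omega))
      ((hc i (by omega) s m hm hR).cons fun s' m' hm' hR' =>
        loop_iter hb hc k (i + 1) (by omega) s' m' hm' hR')
    exact this.mono (by rw [add_mul]; omega)

/-! ### Soundness -/

theorem run_nil (n : ℕ) (m : Mem) : run n ([], m) = PMF.pure ([], m) := by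
  induction n with
  | zero => rfl
  | succ n ih => simp only [run, step, PMF.pure_bind, ih]

theorem run_det {x x' : Config} (h : step x = PMF.pure x') (n : ℕ) :
    run (n + 1) x = run n x' := by
  simp only [run, h, PMF.pure_bind]

theorem run_flip (n a : ℕ) (i : NExp) (r : RExp) (k : List Cmd) (m : Mem) :
    run (n + 1) (.flip a i r :: k, m) = (coin (r.eval m)).bind fun b =>
      run n (k, m.setNat a (i.eval m) (if b = true then 1 else 0)) := by
  simp only [run, step, PMF.bind_map]
  rfl

theorem halts {x : Config} (h : Sim J R T x t) : ∀ y ∈ (run T x).support, y.1 = [] := by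
  induction h with
  | ret T m s hm hs => simp [run_nil]
  | det T x x' t hx hs _ ih => rwa [run_det hs]
  | flip T a i r k m p t u hm hp _ _ ih1 ih2 =>
    intro y hy
    rw [run_flip, PMF.mem_support_bind_iff] at hy
    obtain ⟨b, -, hb⟩ := hy
    cases b
    · exact ih2 y (by simpa using hb)
    · exact ih1 y (by simpa using hb)

theorem invariant {x : Config} (h : Sim J R T x t) (n : ℕ) :
    ∀ y ∈ (run n x).support, J y.2 := by
  induction h generalizing n with
  | ret T m s hm hs =>
    intro y hy
    rw [run_nil, PMF.support_pure, Set.mem_singleton_iff] at hy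
    rwa [hy]
  | det T x x' t hx hs _ ih =>
    cases n with
    | zero =>
      intro y hy
      rw [run, PMF.support_pure, Set.mem_singleton_iff] at hy
      rwa [hy]
    | succ n => rw [run_det hs]; exact ih n
  | flip T a i r k m p t u hm hp _ _ ih1 ih2 =>
    intro y hy
    cases n with
    | zero =>
      rw [run, PMF.support_pure, Set.mem_singleton_iff] at hy
      rwa [hy]
    | succ n =>
      rw [run_flip, PMF.mem_support_bind_iff] at hy
      obtain ⟨b, -, hb⟩ := hy
      cases b
      · exact ih2 n y (by simpa using hb)
      · exact ih1 n y (by simpa using hb)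

theorem toOuterMeasure_ne_top {γ : Type*} (μ : PMF γ) (A : Set γ) : μ.toOuterMeasure A ≠ ⊤ := by
  refine ne_top_of_le_ne_top ENNReal.one_ne_top ?_
  rw [PMF.toOuterMeasure_apply, ← μ.tsum_coe]
  exact ENNReal.tsum_le_tsum fun a => Set.indicator_le_self _ _ _

/-- `clamp` is the truncation that is built into `coin`, so no assumption on the bias is needed
here; biases are shown to lie in `[0,1]` only when expectations are computed. -/
theorem prob_coin_bind {γ : Type*} (r : ℝ) (g : Bool → PMF γ) (A : Set γ) :
    prob ((coin r).bind g) A =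
      CoinTree.clamp r * prob (g true) A + (1 - CoinTree.clamp r) * prob (g false) A := by
  have h1 : (coin r) true = ((min r.toNNReal 1 : ℝ≥0) : ℝ≥0∞) := by simp [coin]
  have h0 : (coin r) false = ((1 - min r.toNNReal 1 : ℝ≥0) : ℝ≥0∞) := by simp [coin]
  rw [prob, PMF.toOuterMeasure_bind_apply, tsum_bool, ENNReal.toReal_add, ENNReal.toReal_mul,
    ENNReal.toReal_mul, h1, h0, ENNReal.coe_toReal, ENNReal.coe_toReal, NNReal.coe_sub
    (min_le_right _ _), add_comm]
  · rfl
  · exact ENNReal.mul_ne_top (h0 ▸ ENNReal.coe_ne_top) (toOuterMeasure_ne_top _ _)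
  · exact ENNReal.mul_ne_top (h1 ▸ ENNReal.coe_ne_top) (toOuterMeasure_ne_top _ _)

open Classical in
-- Transfers expectations on the tree to probabilities on the machine: the final configuration has
-- no commands left, so the event need only be decided by the abstract result.
theorem prob_eq {x : Config} (h : Sim J R T x t) {A : Set Config} {f : α → ℝ}
    (hf : ∀ s m, R s m → f s = if (([], m) : Config) ∈ A then 1 else 0) :
    prob (run T x) A = t.expect f := by
  induction h with
  | ret T m s hm hs =>
    rw [run_nil, prob, PMF.toOuterMeasure_pure_apply, CoinTree.expect_ret, hf s m hs]
    split_ifs <;> simp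
  | det T x x' t hx hs _ ih => rwa [run_det hs]
  | flip T a i r k m p t u hm hp _ _ ih1 ih2 =>
    rw [run_flip, prob_coin_bind, CoinTree.expect, ← ih1, ← ih2, hp]
    simp

end Sim

end RandRAM

/-! ### The rounding procedure as a coin tree; partial sums, groups and targets. -/

namespace RoundingInstance

open RandRAM

/-- The status of a vertex `v ∈ V`: nothing is decided (`free`); the edge `a` is a candidate, to be
chosen with probability `lam`, where `b` tells whether `lam` may still be lowered; `a` is chosen. -/
inductive Status (n : ℕ) : Type
  | free
  | cand (a : Fin n) (b : Bool) (lam : ℝ)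
  | done (a : Fin n)

variable (I : RoundingInstance)

abbrev State : Type := Fin I.nV → Status I.nE

/-- The end point in `V`. -/
def vtx (e : Fin I.nE) : Fin I.nV := (I.ends e).2

/-- The relation of two edges to belong to the same group. -/
def Same (e g : Fin I.nE) : Prop :=
  (I.ends e).1 = (I.ends g).1 ∧ I.label e = I.label g ∧ I.label e ≠ 0

/-- The sum of `x` over the edges at `w` before `i`. -/
def headSum (w : Fin I.nV) (i : ℕ) (x : Fin I.nE → ℝ) : ℝ :=
  ∑ g with I.vtx g = w ∧ (g : ℕ) < i, x g

/-- The sum of `x` over the edges at `w` from `i` on. -/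
def tailSum (w : Fin I.nV) (i : ℕ) (x : Fin I.nE → ℝ) : ℝ :=
  ∑ g with I.vtx g = w ∧ i ≤ (g : ℕ), x g

/-- The values `y` with `y a` replaced by `0`. -/
def yExcept (a : Fin I.nE) (g : Fin I.nE) : ℝ := if g = a then 0 else I.y g

/-! ### The algorithm -/

/-- Change the status of `v` only, depending on the status of `v` only. -/
def ownStep (v : Fin I.nV) (κ : Status I.nE → CoinTree (Status I.nE)) (s : I.State) : CoinTree I.State :=
  (κ (s v)).bind fun σ => .ret (Function.update s v σ)

open Classical in
/-- The last active candidate before `k` in the group of `e`. -/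
def target (s : I.State) (e : Fin I.nE) : ℕ → Option (Fin I.nE)
  | 0 => none
  | k + 1 => if h : ∃ hk : k < I.nE, (∃ lam, s (I.vtx ⟨k, hk⟩) = .cand ⟨k, hk⟩ true lam) ∧
      I.Same e ⟨k, hk⟩ then some ⟨k, h.1⟩ else target s e k

/-- Change the probability of the candidate `t` by `δ`. -/
def adjust (s : I.State) (t : Option (Fin I.nE)) (b : Bool) (δ : ℝ) : I.State :=
  match t with
  | none => s
  | some a => Function.update s (I.vtx a)
      (match s (I.vtx a) with
        | .cand a' _ lam => .cand a' b (lam + δ)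
        | σ => σ)

/-- A free vertex makes its edge `i` the candidate with probability `y i / 3` in total. -/
def candKernel (i : Fin I.nE) : Status I.nE → CoinTree (Status I.nE)
  | .free => .flip (I.y i / (3 - I.headSum (I.vtx i) i I.y))
      (.ret (.cand i true ((1 + I.y i) / 2))) (.ret .free)
  | σ => .ret σ

/-- The state after a free vertex has chosen its edge `i`. -/
def afterHit (i : Fin I.nE) (s : I.State) : I.State :=
  Function.update (I.adjust s (I.target s i I.nE) false
    (-((2 - I.headSum (I.vtx i) i I.y - I.y i) / 4))) (I.vtx i) (.done i)

/-- The state after a free vertex has not chosen its edge `i`. -/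
def afterMiss (i : Fin I.nE) (s : I.State) : I.State :=
  I.adjust s (I.target s i I.nE) true (I.y i / 4)

/-- A free vertex chooses its edge `i` with probability `y i / 2` in total, which changes the
probability of a candidate in the group of `i`. -/
def commitStep (i : Fin I.nE) (s : I.State) : CoinTree I.State :=
  match s (I.vtx i) with
  | .free => .flip (I.y i / (2 - I.headSum (I.vtx i) i I.y))
      (.ret (I.afterHit i s)) (.ret (I.afterMiss i s))
  | _ => .ret s

/-- The candidate `i` is chosen with its probability. -/
def candRoundKernel (i : Fin I.nE) : Status I.nE → CoinTree (Status I.nE)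
  | .cand a b lam => if a = i then .flip lam (.ret (.done i)) (.ret (.cand a b lam))
      else .ret (.cand a b lam)
  | σ => .ret σ

/-- The remaining vertices choose an edge. -/
def roundKernel (i : Fin I.nE) : Status I.nE → CoinTree (Status I.nE)
  | .free => .flip (I.y i / (1 - I.headSum (I.vtx i) i I.y)) (.ret (.done i)) (.ret .free)
  | .cand a b lam => if a = i then .ret (.cand a b lam) else
      .flip (I.y i / (1 - I.y a - I.headSum (I.vtx i) i (I.yExcept a)))
        (.ret (.done i)) (.ret (.cand a b lam))
  | .done a => .ret (.done a)

/-- Steps for all edges, as a function on numbers. -/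
def onEdges (f : Fin I.nE → I.State → CoinTree I.State) (i : ℕ) (s : I.State) : CoinTree I.State :=
  if h : i < I.nE then f ⟨i, h⟩ s else .ret s

def candLoop : I.State → CoinTree I.State :=
  .iter (I.onEdges fun i => I.ownStep (I.vtx i) (I.candKernel i)) I.nE 0

def commitLoop : I.State → CoinTree I.State := .iter (I.onEdges I.commitStep) I.nE 0

def candRoundLoop : I.State → CoinTree I.State :=
  .iter (I.onEdges fun i => I.ownStep (I.vtx i) (I.candRoundKernel i)) I.nE 0

def roundLoop : I.State → CoinTree I.State :=
  .iter (I.onEdges fun i => I.ownStep (I.vtx i) (I.roundKernel i)) I.nE 0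

def rounding : CoinTree I.State :=
  (I.candLoop fun _ => .free).bind fun s => (I.commitLoop s).bind fun s' =>
    (I.candRoundLoop s').bind I.roundLoop

/-! ### Sums over edges -/

variable {I}

theorem y_nonneg (e : Fin I.nE) : 0 ≤ I.y e := (I.y_mem e).1

theorem edge_ext {e g : Fin I.nE} (h1 : (I.ends e).1 = (I.ends g).1) (h2 : I.vtx e = I.vtx g) :
    e = g :=
  I.ends.injective (Prod.ext h1 h2)

theorem yExcept_nonneg (a g : Fin I.nE) : 0 ≤ I.yExcept a g := by
  unfold yExcept
  split_ifs
  exacts [le_rfl, y_nonneg g]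

section sums

variable {w : Fin I.nV} {i : ℕ} {x c : Fin I.nE → ℝ}

theorem headSum_zero : I.headSum w 0 x = 0 := by simp [headSum]

theorem tailSum_nE : I.tailSum w I.nE x = 0 := by
  unfold tailSum
  rw [Finset.filter_false_of_mem, Finset.sum_empty]
  intro g _ h
  exact absurd g.2 (by omega)

theorem headSum_add_tailSum : I.headSum w i x + I.tailSum w i x = ∑ g with I.vtx g = w, x g := by
  unfold headSum tailSum
  rw [← Finset.sum_filter_add_sum_filter_not (Finset.univ.filter fun g => I.vtx g = w)
    (fun g : Fin I.nE => (g : ℕ) < i), Finset.filter_filter, Finset.filter_filter]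
  simp only [not_lt]

theorem tailSum_zero : I.tailSum w 0 x = ∑ g with I.vtx g = w, x g := by
  rw [← headSum_add_tailSum (i := 0), headSum_zero, zero_add]

theorem headSum_succ (h : i < I.nE) (hw : I.vtx ⟨i, h⟩ = w) :
    I.headSum w (i + 1) x = I.headSum w i x + x ⟨i, h⟩ := by
  unfold headSum
  have : (Finset.univ.filter fun g : Fin I.nE => I.vtx g = w ∧ (g : ℕ) < i + 1) =
      insert ⟨i, h⟩ (Finset.univ.filter fun g : Fin I.nE => I.vtx g = w ∧ (g : ℕ) < i) := by
    ext g
    simp only [Finset.mem_filter, Finset.mem_univ, true_and, Finset.mem_insert]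
    constructor
    · rintro ⟨h1, h2⟩
      by_cases hg : (g : ℕ) = i
      · exact Or.inl (Fin.ext hg)
      · exact Or.inr ⟨h1, by omega⟩
    · rintro (rfl | ⟨h1, h2⟩)
      · exact ⟨hw, by simp⟩
      · exact ⟨h1, by omega⟩
  rw [this, Finset.sum_insert (by simp), add_comm]

theorem headSum_succ_of_ne (h : i < I.nE) (hw : I.vtx ⟨i, h⟩ ≠ w) :
    I.headSum w (i + 1) x = I.headSum w i x := by
  unfold headSum
  congr 1
  ext g
  simp only [Finset.mem_filter, Finset.mem_univ, true_and]
  refine and_congr_right fun h1 => ⟨fun h2 => ?_, fun h2 => by omega⟩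
  by_contra h3
  exact hw (by rw [← h1]; congr 1; exact Fin.ext (by simp; omega))

theorem tailSum_eq (h : i < I.nE) (hw : I.vtx ⟨i, h⟩ = w) :
    I.tailSum w i x = x ⟨i, h⟩ + I.tailSum w (i + 1) x := by
  have h1 := headSum_add_tailSum (w := w) (i := i) (x := x)
  have h2 := headSum_add_tailSum (w := w) (i := i + 1) (x := x)
  rw [headSum_succ h hw] at h2
  linarith

theorem tailSum_eq_of_ne (h : i < I.nE) (hw : I.vtx ⟨i, h⟩ ≠ w) :
    I.tailSum w i x = I.tailSum w (i + 1) x := by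
  have h1 := headSum_add_tailSum (w := w) (i := i) (x := x)
  have h2 := headSum_add_tailSum (w := w) (i := i + 1) (x := x)
  rw [headSum_succ_of_ne h hw] at h2
  linarith

theorem headSum_nonneg (hx : ∀ g, 0 ≤ x g) : 0 ≤ I.headSum w i x :=
  Finset.sum_nonneg fun g _ => hx g

theorem tailSum_nonneg (hx : ∀ g, 0 ≤ x g) : 0 ≤ I.tailSum w i x :=
  Finset.sum_nonneg fun g _ => hx g

theorem le_tailSum (hx : ∀ g, 0 ≤ x g) {e : Fin I.nE} (he : I.vtx e = w) (hi : i ≤ e) :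
    x e ≤ I.tailSum w i x :=
  Finset.single_le_sum (f := x) (fun g _ => hx g) (by simp [he, hi])

theorem headSum_add_tailSum_y : I.headSum w i I.y + I.tailSum w i I.y = 1 :=
  headSum_add_tailSum.trans (I.y_sum w)

theorem headSum_y_nE : I.headSum w I.nE I.y = 1 := by
  rw [← headSum_add_tailSum_y (w := w) (i := I.nE), tailSum_nE, add_zero]

theorem headSum_y_le_one : I.headSum w i I.y ≤ 1 := by
  have := headSum_add_tailSum_y (w := w) (i := i)
  have := tailSum_nonneg (w := w) (i := i) (x := I.y) y_nonneg
  linarith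

theorem headSum_add_y_le (e : Fin I.nE) : I.headSum (I.vtx e) e I.y + I.y e ≤ 1 := by
  have := headSum_add_tailSum_y (w := I.vtx e) (i := e)
  have := le_tailSum (i := e) (x := I.y) y_nonneg (e := e) rfl le_rfl
  linarith

theorem sum_yExcept {a : Fin I.nE} (ha : I.vtx a = w) :
    ∑ g with I.vtx g = w, I.yExcept a g = 1 - I.y a := by
  have h : ∑ g with I.vtx g = w, (I.yExcept a g + if g = a then I.y a else 0) = 1 := by
    rw [← I.y_sum w]
    refine Finset.sum_congr rfl fun g _ => ?_
    unfold yExcept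
    split_ifs with hg
    · rw [hg, zero_add]
    · rw [add_zero]
  rw [Finset.sum_add_distrib, Finset.sum_ite_eq' , if_pos (by simp [ha])] at h
  linarith

theorem headSum_add_tailSum_yExcept {a : Fin I.nE} (ha : I.vtx a = w) :
    I.headSum w i (I.yExcept a) + I.tailSum w i (I.yExcept a) = 1 - I.y a :=
  headSum_add_tailSum.trans (sum_yExcept ha)

theorem yExcept_self (a : Fin I.nE) : I.yExcept a a = 0 := if_pos rfl

theorem yExcept_of_ne {a g : Fin I.nE} (h : g ≠ a) : I.yExcept a g = I.y g := if_neg h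

theorem y_eq_zero {a e : Fin I.nE} (h : I.vtx e = I.vtx a) (hne : e ≠ a) (ha : 1 - I.y a = 0) :
    I.y e = 0 := by
  have h1 := le_tailSum (i := 0) (x := I.yExcept a) (yExcept_nonneg a) h (Nat.zero_le _)
  rw [tailSum_zero, sum_yExcept rfl, yExcept_of_ne hne, ha] at h1
  exact le_antisymm h1 (y_nonneg e)

end sums

/-! ### Groups -/

/-- The groups at `u` are disjoint, so only one summand of the label is nonzero. -/
theorem label_of_mem {u : Fin I.nU} {l : Fin (I.κ u)} {e : Fin I.nE} (h : e ∈ I.grp u l) :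
    I.label e = l + 1 := by
  obtain rfl := I.grp_subset u l e h
  unfold label
  rw [Finset.sum_eq_single l, if_pos h]
  · intro l' _ hl
    exact if_neg fun h' => Finset.disjoint_left.1 (I.grp_disjoint _ _ _ hl) h' h
  · simp

theorem exists_mem_grp {e : Fin I.nE} (h : I.label e ≠ 0) :
    ∃ l : Fin (I.κ (I.ends e).1), e ∈ I.grp (I.ends e).1 l := by
  by_contra! hn
  exact h (Finset.sum_eq_zero fun l _ => if_neg (hn l))

theorem Same.symm {e g : Fin I.nE} (h : I.Same e g) : I.Same g e :=
  ⟨h.1.symm, h.2.1.symm, h.2.1 ▸ h.2.2⟩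

theorem Same.trans {e g f : Fin I.nE} (h : I.Same e g) (h' : I.Same g f) : I.Same e f :=
  ⟨h.1.trans h'.1, h.2.1.trans h'.2.1, h.2.2⟩

theorem same_of_mem {u : Fin I.nU} {l : Fin (I.κ u)} {e g : Fin I.nE} (he : e ∈ I.grp u l)
    (hg : g ∈ I.grp u l) : I.Same e g :=
  ⟨(I.grp_subset u l e he).trans (I.grp_subset u l g hg).symm,
    (label_of_mem he).trans (label_of_mem hg).symm, by rw [label_of_mem he]; omega⟩

theorem mem_grp_of_same {e g : Fin I.nE} (h : I.Same e g) {l : Fin (I.κ (I.ends e).1)}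
    (he : e ∈ I.grp (I.ends e).1 l) : g ∈ I.grp (I.ends e).1 l := by
  obtain ⟨l', hl'⟩ := exists_mem_grp (h.2.1 ▸ h.2.2 : I.label g ≠ 0)
  have h1 := label_of_mem he
  have h2 := label_of_mem hl'
  have h3 := h.2.1
  -- The type of `l'` mentions the end point of `g`; it is generalized so that the equality of end
  -- points can be rewritten in it.
  revert l'
  rw [← h.1]
  intro l' hl' h2
  obtain rfl : l' = l := Fin.ext (by omega)
  exact hl'

open Classical in
-- `Same` is reflexive only on edges with a nonzero label. For label `0` the sum is empty, otherwise
-- it is a sum over part of one group.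
theorem sum_same_le_one (e : Fin I.nE) : ∑ g with I.Same e g, I.y g ≤ 1 := by
  by_cases h : I.label e = 0
  · rw [Finset.filter_false_of_mem fun g _ hg => hg.2.2 h]
    simp
  · obtain ⟨l, hl⟩ := exists_mem_grp h
    refine le_trans (Finset.sum_le_sum_of_subset_of_nonneg (fun g hg => ?_) fun g _ _ =>
      y_nonneg g) (I.grp_mass _ l)
    exact mem_grp_of_same (by simpa using hg) hl

/-! ### Targets -/

theorem target_spec {s : I.State} {e a : Fin I.nE} {k : ℕ} (h : I.target s e k = some a) :
    (∃ lam, s (I.vtx a) = .cand a true lam) ∧ I.Same e a := by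
  induction k with
  | zero => simp [target] at h
  | succ k ih =>
    rw [target] at h
    split_ifs at h with hk
    · obtain rfl := Option.some.inj h
      exact hk.2
    · exact ih h

theorem target_ne_none {s : I.State} {e a : Fin I.nE} {lam : ℝ} (h : s (I.vtx a) = .cand a true lam)
    (hea : I.Same e a) : ∀ k, (a : ℕ) < k → I.target s e k ≠ none
  | 0, hk => absurd hk (by omega)
  | k + 1, hk => by
    rw [target]
    split_ifs with hc
    · simp
    · by_cases hak : (a : ℕ) = k
      · refine absurd ⟨hak ▸ a.2, ?_⟩ hc
        have : (⟨k, hak ▸ a.2⟩ : Fin I.nE) = a := Fin.ext hak.symm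
        rw [this]
        exact ⟨⟨lam, h⟩, hea⟩
      · exact target_ne_none h hea k (by omega)

theorem adjust_apply_of_ne {s : I.State} {t : Option (Fin I.nE)} {b : Bool} {δ : ℝ} {w : Fin I.nV}
    (h : ∀ a, t = some a → I.vtx a ≠ w) : I.adjust s t b δ w = s w := by
  cases t with
  | none => rfl
  | some a => exact Function.update_of_ne (h a rfl).symm _ _

theorem adjust_apply_self {s : I.State} {a a' : Fin I.nE} {b b' : Bool} {δ lam : ℝ}
    (h : s (I.vtx a) = .cand a' b' lam) :
    I.adjust s (some a) b δ (I.vtx a) = .cand a' b (lam + δ) := by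
  simp [adjust, h]

end RoundingInstance

/-! ### Expectations of single steps, invariants, and conditional probabilities of edges. -/

namespace RoundingInstance

open RandRAM

variable {I : RoundingInstance}

/-! ### Steps that change one vertex -/

/-- The step changes at most one factor, because the `w j` are distinct; the others can be taken out
of the expectation. Iterating this yields independence of distinct vertices in every loop that
consists of such steps. -/
theorem ownStep_prod {ι : Type} [Fintype ι] [DecidableEq ι] {w : ι → Fin I.nV}
    (hw : Function.Injective w) {v : Fin I.nV} {κ : Status I.nE → CoinTree (Status I.nE)}
    {s : I.State} {F G : ι → Status I.nE → ℝ}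
    (hv : ∀ j, w j = v → (κ (s v)).expect (G j) = F j (s v))
    (ho : ∀ j, w j ≠ v → G j (s (w j)) = F j (s (w j))) :
    (I.ownStep v κ s).expect (fun s' => ∏ j, G j (s' (w j))) = ∏ j, F j (s (w j)) := by
  unfold ownStep
  rw [CoinTree.expect_bind]
  simp only [CoinTree.expect_ret]
  by_cases h : ∃ j, w j = v
  · obtain ⟨j, rfl⟩ := h
    have hne : ∀ k ∈ Finset.univ.erase j, w k ≠ w j := fun k hk h =>
      (Finset.ne_of_mem_erase hk) (hw h)
    have : ∀ σ, ∏ k, G k (Function.update s (w j) σ (w k)) =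
        (∏ k ∈ Finset.univ.erase j, F k (s (w k))) * G j σ := by
      intro σ
      rw [← Finset.prod_erase_mul _ _ (Finset.mem_univ j), Function.update_self]
      congr 1
      refine Finset.prod_congr rfl fun k hk => ?_
      rw [Function.update_of_ne (hne k hk), ho k (hne k hk)]
    simp only [this]
    rw [CoinTree.expect_const_mul, hv j rfl, Finset.prod_erase_mul _ _ (Finset.mem_univ j)]
  · push Not at h
    have : ∀ σ, ∏ k, G k (Function.update s v σ (w k)) = ∏ k, F k (s (w k)) := fun σ =>
      Finset.prod_congr rfl fun k _ => by rw [Function.update_of_ne (h k), ho k (h k)]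
    simp only [this]
    rw [CoinTree.expect_const]

/-- One coin of a sequential choice with total weights `N` and normalization `D`. -/
theorem pick_identity {y c D D' N N' : ℝ} (hD : D = y + D') (hN : N = y * c + N') (hy : 0 ≤ y)
    (hD' : 0 ≤ D') (h0 : D' = 0 → N' = 0) : y / D * c + (1 - y / D) * (N' / D') = N / D := by
  rcases eq_or_ne D 0 with h | h
  · have hy0 : y = 0 := by linarith
    have : D' = 0 := by linarith
    simp [h, this]
  · rcases eq_or_ne D' 0 with h' | h'
    · simp [h', hN, h0 h']
      ring
    · rw [hN]
      field_simp
      rw [hD]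
      ring

theorem div_mem_unit {y D : ℝ} (hy : 0 ≤ y) (h : y ≤ D) : 0 ≤ y / D ∧ y / D ≤ 1 :=
  ⟨div_nonneg hy (hy.trans h), div_le_one_of_le₀ h (hy.trans h)⟩

section pick

variable {i : Fin I.nE} {w : Fin I.nV}

theorem pick_mem_unit {k : ℝ} (hk : 1 ≤ k) :
    0 ≤ I.y i / (k - I.headSum (I.vtx i) i I.y) ∧ I.y i / (k - I.headSum (I.vtx i) i I.y) ≤ 1 :=
  div_mem_unit (y_nonneg i) (by linarith [headSum_add_y_le i])

/-- The expected value of `c` under a sequential choice with total probability `y g / k` for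
`g`, and of `f` if nothing is chosen. -/
def pickValue (k : ℝ) (w : Fin I.nV) (i : ℕ) (c : Fin I.nE → ℝ) (f : ℝ) : ℝ :=
  (I.tailSum w i (fun g => I.y g * c g) + (k - 1) * f) / (k - I.headSum w i I.y)

/-- The number `k - headSum` is the unexamined mass `tailSum` plus the mass `k - 1` of choosing
nothing. Tossing with hazard `y i / (k - headSum)` therefore gives each edge its share `y g / k` in
total. -/
theorem pickValue_succ {k : ℝ} (hk : 1 ≤ k) (c : Fin I.nE → ℝ) (f : ℝ) (hw : I.vtx i = w) :
    I.y i / (k - I.headSum w i I.y) * c i +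
      (1 - I.y i / (k - I.headSum w i I.y)) * pickValue k w ((i : ℕ) + 1) c f =
      pickValue k w i c f := by
  have h1 := headSum_succ (x := I.y) i.2 hw
  have h2 := headSum_y_le_one (w := w) (i := (i : ℕ) + 1)
  have h3 := headSum_add_tailSum_y (w := w) (i := (i : ℕ) + 1)
  have h4 := tailSum_nonneg (w := w) (i := (i : ℕ) + 1) (x := I.y) y_nonneg
  simp only [Fin.eta] at h1
  refine pick_identity (by rw [h1]; ring) ?_ (y_nonneg i) (by linarith) fun h0 => ?_
  · rw [tailSum_eq i.2 hw]
    simp only [Fin.eta]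
    ring
  · have hk1 : k = 1 := by linarith
    -- A vanishing normalization forces `k = 1` and no remaining mass, so the numerator vanishes as
    -- well and `0 / 0 = 0` is the right value.
    have h5 : I.tailSum w ((i : ℕ) + 1) I.y = 0 := by linarith
    rw [hk1, sub_self, zero_mul, add_zero]
    refine Finset.sum_eq_zero fun g hg => ?_
    rw [(Finset.sum_eq_zero_iff_of_nonneg fun g _ => y_nonneg g).1 h5 g hg, zero_mul]

theorem pickValue_succ_of_ne {k : ℝ} (c : Fin I.nE → ℝ) (f : ℝ) (hw : I.vtx i ≠ w) :
    pickValue k w ((i : ℕ) + 1) c f = pickValue k w i c f := by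
  unfold pickValue
  rw [headSum_succ_of_ne i.2 hw, ← tailSum_eq_of_ne i.2 hw]

theorem pickValue_nE {k : ℝ} (hk : k ≠ 1) (c : Fin I.nE → ℝ) (f : ℝ) :
    pickValue k w I.nE c f = f := by
  unfold pickValue
  rw [tailSum_nE, headSum_y_nE, zero_add, mul_div_cancel_left₀ _ (sub_ne_zero.2 hk)]

/-- For `k = 1` the normalization at the end is `0`, and `0 / 0 = 0` fits a vertex that has chosen
nothing; such an outcome has probability `0` but is still present in the tree. -/
theorem pickValue_one_nE (c : Fin I.nE → ℝ) (f : ℝ) : pickValue 1 w I.nE c f = 0 := by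
  unfold pickValue
  rw [tailSum_nE, sub_self, zero_mul, add_zero, zero_div]

theorem pickValue_zero (k : ℝ) (c : Fin I.nE → ℝ) (f : ℝ) :
    pickValue k w 0 c f = ((∑ g with I.vtx g = w, I.y g * c g) + (k - 1) * f) / k := by
  unfold pickValue
  rw [tailSum_zero, headSum_zero, sub_zero]

theorem tailSum_single (x : Fin I.nE → ℝ) (e : Fin I.nE) (j : ℕ) :
    I.tailSum (I.vtx e) j (fun g => x g * if g = e then 1 else 0) =
      if j ≤ (e : ℕ) then x e else 0 := by
  unfold tailSum
  simp only [mul_ite, mul_one, mul_zero]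
  rw [Finset.sum_ite_eq']
  simp

/-- As `pickValue 1`, for a choice among the edges other than `a`. -/
def pickExcept (a : Fin I.nE) (w : Fin I.nV) (i : ℕ) (c : Fin I.nE → ℝ) : ℝ :=
  I.tailSum w i (fun g => I.yExcept a g * c g) / (1 - I.y a - I.headSum w i (I.yExcept a))

theorem pickExcept_succ {a : Fin I.nE} (ha : I.vtx a = w) (c : Fin I.nE → ℝ) (hia : a ≠ i)
    (hw : I.vtx i = w) :
    I.y i / (1 - I.y a - I.headSum w i (I.yExcept a)) * c i +
      (1 - I.y i / (1 - I.y a - I.headSum w i (I.yExcept a))) * pickExcept a w ((i : ℕ) + 1) c =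
      pickExcept a w i c := by
  have h1 := headSum_succ (x := I.yExcept a) i.2 hw
  have h3 := headSum_add_tailSum_yExcept (i := (i : ℕ) + 1) ha
  have h4 := tailSum_nonneg (w := w) (i := (i : ℕ) + 1) (x := I.yExcept a) (yExcept_nonneg a)
  simp only [Fin.eta, yExcept_of_ne hia.symm] at h1
  refine pick_identity (by rw [h1]; ring) ?_ (y_nonneg i) (by linarith) fun h0 => ?_
  · rw [tailSum_eq i.2 hw]
    simp only [Fin.eta, yExcept_of_ne hia.symm]
  · have h5 : I.tailSum w ((i : ℕ) + 1) (I.yExcept a) = 0 := by linarith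
    refine Finset.sum_eq_zero fun g hg => ?_
    rw [(Finset.sum_eq_zero_iff_of_nonneg fun g _ => yExcept_nonneg a g).1 h5 g hg, zero_mul]

/-- The edge `a` has weight `0` in `yExcept a`, so leaving out its step does not change the choice.
-/
theorem pickExcept_succ_self (c : Fin I.nE → ℝ) (hw : I.vtx i = w) :
    pickExcept i w ((i : ℕ) + 1) c = pickExcept i w i c := by
  unfold pickExcept
  rw [headSum_succ i.2 hw, tailSum_eq i.2 hw]
  simp only [Fin.eta, yExcept_self]
  simp

theorem pickExcept_succ_of_ne {a : Fin I.nE} (c : Fin I.nE → ℝ) (hw : I.vtx i ≠ w) :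
    pickExcept a w ((i : ℕ) + 1) c = pickExcept a w i c := by
  unfold pickExcept
  rw [headSum_succ_of_ne i.2 hw, ← tailSum_eq_of_ne i.2 hw]

end pick

/-! ### Invariants -/

/-- The edges of a status belong to the vertex, and probabilities lie in `[0,1]`. -/
def Valid (s : I.State) : Prop :=
  ∀ w a b lam, s w = .cand a b lam → I.vtx a = w ∧ 0 ≤ lam ∧ lam ≤ 1

theorem ownStep_all {v : Fin I.nV} {κ : Status I.nE → CoinTree (Status I.nE)} {s : I.State}
    {P : Fin I.nV → Status I.nE → Prop} (h : ∀ w, P w (s w)) (hκ : (κ (s v)).All (P v)) :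
    (I.ownStep v κ s).All fun s' => ∀ w, P w (s' w) := by
  refine hκ.bind fun σ hσ w => ?_
  rcases eq_or_ne w v with rfl | hw
  · rwa [Function.update_self]
  · rw [Function.update_of_ne hw]
    exact h w

theorem onEdges_all {f : Fin I.nE → I.State → CoinTree I.State} {P : ℕ → I.State → Prop} {i : ℕ}
    {s : I.State} (h : ∀ h : i < I.nE, (f ⟨i, h⟩ s).All (P (i + 1))) (hi : i < I.nE) :
    (I.onEdges f i s).All (P (i + 1)) := by
  unfold onEdges
  rw [dif_pos hi]
  exact h hi

theorem candKernel_all {i : Fin I.nE} {σ : Status I.nE} {P : Status I.nE → Prop} (h : P σ)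
    (hi : P (.cand i true ((1 + I.y i) / 2))) : (I.candKernel i σ).All P := by
  cases σ with
  | free => exact ⟨hi, h⟩
  | cand a b lam => exact h
  | done a => exact h

theorem candRoundKernel_all {i : Fin I.nE} {σ : Status I.nE} {P : Status I.nE → Prop} (h : P σ)
    (hi : P (.done i)) : (I.candRoundKernel i σ).All P := by
  cases σ with
  | free => exact h
  | cand a b lam =>
    rw [candRoundKernel]
    split_ifs
    exacts [⟨hi, h⟩, h]
  | done a => exact h

theorem roundKernel_all {i : Fin I.nE} {σ : Status I.nE} {P : Status I.nE → Prop} (h : P σ)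
    (hi : P (.done i)) : (I.roundKernel i σ).All P := by
  cases σ with
  | free => exact ⟨hi, h⟩
  | cand a b lam =>
    rw [roundKernel]
    split_ifs
    exacts [h, ⟨hi, h⟩]
  | done a => exact h

theorem candRoundStep_valid {i : Fin I.nE} {s : I.State} (h : Valid s) :
    (I.ownStep (I.vtx i) (I.candRoundKernel i) s).All Valid :=
  ownStep_all (P := fun w σ => ∀ a b lam, σ = .cand a b lam → I.vtx a = w ∧ 0 ≤ lam ∧ lam ≤ 1) h
    (candRoundKernel_all (h _) (by simp))

theorem roundStep_valid {i : Fin I.nE} {s : I.State} (h : Valid s) :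
    (I.ownStep (I.vtx i) (I.roundKernel i) s).All Valid :=
  ownStep_all (P := fun w σ => ∀ a b lam, σ = .cand a b lam → I.vtx a = w ∧ 0 ≤ lam ∧ lam ≤ 1) h
    (roundKernel_all (h _) (by simp))

/-- The invariant of the first loop. -/
def CandInv (s : I.State) : Prop :=
  ∀ w, s w = .free ∨ ∃ a, I.vtx a = w ∧ s w = .cand a true ((1 + I.y a) / 2)

theorem candStep_inv {i : Fin I.nE} {s : I.State} (h : CandInv s) :
    (I.ownStep (I.vtx i) (I.candKernel i) s).All CandInv :=
  ownStep_all (P := fun w σ => σ = .free ∨ ∃ a, I.vtx a = w ∧ σ = .cand a true ((1 + I.y a) / 2)) h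
    (candKernel_all (h _) (Or.inr ⟨i, rfl, rfl⟩))

open Classical in
/-- The invariant of the second loop before step `i`. -/
def CommitInv (i : ℕ) (s : I.State) : Prop :=
  ∀ w a b lam, s w = .cand a b lam → I.vtx a = w ∧ 0 ≤ lam ∧ (b = true → (1 + I.y a) / 2 ≤ lam) ∧
    lam ≤ (1 + I.y a) / 2 + (∑ g with (I.Same a g ∧ g ≠ a) ∧ (g : ℕ) < i, I.y g) / 4 ∧
    (b = false → ∃ g, g ≠ a ∧ I.Same a g ∧ s (I.vtx g) = .done g)

/-- Raises come from other edges of the group of `a`, whose mass is at most `1 - y a`. So `lam ≤ (1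
+ y a) / 2 + (1 - y a) / 4 ≤ 1`; without a group there are no raises. -/
theorem CommitInv.valid {i : ℕ} {s : I.State} (h : CommitInv i s) : Valid s := by
  classical
  intro w a b lam hs
  obtain ⟨h1, h2, -, h3, -⟩ := h w a b lam hs
  refine ⟨h1, h2, h3.trans ?_⟩
  have h4 : (∑ g with (I.Same a g ∧ g ≠ a) ∧ (g : ℕ) < i, I.y g) + I.y a ≤ 1 ∨
      (∑ g with (I.Same a g ∧ g ≠ a) ∧ (g : ℕ) < i, I.y g) = 0 := by
    by_cases hl : I.label a = 0
    · right
      rw [Finset.filter_false_of_mem fun g _ hg => hg.1.1.2.2 hl, Finset.sum_empty]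
    · left
      refine le_trans ?_ (sum_same_le_one a)
      rw [← Finset.sum_erase_add (Finset.univ.filter fun g => I.Same a g) _
        (show a ∈ _ by simp [Same, hl])]
      refine add_le_add_left (Finset.sum_le_sum_of_subset_of_nonneg (fun g hg => ?_)
        fun g _ _ => y_nonneg g) _
      simp only [Finset.mem_filter, Finset.mem_univ, true_and] at hg
      simp [hg.1.1, hg.1.2]
  have h5 := (I.y_mem a).2
  rcases h4 with h4 | h4 <;> linarith

theorem CandInv.commitInv {s : I.State} (h : CandInv s) : CommitInv 0 s := by
  intro w a b lam hs
  rcases h w with hw | ⟨a', ha', hw⟩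
  · rw [hs] at hw; cases hw
  · rw [hs] at hw
    obtain ⟨rfl, rfl, rfl⟩ : a = a' ∧ b = true ∧ lam = (1 + I.y a') / 2 := by
      simpa using hw
    refine ⟨ha', by linarith [y_nonneg a], fun _ => le_rfl, ?_, by simp⟩
    simp

theorem CommitInv.mono {i j : ℕ} {s : I.State} (h : CommitInv i s) (hij : i ≤ j) :
    CommitInv j s := by
  classical
  intro w a b lam hs
  obtain ⟨h1, h2, h3, h4, h5⟩ := h w a b lam hs
  refine ⟨h1, h2, h3, h4.trans ?_, h5⟩
  gcongr
  · exact fun g _ _ => y_nonneg g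

theorem target_vtx_ne {s : I.State} {i a : Fin I.nE} {k : ℕ} (hf : s (I.vtx i) = .free)
    (h : I.target s i k = some a) : I.vtx a ≠ I.vtx i := by
  obtain ⟨⟨lam, h1⟩, -⟩ := target_spec h
  intro h2
  rw [h2, hf] at h1
  cases h1

theorem afterMiss_apply_self {i : Fin I.nE} {s : I.State} (hf : s (I.vtx i) = .free) :
    I.afterMiss i s (I.vtx i) = .free := by
  rw [afterMiss, adjust_apply_of_ne fun a ha => target_vtx_ne hf ha, hf]

theorem afterHit_apply_self {i : Fin I.nE} {s : I.State} :
    I.afterHit i s (I.vtx i) = .done i := by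
  rw [afterHit, Function.update_self]

theorem afterMiss_apply_of_ne {i : Fin I.nE} {s : I.State} {w : Fin I.nV}
    (h : ∀ a, I.target s i I.nE = some a → I.vtx a ≠ w) : I.afterMiss i s w = s w :=
  adjust_apply_of_ne h

theorem afterHit_apply_of_ne {i : Fin I.nE} {s : I.State} {w : Fin I.nV} (hw : w ≠ I.vtx i)
    (h : ∀ a, I.target s i I.nE = some a → I.vtx a ≠ w) : I.afterHit i s w = s w := by
  rw [afterHit, Function.update_of_ne hw, adjust_apply_of_ne h]

theorem afterMiss_apply_target {i a : Fin I.nE} {s : I.State} {lam : ℝ}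
    (h : I.target s i I.nE = some a) (hs : s (I.vtx a) = .cand a true lam) :
    I.afterMiss i s (I.vtx a) = .cand a true (lam + I.y i / 4) := by
  rw [afterMiss, h, adjust_apply_self hs]

theorem afterHit_apply_target {i a : Fin I.nE} {s : I.State} {lam : ℝ}
    (hf : s (I.vtx i) = .free)
    (h : I.target s i I.nE = some a) (hs : s (I.vtx a) = .cand a true lam) :
    I.afterHit i s (I.vtx a) = .cand a false
      (lam + -((2 - I.headSum (I.vtx i) i I.y - I.y i) / 4)) := by
  rw [afterHit, Function.update_of_ne (target_vtx_ne hf h), h, adjust_apply_self hs]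

theorem commitStep_free {i : Fin I.nE} {s : I.State} (hf : s (I.vtx i) = .free) :
    I.commitStep i s = .flip (I.y i / (2 - I.headSum (I.vtx i) i I.y))
      (.ret (I.afterHit i s)) (.ret (I.afterMiss i s)) := by
  simp only [commitStep, hf]

theorem commitStep_of_ne_free {i : Fin I.nE} {s : I.State} (hf : s (I.vtx i) ≠ .free) :
    I.commitStep i s = .ret s := by
  unfold commitStep
  split
  · contradiction
  · rfl

/-- A status `done` is preserved by the second loop. -/
theorem commit_done {i g : Fin I.nE} {s : I.State} (hf : s (I.vtx i) = .free)
    (hg : s (I.vtx g) = .done g) :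
    I.afterHit i s (I.vtx g) = .done g ∧ I.afterMiss i s (I.vtx g) = .done g := by
  have h1 : I.vtx g ≠ I.vtx i := fun h => by rw [h, hf] at hg; cases hg
  have h2 : ∀ a, I.target s i I.nE = some a → I.vtx a ≠ I.vtx g := fun a ha h => by
    obtain ⟨⟨lam, h3⟩, -⟩ := target_spec ha
    rw [h, hg] at h3
    cases h3
  exact ⟨by rw [afterHit_apply_of_ne h1 h2, hg], by rw [afterMiss_apply_of_ne h2, hg]⟩

/-- A hit lowers its target once and deactivates it, and the chosen edge `i` witnesses the
deactivation. A miss raises the target by `y i / 4`, which is paid for by `i` entering the sum in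
the upper bound. -/
theorem commitStep_inv {i : Fin I.nE} {s : I.State} (h : CommitInv i s) :
    (I.commitStep i s).All (CommitInv ((i : ℕ) + 1)) := by
  classical
  by_cases hf : s (I.vtx i) = .free
  swap
  · rw [commitStep_of_ne_free hf]
    exact h.mono (Nat.le_succ _)
  rw [commitStep_free hf]
  have h' := h.mono (Nat.le_succ (i : ℕ))
  refine ⟨fun w a b lam hs => ?_, fun w a b lam hs => ?_⟩
  · have hwi : w ≠ I.vtx i := fun hw => by rw [hw, afterHit_apply_self] at hs; cases hs
    by_cases ht : ∀ t, I.target s i I.nE = some t → I.vtx t ≠ w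
    · rw [afterHit_apply_of_ne hwi ht] at hs
      obtain ⟨h1, h2, h3, h4, h5⟩ := h' w a b lam hs
      refine ⟨h1, h2, h3, h4, fun hb => ?_⟩
      obtain ⟨g, hg, hag, hgs⟩ := h5 hb
      exact ⟨g, hg, hag, (commit_done hf hgs).1⟩
    · push Not at ht
      obtain ⟨t, ht, rfl⟩ := ht
      obtain ⟨⟨lam', hlam⟩, hsame⟩ := target_spec ht
      rw [afterHit_apply_target hf ht hlam] at hs
      obtain ⟨rfl, rfl, rfl⟩ : t = a ∧ false = b ∧ _ = lam := by simpa using hs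
      obtain ⟨h1, h2, h3, h4, h5⟩ := h' _ t true lam' hlam
      have h6 := h3 rfl
      have h7 := headSum_add_y_le i
      have h8 := headSum_nonneg (w := I.vtx i) (i := i) (x := I.y) y_nonneg
      have h9 := y_nonneg i
      have h10 := y_nonneg t
      -- While active, `lam'` is at least `1/2`, and the decrement is at most `2/4`; hence the new
      -- value is nonnegative.
      refine ⟨h1, by linarith, by simp, by linarith, fun _ => ⟨i, ?_, hsame.symm,
        afterHit_apply_self⟩⟩
      rintro rfl
      exact hwi rfl
  · by_cases ht : ∀ t, I.target s i I.nE = some t → I.vtx t ≠ w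
    · rw [afterMiss_apply_of_ne ht] at hs
      obtain ⟨h1, h2, h3, h4, h5⟩ := h' w a b lam hs
      refine ⟨h1, h2, h3, h4, fun hb => ?_⟩
      obtain ⟨g, hg, hag, hgs⟩ := h5 hb
      exact ⟨g, hg, hag, (commit_done hf hgs).2⟩
    · push Not at ht
      obtain ⟨t, ht, rfl⟩ := ht
      obtain ⟨⟨lam', hlam⟩, hsame⟩ := target_spec ht
      rw [afterMiss_apply_target ht hlam] at hs
      obtain ⟨rfl, rfl, rfl⟩ : t = a ∧ true = b ∧ _ = lam := by simpa using hs
      obtain ⟨h1, h2, h3, h4, h5⟩ := h _ t true lam' hlam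
      have h9 := y_nonneg i
      refine ⟨h1, by linarith, fun _ => by linarith [h3 rfl], ?_, by simp⟩
      -- The edge `i` belongs to this sum: it lies in the group of `t`, and differs from `t` because
      -- its vertex is free while that of `t` has a candidate.
      have h10 : (Finset.univ.filter fun g => (I.Same t g ∧ g ≠ t) ∧ (g : ℕ) < (i : ℕ) + 1) =
          insert i (Finset.univ.filter fun g => (I.Same t g ∧ g ≠ t) ∧ (g : ℕ) < i) := by
        ext g
        simp only [Finset.mem_filter, Finset.mem_univ, true_and, Finset.mem_insert]
        constructor
        · rintro ⟨hg1, hg2⟩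
          by_cases hg : (g : ℕ) = i
          · exact Or.inl (Fin.ext hg)
          · exact Or.inr ⟨hg1, by omega⟩
        · rintro (rfl | ⟨hg1, hg2⟩)
          · refine ⟨⟨hsame.symm, ?_⟩, by omega⟩
            rintro rfl
            exact target_vtx_ne hf ht rfl
          · exact ⟨hg1, by omega⟩
      rw [h10, Finset.sum_insert (by simp)]
      linarith

/-! ### Conditional probabilities -/

/-- The probability that the last loop before its step `i` gives to the edge `e`. -/
def roundValue (i : ℕ) (e : Fin I.nE) : Status I.nE → ℝ
  | .free => pickValue 1 (I.vtx e) i (fun g => if g = e then 1 else 0) 0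
  | .cand a _ _ => pickExcept a (I.vtx e) i (fun g => if g = e then 1 else 0)
  | .done a => if a = e then 1 else 0

/-- The probability that the last two loops before step `i` of the first of them give to `e`. -/
def candRoundValue (i : ℕ) (e : Fin I.nE) : Status I.nE → ℝ
  | .cand a b lam => if i ≤ (a : ℕ) then
      lam * (if a = e then 1 else 0) + (1 - lam) * roundValue 0 e (.cand a b lam)
      else roundValue 0 e (.cand a b lam)
  | σ => roundValue 0 e σ

/-- The probability that the last three loops before step `i` of the first of them give to `e`. -/
def commitValue (i : ℕ) (e : Fin I.nE) : Status I.nE → ℝ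
  | .free => pickValue 2 (I.vtx e) i (fun g => if g = e then 1 else 0) (I.y e)
  | σ => candRoundValue 0 e σ

theorem roundValue_zero_free (e : Fin I.nE) : roundValue 0 e .free = I.y e := by
  simp only [roundValue, pickValue, tailSum_single, headSum_zero]
  simp

theorem roundValue_zero_cand {e a : Fin I.nE} {b : Bool} {lam : ℝ} :
    roundValue 0 e (.cand a b lam) = I.yExcept a e / (1 - I.y a) := by
  simp only [roundValue, pickExcept, tailSum_single, headSum_zero]
  simp

theorem roundValue_nE (e : Fin I.nE) (σ : Status I.nE) [Decidable (σ = .done e)] :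
    roundValue I.nE e σ = if σ = .done e then 1 else 0 := by
  cases σ with
  | free => simp [roundValue, pickValue_one_nE]
  | cand a b lam => simp [roundValue, pickExcept, tailSum_nE]
  | done a => simp [roundValue]

theorem candRoundValue_nE (e : Fin I.nE) (σ : Status I.nE) :
    candRoundValue I.nE e σ = roundValue 0 e σ := by
  cases σ with
  | free => rfl
  | cand a b lam => exact if_neg (by have := a.2; omega)
  | done a => rfl

/-- At the end of the second loop a free vertex has the value `y e`, which is what a fresh choice in
the last loop gives. -/
theorem commitValue_nE (e : Fin I.nE) (σ : Status I.nE) :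
    commitValue I.nE e σ = candRoundValue 0 e σ := by
  cases σ with
  | free =>
    rw [commitValue, candRoundValue, roundValue_zero_free, pickValue_nE (by norm_num)]
    simp
  | cand a b lam => rfl
  | done a => rfl

theorem roundValue_succ_of_ne {i e : Fin I.nE} (h : I.vtx e ≠ I.vtx i) (σ : Status I.nE) :
    roundValue ((i : ℕ) + 1) e σ = roundValue i e σ := by
  cases σ with
  | free => exact pickValue_succ_of_ne _ _ h.symm
  | cand a b lam => exact pickExcept_succ_of_ne _ h.symm
  | done a => rfl

/-- For a rejected candidate `a` the choice is among the other edges; step `a` is skipped, in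
agreement with its weight `0`. -/
theorem roundKernel_expect {i e : Fin I.nE} (h : I.vtx e = I.vtx i) {σ : Status I.nE}
    (hσ : ∀ a b lam, σ = .cand a b lam → I.vtx a = I.vtx i) :
    (I.roundKernel i σ).expect (roundValue ((i : ℕ) + 1) e) = roundValue i e σ := by
  cases σ with
  | free =>
    obtain ⟨h0, h1⟩ := pick_mem_unit (i := i) le_rfl
    rw [roundKernel, CoinTree.expect_flip _ _ _ _ h0 h1]
    simp only [CoinTree.expect_ret, roundValue]
    rw [h]
    exact pickValue_succ le_rfl (fun g => if g = e then 1 else 0) 0 rfl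
  | cand a b lam =>
    have ha := hσ a b lam rfl
    rw [roundKernel]
    split_ifs with hai
    · subst hai
      simp only [CoinTree.expect_ret, roundValue]
      exact pickExcept_succ_self _ h.symm
    · have h2 : 0 ≤ I.y i / (1 - I.y a - I.headSum (I.vtx i) i (I.yExcept a)) ∧
          I.y i / (1 - I.y a - I.headSum (I.vtx i) i (I.yExcept a)) ≤ 1 := by
        refine div_mem_unit (y_nonneg i) ?_
        have h3 := headSum_add_tailSum_yExcept (i := i) ha
        have h4 := le_tailSum (i := i) (x := I.yExcept a) (yExcept_nonneg a) (e := i) rfl le_rfl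
        rw [yExcept_of_ne (Ne.symm hai)] at h4
        linarith
      rw [CoinTree.expect_flip _ _ _ _ h2.1 h2.2]
      simp only [CoinTree.expect_ret, roundValue]
      rw [h]
      exact pickExcept_succ ha (fun g => if g = e then 1 else 0) hai rfl
  | done a => rfl

/-- The threshold `i ≤ a` changes in step `i` only for the candidate `a = i`. -/
theorem candRoundValue_succ_of_ne {i e : Fin I.nE} {σ : Status I.nE}
    (hσ : ∀ b lam, σ ≠ .cand i b lam) :
    candRoundValue ((i : ℕ) + 1) e σ = candRoundValue i e σ := by
  cases σ with
  | free => rfl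
  | cand a b lam =>
    have : (a : ℕ) ≠ i := fun h => hσ b lam (by rw [Fin.ext h])
    simp only [candRoundValue]
    by_cases h : (i : ℕ) ≤ a
    · rw [if_pos h, if_pos (by omega)]
    · rw [if_neg h, if_neg (by omega)]
  | done a => rfl

/-- A candidate that survives its own step has been rejected, and from then on has the value that
the last loop gives it. -/
theorem candRoundKernel_expect {i e : Fin I.nE} {σ : Status I.nE}
    (hσ : ∀ a b lam, σ = .cand a b lam → 0 ≤ lam ∧ lam ≤ 1) :
    (I.candRoundKernel i σ).expect (candRoundValue ((i : ℕ) + 1) e) = candRoundValue i e σ := by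
  cases σ with
  | free => rfl
  | cand a b lam =>
    rw [candRoundKernel]
    split_ifs with hai
    · subst hai
      rw [CoinTree.expect_flip _ _ _ _ (hσ a b lam rfl).1 (hσ a b lam rfl).2]
      simp [candRoundValue, roundValue]
    · exact candRoundValue_succ_of_ne (by simpa using hai)
  | done a => rfl

open Classical in
/-- The indicator of the event that `e` is chosen. -/
def chosen (e : Fin I.nE) (s : I.State) : ℝ := if s (I.vtx e) = .done e then 1 else 0

section product

variable {ι : Type} [Fintype ι] [DecidableEq ι] {e : ι → Fin I.nE}

theorem expect_roundLoop (he : Function.Injective fun j => I.vtx (e j)) {s : I.State}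
    (hs : Valid s) :
    (I.roundLoop s).expect (fun s' => ∏ j, roundValue I.nE (e j) (s' (I.vtx (e j)))) =
      ∏ j, roundValue 0 (e j) (s (I.vtx (e j))) := by
  refine CoinTree.expect_iter_eq (J := fun _ => Valid)
    (φ := fun i s => ∏ j, roundValue i (e j) (s (I.vtx (e j))))
    (fun i hi s hs => onEdges_all (P := fun _ => Valid) (fun _ => roundStep_valid hs) hi)
    (fun i hi s hs => ?_) I.nE 0 (zero_add _) s hs
  rw [onEdges, dif_pos hi]
  refine ownStep_prod he (F := fun j => roundValue i (e j)) (G := fun j => roundValue (i + 1) (e j))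
    (fun j hj => ?_) fun j hj => ?_
  · exact roundKernel_expect hj fun a b lam h => (hs _ a b lam h).1
  · exact roundValue_succ_of_ne (i := ⟨i, hi⟩) hj _

theorem expect_candRoundLoop (he : Function.Injective fun j => I.vtx (e j)) {s : I.State}
    (hs : Valid s) :
    (I.candRoundLoop s).expect (fun s' => ∏ j, candRoundValue I.nE (e j) (s' (I.vtx (e j)))) =
      ∏ j, candRoundValue 0 (e j) (s (I.vtx (e j))) := by
  refine CoinTree.expect_iter_eq (J := fun _ => Valid)
    (φ := fun i s => ∏ j, candRoundValue i (e j) (s (I.vtx (e j))))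
    (fun i hi s hs => onEdges_all (P := fun _ => Valid) (fun _ => candRoundStep_valid hs) hi)
    (fun i hi s hs => ?_) I.nE 0 (zero_add _) s hs
  rw [onEdges, dif_pos hi]
  refine ownStep_prod he (F := fun j => candRoundValue i (e j))
    (G := fun j => candRoundValue (i + 1) (e j)) (fun j hj => ?_) fun j hj => ?_
  · exact candRoundKernel_expect fun a b lam h => (hs _ a b lam h).2
  · refine candRoundValue_succ_of_ne (i := ⟨i, hi⟩) fun b lam h => hj ?_
    exact ((hs _ _ b lam h).1).symm

/-- The last two loops round every vertex independently. -/
theorem expect_last_loops (he : Function.Injective fun j => I.vtx (e j)) {s : I.State}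
    (hs : Valid s) :
    ((I.candRoundLoop s).bind I.roundLoop).expect (fun s' => ∏ j, chosen (e j) s') =
      ∏ j, candRoundValue 0 (e j) (s (I.vtx (e j))) := by
  rw [← expect_candRoundLoop he hs, CoinTree.expect_bind]
  have hv : (I.candRoundLoop s).All Valid :=
    CoinTree.iter_all (J := fun _ => Valid)
      (fun i hi s hs => onEdges_all (P := fun _ => Valid) (fun _ => candRoundStep_valid hs) hi)
      I.nE 0 (zero_add _) s hs
  refine hv.expect_congr fun s' hs' => ?_
  simp only [candRoundValue_nE, chosen, ← roundValue_nE]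
  exact expect_roundLoop he hs'

end product

end RoundingInstance

/-! ### Marginals, and the supermartingale property of products in the second loop. -/

namespace RoundingInstance

open RandRAM

variable {I : RoundingInstance}

/-! ### The first loop -/

/-- The expected value of `F` at the status of `w` after the first loop, before its step `i`. -/
def candValue (F : Status I.nE → ℝ) (i : ℕ) (w : Fin I.nV) : Status I.nE → ℝ
  | .free => pickValue 3 w i (fun g => F (.cand g true ((1 + I.y g) / 2))) (F .free)
  | σ => F σ

/-- The mean of `F` at the status of `w` after the first loop. -/
def candMean (F : Status I.nE → ℝ) (w : Fin I.nV) : ℝ :=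
  ((∑ g with I.vtx g = w, I.y g * F (.cand g true ((1 + I.y g) / 2))) + 2 * F .free) / 3

/-- Vertices do not interact in this loop, so the expectation factorizes. Each factor averages over
the candidates with weights `y g / 3` and over `free` with weight `2/3`. -/
theorem expect_candLoop {ι : Type} [Fintype ι] [DecidableEq ι] {w : ι → Fin I.nV}
    (hw : Function.Injective w) (F : ι → Status I.nE → ℝ) :
    (I.candLoop fun _ => .free).expect (fun s => ∏ j, F j (s (w j))) =
      ∏ j, candMean (F j) (w j) := by
  have h := CoinTree.expect_iter_eq (J := fun _ (_ : I.State) => True)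
    (f := I.onEdges fun i => I.ownStep (I.vtx i) (I.candKernel i)) (n := I.nE)
    (φ := fun i s => ∏ j, candValue (F j) i (w j) (s (w j)))
    (fun i hi s hs => CoinTree.all_true _) (fun i hi s _ => ?_) I.nE 0 (zero_add _) (fun _ => .free)
    trivial
  · have h2 : ∀ j σ, candValue (F j) I.nE (w j) σ = F j σ := by
      intro j σ
      cases σ with
      | free => exact pickValue_nE (by norm_num) _ _
      | cand a b lam => rfl
      | done a => rfl
    simp only [h2] at h
    refine h.trans (Finset.prod_congr rfl fun j _ => ?_)
    rw [candValue, pickValue_zero, candMean]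
    norm_num
  · rw [onEdges, dif_pos hi]
    refine ownStep_prod hw (F := fun j => candValue (F j) i (w j))
      (G := fun j => candValue (F j) (i + 1) (w j)) (fun j hj => ?_) fun j hj => ?_
    · cases hσ : s (I.vtx ⟨i, hi⟩) with
      | free =>
        obtain ⟨h0, h1⟩ := pick_mem_unit (i := ⟨i, hi⟩) (k := 3) (by norm_num)
        rw [candKernel, CoinTree.expect_flip _ _ _ _ h0 h1]
        simp only [CoinTree.expect_ret, candValue]
        rw [hj]
        exact pickValue_succ (i := ⟨i, hi⟩) (k := 3) (by norm_num)
          (fun g => F j (.cand g true ((1 + I.y g) / 2))) (F j .free) rfl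
      | cand a b lam => rfl
      | done a => rfl
    · cases s (w j) with
      | free => exact pickValue_succ_of_ne (i := ⟨i, hi⟩) _ _ (Ne.symm hj)
      | cand a b lam => rfl
      | done a => rfl

theorem candLoop_inv : (I.candLoop fun _ => .free).All CandInv :=
  CoinTree.iter_all (J := fun _ => CandInv)
    (fun _ hi _ hs => onEdges_all (P := fun _ => CandInv) (fun _ => candStep_inv hs) hi)
    I.nE 0 (zero_add _) _ fun _ => Or.inl rfl

theorem commitLoop_inv {s : I.State} (hs : CommitInv 0 s) :
    (I.commitLoop s).All (CommitInv I.nE) :=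
  CoinTree.iter_all (fun i hi _ hs => onEdges_all
    (fun h => commitStep_inv (i := ⟨i, h⟩) hs) hi) I.nE 0 (zero_add _) _ hs

/-- The expected final value of `e` after the first loop. -/
theorem candMean_commitValue (e : Fin I.nE) : candMean (commitValue 0 e) (I.vtx e) = I.y e := by
  have h1 : commitValue 0 e .free = I.y e := by
    rw [commitValue, pickValue]
    rw [tailSum_single, headSum_zero]
    simp
    ring
  -- With `lam = (1 + y g) / 2` the rejection probability is `(1 - y g) / 2`, which cancels the
  -- denominator in `y e / (1 - y g)`. Every candidate then contributes `y e / 2`, and `e` itself an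
  -- additional `1/2`; averaging with weights `y g` gives `y e`.
  have h2 : ∀ g, I.vtx g = I.vtx e → commitValue 0 e (.cand g true ((1 + I.y g) / 2)) =
      I.y e / 2 + (if g = e then 1 / 2 else 0) := by
    intro g hg
    rw [commitValue, candRoundValue, if_pos (Nat.zero_le _), roundValue_zero_cand]
    by_cases hge : g = e
    · subst hge
      rw [if_pos rfl, if_pos rfl, yExcept_self]
      ring
    · rw [if_neg hge, if_neg hge, yExcept_of_ne (Ne.symm hge)]
      -- If `y g = 1` then the other edges at the vertex have value `0`, so the division by zero is
      -- harmless.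
      rcases eq_or_ne (1 - I.y g) 0 with h | h
      · rw [y_eq_zero hg.symm (Ne.symm hge) h]
        ring
      · field_simp
        ring
    · intro h; cases h
  have h3 : ∑ g with I.vtx g = I.vtx e, I.y g * commitValue 0 e (.cand g true ((1 + I.y g) / 2)) =
      ∑ g with I.vtx g = I.vtx e, (I.y g * (I.y e / 2) + if g = e then I.y g / 2 else 0) := by
    refine Finset.sum_congr rfl fun g hg => ?_
    rw [h2 g (by simpa using hg)]
    split_ifs <;> ring
  have h4 : ∑ g with I.vtx g = I.vtx e, I.y g = 1 := I.y_sum _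
  rw [candMean, h1, h3, Finset.sum_add_distrib, ← Finset.sum_mul, h4, Finset.sum_ite_eq', if_pos (by simp)]
  ring

/-! ### The second loop -/

theorem commitValue_succ_of_ne {i e : Fin I.nE} (h : I.vtx e ≠ I.vtx i) (σ : Status I.nE) :
    commitValue ((i : ℕ) + 1) e σ = commitValue i e σ := by
  cases σ with
  | free => exact pickValue_succ_of_ne _ _ h.symm
  | cand a b lam => rfl
  | done a => rfl

theorem commitValue_of_ne_free {σ : Status I.nE} (h : σ ≠ .free) (i j : ℕ) (e : Fin I.nE) :
    commitValue i e σ = commitValue j e σ := by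
  cases σ with
  | free => exact absurd rfl h
  | cand a b lam => rfl
  | done a => rfl

theorem commitValue_done (i : ℕ) (e a : Fin I.nE) :
    commitValue i e (.done a) = if a = e then 1 else 0 := rfl

theorem commitValue_cand (i : ℕ) (e a : Fin I.nE) (b : Bool) (lam : ℝ) :
    commitValue i e (.cand a b lam) =
      lam * (if a = e then 1 else 0) + (1 - lam) * (I.yExcept a e / (1 - I.y a)) := by
  rw [commitValue, candRoundValue, if_pos (Nat.zero_le _), roundValue_zero_cand]
  intro h; cases h

theorem commitValue_free (i : ℕ) (e : Fin I.nE) :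
    commitValue i e .free =
      ((if i ≤ (e : ℕ) then I.y e else 0) + I.y e) / (2 - I.headSum (I.vtx e) i I.y) := by
  rw [commitValue, pickValue, tailSum_single]
  congr 1
  ring

theorem commitValue_free_nonneg (i : ℕ) (e : Fin I.nE) : 0 ≤ commitValue i e .free := by
  rw [commitValue_free]
  have h1 := headSum_y_le_one (w := I.vtx e) (i := i)
  have h2 := y_nonneg e
  refine div_nonneg ?_ (by linarith)
  split_ifs <;> linarith

theorem commitValue_free_succ (e : Fin I.nE) : commitValue ((e : ℕ) + 1) e .free =
    I.y e / (2 - I.headSum (I.vtx e) e I.y - I.y e) := by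
  rw [commitValue_free, if_neg (by omega), headSum_succ e.2 rfl, zero_add]
  simp only [Fin.eta]
  congr 1
  ring

section step

variable {i : Fin I.nE} {s : I.State}

/-- The change of the value of `e`, at the vertex that chooses. -/
theorem commitValue_pick (hf : s (I.vtx i) = .free) {e : Fin I.nE} (he : I.vtx e = I.vtx i) :
    I.y i / (2 - I.headSum (I.vtx i) i I.y) *
        commitValue ((i : ℕ) + 1) e (I.afterHit i s (I.vtx e)) +
      (1 - I.y i / (2 - I.headSum (I.vtx i) i I.y)) *
        commitValue ((i : ℕ) + 1) e (I.afterMiss i s (I.vtx e)) =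
      commitValue i e (s (I.vtx e)) := by
  rw [he, afterHit_apply_self, afterMiss_apply_self hf, hf, commitValue_done, commitValue,
    commitValue, he]
  simp only [eq_comm (a := i)]
  have := pickValue_succ (I := I) (i := i) (k := 2) (by norm_num)
    (fun g => if g = e then 1 else 0) (I.y e) rfl
  simpa only [eq_comm (b := e)] using this

/-- The value of `e` at the vertex of the target. -/
theorem commitValue_target (hf : s (I.vtx i) = .free) {a e : Fin I.nE}
    (ht : I.target s i I.nE = some a) (he : I.vtx e = I.vtx a) :
    I.y i / (2 - I.headSum (I.vtx i) i I.y) *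
        commitValue ((i : ℕ) + 1) e (I.afterHit i s (I.vtx e)) +
      (1 - I.y i / (2 - I.headSum (I.vtx i) i I.y)) *
        commitValue ((i : ℕ) + 1) e (I.afterMiss i s (I.vtx e)) =
      commitValue i e (s (I.vtx e)) ∧
    commitValue ((i : ℕ) + 1) e (I.afterHit i s (I.vtx e)) -
        commitValue ((i : ℕ) + 1) e (I.afterMiss i s (I.vtx e)) =
      -((2 - I.headSum (I.vtx i) i I.y) / 4) *
        ((if a = e then 1 else 0) - I.yExcept a e / (1 - I.y a)) := by
  obtain ⟨⟨lam, hlam⟩, -⟩ := target_spec ht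
  rw [he, afterHit_apply_target hf ht hlam, afterMiss_apply_target ht hlam, hlam,
    commitValue_cand, commitValue_cand, commitValue_cand]
  have h1 := headSum_y_le_one (w := I.vtx i) (i := i)
  have h2 : (2 - I.headSum (I.vtx i) i I.y) ≠ 0 := by linarith
  constructor
  -- With `p = y i / (2 - H)` one has `p * (2 - H - y i) = (1 - p) * y i`, so lowering and raising
  -- cancel on average; the value of `e` is affine in `lam`.
  · field_simp
    ring
  · ring

theorem commitValue_martingale (e : Fin I.nE) :
    (I.commitStep i s).expect (fun s' => commitValue ((i : ℕ) + 1) e (s' (I.vtx e))) =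
      commitValue i e (s (I.vtx e)) := by
  by_cases hf : s (I.vtx i) = .free
  swap
  · rw [commitStep_of_ne_free hf, CoinTree.expect_ret]
    by_cases he : I.vtx e = I.vtx i
    · exact commitValue_of_ne_free (he ▸ hf) _ _ _
    · exact commitValue_succ_of_ne he _
  obtain ⟨h0, h1⟩ := pick_mem_unit (i := i) (k := 2) (by norm_num)
  rw [commitStep_free hf, CoinTree.expect_flip _ _ _ _ h0 h1]
  simp only [CoinTree.expect_ret]
  by_cases he : I.vtx e = I.vtx i
  · exact commitValue_pick hf he
  by_cases ht : ∀ a, I.target s i I.nE = some a → I.vtx a ≠ I.vtx e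
  · rw [afterHit_apply_of_ne he ht, afterMiss_apply_of_ne ht, commitValue_succ_of_ne he]
    ring
  · push Not at ht
    obtain ⟨a, ha, hae⟩ := ht
    exact (commitValue_target hf ha hae.symm).1

/-- One coin gives two-point variables with means known from the martingale property; their
covariance is `p * (1 - p)` times the product of the two jumps. -/
theorem commitStep_expect_mul (hf : s (I.vtx i) = .free) (e e' : Fin I.nE) :
    (I.commitStep i s).expect (fun s' => commitValue ((i : ℕ) + 1) e (s' (I.vtx e)) *
        commitValue ((i : ℕ) + 1) e' (s' (I.vtx e'))) =
      commitValue i e (s (I.vtx e)) * commitValue i e' (s (I.vtx e')) +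
      I.y i / (2 - I.headSum (I.vtx i) i I.y) * (1 - I.y i / (2 - I.headSum (I.vtx i) i I.y)) *
      (commitValue ((i : ℕ) + 1) e (I.afterHit i s (I.vtx e)) -
        commitValue ((i : ℕ) + 1) e (I.afterMiss i s (I.vtx e))) *
      (commitValue ((i : ℕ) + 1) e' (I.afterHit i s (I.vtx e')) -
        commitValue ((i : ℕ) + 1) e' (I.afterMiss i s (I.vtx e'))) := by
  obtain ⟨h0, h1⟩ := pick_mem_unit (i := i) (k := 2) (by norm_num)
  have h2 := commitValue_martingale (i := i) (s := s) e
  have h3 := commitValue_martingale (i := i) (s := s) e'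
  rw [commitStep_free hf, CoinTree.expect_flip _ _ _ _ h0 h1] at h2 h3 ⊢
  simp only [CoinTree.expect_ret] at h2 h3 ⊢
  rw [← h2, ← h3]
  ring

theorem commitValue_hit_sub_miss_self (hf : s (I.vtx i) = .free) :
    commitValue ((i : ℕ) + 1) i (I.afterHit i s (I.vtx i)) -
        commitValue ((i : ℕ) + 1) i (I.afterMiss i s (I.vtx i)) =
      1 - I.y i / (2 - I.headSum (I.vtx i) i I.y - I.y i) := by
  rw [afterHit_apply_self, afterMiss_apply_self hf, commitValue_done, if_pos rfl,
    commitValue_free_succ]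

theorem commitValue_hit_sub_miss_nonpos (hf : s (I.vtx i) = .free) {e : Fin I.nE}
    (he : I.vtx e = I.vtx i) (hne : e ≠ i) :
    commitValue ((i : ℕ) + 1) e (I.afterHit i s (I.vtx e)) -
        commitValue ((i : ℕ) + 1) e (I.afterMiss i s (I.vtx e)) ≤ 0 := by
  rw [he, afterHit_apply_self, afterMiss_apply_self hf, commitValue_done, if_neg (Ne.symm hne)]
  linarith [commitValue_free_nonneg ((i : ℕ) + 1) e]

/-- The values at two vertices change in opposite directions. -/
theorem commitValue_cov_aux (hf : s (I.vtx i) = .free) {e e' a : Fin I.nE}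
    (hu : (I.ends e).1 = (I.ends e').1) (he : I.vtx e = I.vtx i)
    (ht : I.target s i I.nE = some a) (he' : I.vtx e' = I.vtx a) :
    (commitValue ((i : ℕ) + 1) e (I.afterHit i s (I.vtx e)) -
        commitValue ((i : ℕ) + 1) e (I.afterMiss i s (I.vtx e))) *
      (commitValue ((i : ℕ) + 1) e' (I.afterHit i s (I.vtx e')) -
        commitValue ((i : ℕ) + 1) e' (I.afterMiss i s (I.vtx e'))) ≤ 0 := by
  have hsame := (target_spec ht).2
  have h1 := headSum_add_y_le i
  have h2 := y_nonneg i
  rw [(commitValue_target hf ht he').2]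
  -- If `e = i` then `e'` and the target share both end points, so they coincide: `e` jumps up and
  -- `e'` down. Otherwise `e'` is not the target, since that would make `e` share both end points
  -- with `i`: now `e` jumps down and `e'` up.
  by_cases hei : e = i
  · subst hei
    obtain rfl : e' = a := edge_ext (hu.symm.trans hsame.1) he'
    rw [commitValue_hit_sub_miss_self hf, if_pos rfl, yExcept_self, zero_div, sub_zero, mul_one]
    refine mul_nonpos_of_nonneg_of_nonpos (sub_nonneg.2 ?_) (by linarith)
    exact div_le_one_of_le₀ (by linarith [(I.y_mem e).2]) (by linarith)
  · have hae : a ≠ e' := by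
      rintro rfl
      exact hei (edge_ext (hu.trans hsame.1.symm) he)
    rw [if_neg hae, zero_sub]
    refine mul_nonpos_of_nonpos_of_nonneg (commitValue_hit_sub_miss_nonpos hf he hei) ?_
    rw [neg_mul_neg]
    have h3 := (I.y_mem a).2
    exact mul_nonneg (by linarith) (div_nonneg (yExcept_nonneg _ _) (by linarith))

/-- Only the vertex of `i` and the vertex of the target can change. Unless `e` and `e'` occupy
exactly these two, one of the jumps is zero. -/
theorem commitStep_expect_mul_le {e e' : Fin I.nE} (hu : (I.ends e).1 = (I.ends e').1)
    (hne : e ≠ e') :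
    (I.commitStep i s).expect (fun s' => commitValue ((i : ℕ) + 1) e (s' (I.vtx e)) *
        commitValue ((i : ℕ) + 1) e' (s' (I.vtx e'))) ≤
      commitValue i e (s (I.vtx e)) * commitValue i e' (s (I.vtx e')) := by
  have hv : I.vtx e ≠ I.vtx e' := fun h => hne (edge_ext hu h)
  by_cases hf : s (I.vtx i) = .free
  swap
  · rw [commitStep_of_ne_free hf, CoinTree.expect_ret]
    have h : ∀ e, commitValue ((i : ℕ) + 1) e (s (I.vtx e)) = commitValue i e (s (I.vtx e)) := by
      intro e
      by_cases he : I.vtx e = I.vtx i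
      · exact commitValue_of_ne_free (he ▸ hf) _ _ _
      · exact commitValue_succ_of_ne he _
    rw [h, h]
  rw [commitStep_expect_mul hf, mul_assoc]
  obtain ⟨h0, h1⟩ := pick_mem_unit (i := i) (k := 2) (by norm_num)
  refine add_le_of_nonpos_right (mul_nonpos_of_nonneg_of_nonpos
    (mul_nonneg h0 (sub_nonneg.2 h1)) ?_)
  by_cases hc : ∃ e₀ ∈ ({e, e'} : Finset (Fin I.nE)), I.vtx e₀ ≠ I.vtx i ∧
      ∀ a, I.target s i I.nE = some a → I.vtx a ≠ I.vtx e₀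
  · obtain ⟨e₀, he₀, h2, h3⟩ := hc
    have h4 : commitValue ((i : ℕ) + 1) e₀ (I.afterHit i s (I.vtx e₀)) -
        commitValue ((i : ℕ) + 1) e₀ (I.afterMiss i s (I.vtx e₀)) = 0 := by
      rw [afterHit_apply_of_ne h2 h3, afterMiss_apply_of_ne h3, sub_self]
    simp only [Finset.mem_insert, Finset.mem_singleton] at he₀
    rcases he₀ with rfl | rfl
    · rw [h4, zero_mul]
    · rw [h4, mul_zero]
  · push Not at hc
    have h2 := hc e (by simp)
    have h3 := hc e' (by simp)
    by_cases he : I.vtx e = I.vtx i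
    · obtain ⟨a, ha, hae⟩ := h3 fun h => hv (he.trans h.symm)
      exact commitValue_cov_aux hf hu he ha hae.symm
    · obtain ⟨a, ha, hae⟩ := h2 he
      by_cases he' : I.vtx e' = I.vtx i
      · rw [mul_comm]
        exact commitValue_cov_aux hf hu.symm he' ha hae.symm
      · obtain ⟨a', ha', hae'⟩ := h3 he'
        rw [ha] at ha'
        obtain rfl := Option.some.inj ha'
        exact absurd (hae.symm.trans hae') hv

/-- The decrease of the product when the target of `e` is `e'`. -/
theorem commitStep_expect_mul_eq (hf : s (I.vtx i) = .free) {e' : Fin I.nE}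
    (ht : I.target s i I.nE = some e') :
    (I.commitStep i s).expect (fun s' => commitValue ((i : ℕ) + 1) i (s' (I.vtx i)) *
        commitValue ((i : ℕ) + 1) e' (s' (I.vtx e'))) =
      commitValue i i (s (I.vtx i)) * commitValue i e' (s (I.vtx e')) -
        I.y i * (2 - I.headSum (I.vtx i) i I.y - 2 * I.y i) / 4 *
          (1 / (2 - I.headSum (I.vtx i) i I.y)) := by
  rw [commitStep_expect_mul hf, commitValue_hit_sub_miss_self hf,
    (commitValue_target hf ht rfl).2, if_pos rfl, yExcept_self]
  have h1 := headSum_add_y_le i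
  have h2 := y_nonneg i
  have h3 : 2 - I.headSum (I.vtx i) i I.y ≠ 0 := by linarith
  have h4 : 2 - I.headSum (I.vtx i) i I.y - I.y i ≠ 0 := by linarith
  field_simp
  ring

end step

theorem expect_commitLoop_mul_le {e e' : Fin I.nE} (hu : (I.ends e).1 = (I.ends e').1)
    (hne : e ≠ e') (s : I.State) :
    (I.commitLoop s).expect (fun s' => candRoundValue 0 e (s' (I.vtx e)) *
        candRoundValue 0 e' (s' (I.vtx e'))) ≤
      commitValue 0 e (s (I.vtx e)) * commitValue 0 e' (s (I.vtx e')) := by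
  simp only [← commitValue_nE]
  refine CoinTree.expect_iter_le (J := fun _ _ => True) (fun i hi s hs => CoinTree.all_true _)
    (φ := fun i s => commitValue i e (s (I.vtx e)) * commitValue i e' (s (I.vtx e')))
    (fun i hi s _ => ?_) I.nE 0 (zero_add _) s trivial
  rw [onEdges, dif_pos hi]
  exact commitStep_expect_mul_le (i := ⟨i, hi⟩) hu hne

theorem expect_commitLoop (e : Fin I.nE) (s : I.State) :
    (I.commitLoop s).expect (fun s' => candRoundValue 0 e (s' (I.vtx e))) =
      commitValue 0 e (s (I.vtx e)) := by
  simp only [← commitValue_nE]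
  refine CoinTree.expect_iter_eq (J := fun _ _ => True) (fun i hi s hs => CoinTree.all_true _)
    (φ := fun i s => commitValue i e (s (I.vtx e)))
    (fun i hi s _ => ?_) I.nE 0 (zero_add _) s trivial
  rw [onEdges, dif_pos hi]
  exact commitValue_martingale (i := ⟨i, hi⟩) e

end RoundingInstance

/-! ### The quantitative gain for two edges of one group, and the probabilities of the result. -/

namespace RoundingInstance

open RandRAM

variable {I : RoundingInstance}

/-! ### Strong negative correlation within a group -/

/-- The expected value of `F` at the status of `w` after the second loop, before its step `i`, for
functions `F` that do not depend on the probability of a candidate. -/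
def commitMean (F : Status I.nE → ℝ) (i : ℕ) (w : Fin I.nV) : Status I.nE → ℝ
  | .free => pickValue 2 w i (fun g => F (.done g)) (F .free)
  | σ => F σ

/-- The function `F` does not depend on the probability of a candidate. -/
def Insensitive (F : Status I.nE → ℝ) : Prop :=
  ∀ a b lam b' lam', F (.cand a b lam) = F (.cand a b' lam')

theorem commitMean_of_ne_free {F : Status I.nE → ℝ} {σ : Status I.nE} (h : σ ≠ .free) (i : ℕ)
    (w : Fin I.nV) : commitMean F i w σ = F σ := by
  cases σ with
  | free => exact absurd rfl h
  | cand a b lam => rfl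
  | done a => rfl

theorem commitMean_succ_of_ne {F : Status I.nE → ℝ} {i : Fin I.nE} {w : Fin I.nV}
    (h : w ≠ I.vtx i) (σ : Status I.nE) :
    commitMean F ((i : ℕ) + 1) w σ = commitMean F i w σ := by
  cases σ with
  | free => exact pickValue_succ_of_ne _ _ h.symm
  | cand a b lam => rfl
  | done a => rfl

/-- Away from the vertex of `i`, a step alters only the probability and the activity flag of a
candidate, and `F` sees neither. -/
theorem commitMean_after {F : Status I.nE → ℝ} (hF : Insensitive F) {i : Fin I.nE} {s : I.State}
    (hf : s (I.vtx i) = .free) {w : Fin I.nV} (hw : w ≠ I.vtx i) :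
    commitMean F ((i : ℕ) + 1) w (I.afterHit i s w) = commitMean F i w (s w) ∧
      commitMean F ((i : ℕ) + 1) w (I.afterMiss i s w) = commitMean F i w (s w) := by
  by_cases ht : ∀ a, I.target s i I.nE = some a → I.vtx a ≠ w
  · rw [afterHit_apply_of_ne hw ht, afterMiss_apply_of_ne ht, commitMean_succ_of_ne hw]
    exact ⟨rfl, rfl⟩
  · push Not at ht
    obtain ⟨a, ha, rfl⟩ := ht
    obtain ⟨⟨lam, hlam⟩, -⟩ := target_spec ha
    rw [afterHit_apply_target hf ha hlam, afterMiss_apply_target ha hlam, hlam]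
    exact ⟨hF _ _ _ _ _, hF _ _ _ _ _⟩

/-- Adjusting targets is the only interaction between vertices in the second loop. Functions that
ignore it behave as if the vertices evolved independently. -/
theorem expect_commitStep_prod {ι : Type} [Fintype ι] [DecidableEq ι] {w : ι → Fin I.nV}
    (hw : Function.Injective w) {F : ι → Status I.nE → ℝ} (hF : ∀ j, Insensitive (F j))
    {i : Fin I.nE} {s : I.State} :
    (I.commitStep i s).expect
        (fun s' => ∏ j, commitMean (F j) ((i : ℕ) + 1) (w j) (s' (w j))) =
      ∏ j, commitMean (F j) i (w j) (s (w j)) := by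
  by_cases hf : s (I.vtx i) = .free
  swap
  · rw [commitStep_of_ne_free hf, CoinTree.expect_ret]
    refine Finset.prod_congr rfl fun j _ => ?_
    by_cases hj : w j = I.vtx i
    · rw [commitMean_of_ne_free (hj ▸ hf), commitMean_of_ne_free (hj ▸ hf)]
    · exact commitMean_succ_of_ne hj _
  obtain ⟨h0, h1⟩ := pick_mem_unit (i := i) (k := 2) (by norm_num)
  rw [commitStep_free hf, CoinTree.expect_flip _ _ _ _ h0 h1]
  simp only [CoinTree.expect_ret]
  by_cases h : ∃ j, w j = I.vtx i
  · obtain ⟨j, hj⟩ := h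
    have hne : ∀ k ∈ Finset.univ.erase j, w k ≠ I.vtx i := fun k hk h =>
      (Finset.ne_of_mem_erase hk) (hw (h.trans hj.symm))
    rw [← Finset.prod_erase_mul _ _ (Finset.mem_univ j),
      ← Finset.prod_erase_mul _ _ (Finset.mem_univ j),
      ← Finset.prod_erase_mul _ _ (Finset.mem_univ j),
      Finset.prod_congr rfl fun k hk => (commitMean_after (hF k) hf (hne k hk)).1,
      Finset.prod_congr rfl fun k hk => (commitMean_after (hF k) hf (hne k hk)).2]
    have h2 := pickValue_succ (i := i) (k := 2) (by norm_num) (fun g => F j (.done g)) (F j .free)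
      rfl
    rw [hj, afterHit_apply_self, afterMiss_apply_self hf, hf]
    simp only [commitMean]
    rw [← h2]
    ring
  · push Not at h
    rw [Finset.prod_congr rfl fun k _ => (commitMean_after (hF k) hf (h k)).1,
      Finset.prod_congr rfl fun k _ => (commitMean_after (hF k) hf (h k)).2]
    ring

open Classical in
def isFree (σ : Status I.nE) : ℝ := if σ = .free then 1 else 0

open Classical in
def isCand (e : Fin I.nE) (σ : Status I.nE) : ℝ := if ∃ b lam, σ = .cand e b lam then 1 else 0

open Classical in
def isUsed (e : Fin I.nE) (σ : Status I.nE) : ℝ :=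
  if σ = .done e ∨ ∃ b lam, σ = .cand e b lam then 1 else 0

theorem insensitive_isFree : Insensitive (isFree (I := I)) := fun a b lam b' lam' => by
  simp [isFree]

theorem insensitive_isCand (e : Fin I.nE) : Insensitive (isCand e) := fun a b lam b' lam' => by
  simp [isCand]

theorem insensitive_isUsed (e : Fin I.nE) : Insensitive (isUsed e) := fun a b lam b' lam' => by
  simp [isUsed]

open Classical in
/-- The edges that compete with `e` and `e'` in their group. -/
def rivals (e e' : Fin I.nE) : Finset (Fin I.nE) := {g | I.Same e g ∧ g ≠ e ∧ g ≠ e'}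

/-- A lower bound for the probability that, in step `e` of the second loop, the end point of `e` is
free and the target is `e'`, divided by the probability that the end point stays free. -/
def meeting (e e' : Fin I.nE) (i : ℕ) (s : I.State) : ℝ :=
  commitMean isFree i (I.vtx e) (s (I.vtx e)) * commitMean (isCand e') i (I.vtx e') (s (I.vtx e')) -
    ∑ g ∈ rivals e e', commitMean isFree i (I.vtx e) (s (I.vtx e)) *
      commitMean (isCand e') i (I.vtx e') (s (I.vtx e')) *
      commitMean (isUsed g) i (I.vtx g) (s (I.vtx g))

theorem injective_vec_two {α : Type*} {a b : α} (h : a ≠ b) : Function.Injective ![a, b] := by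
  intro i j hij
  fin_cases i <;> fin_cases j <;> simp_all [eq_comm]

theorem injective_vec_three {α : Type*} {a b c : α} (h : a ≠ b) (h' : a ≠ c) (h'' : b ≠ c) :
    Function.Injective ![a, b, c] := by
  intro i j hij
  fin_cases i <;> fin_cases j <;> simp_all [eq_comm]

theorem vtx_ne_of_same {e g : Fin I.nE} (h : I.Same e g) (hne : e ≠ g) : I.vtx e ≠ I.vtx g :=
  fun h' => hne (edge_ext h.1 h')

theorem mem_rivals {e e' g : Fin I.nE} : g ∈ rivals e e' ↔ I.Same e g ∧ g ≠ e ∧ g ≠ e' := by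
  simp [rivals]

section meeting

variable {e e' : Fin I.nE}

/-- All edges involved share their end point in `U`, so their vertices in `V` are distinct and each
product in `meeting` is a martingale. -/
theorem expect_meeting (hs : I.Same e e') (hne : e ≠ e') {i : Fin I.nE} {s : I.State} :
    (I.commitStep i s).expect (meeting e e' ((i : ℕ) + 1)) = meeting e e' i s := by
  have h2 := expect_commitStep_prod (i := i) (s := s)
    (injective_vec_two (vtx_ne_of_same hs hne)) (F := ![isFree, isCand e'])
    (Fin.forall_fin_two.2 ⟨insensitive_isFree, insensitive_isCand e'⟩)
  have h3 : ∀ g ∈ rivals e e', _ := fun g hg => expect_commitStep_prod (i := i) (s := s)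
    (injective_vec_three (vtx_ne_of_same hs hne)
      (vtx_ne_of_same (mem_rivals.1 hg).1 (mem_rivals.1 hg).2.1.symm)
      (vtx_ne_of_same (hs.symm.trans (mem_rivals.1 hg).1) (mem_rivals.1 hg).2.2.symm))
    (F := ![isFree, isCand e', isUsed g])
    (by
      intro j
      fin_cases j
      exacts [insensitive_isFree, insensitive_isCand e', insensitive_isUsed g])
  simp only [Fin.prod_univ_two, Fin.prod_univ_three, Matrix.cons_val_zero, Matrix.cons_val_one,
    Matrix.cons_val] at h2 h3
  unfold meeting
  rw [CoinTree.expect_sub, CoinTree.expect_sum, h2]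
  congr 1
  exact Finset.sum_congr rfl fun g hg => h3 g hg

theorem commitMean_isUsed_nonneg (g : Fin I.nE) (i : ℕ) (w : Fin I.nV) (σ : Status I.nE) :
    0 ≤ commitMean (isUsed g) i w σ := by
  have h : ∀ σ : Status I.nE, 0 ≤ isUsed g σ := fun σ => by unfold isUsed; split_ifs <;> norm_num
  cases σ with
  | free =>
    refine div_nonneg (add_nonneg (tailSum_nonneg fun g' => mul_nonneg (y_nonneg _) (h _))
      (mul_nonneg (by norm_num) (h _))) ?_
    linarith [headSum_y_le_one (w := w) (i := i)]
  | cand a b lam => exact h _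
  | done a => exact h _

/-- The conditional probability of remaining free until the end; this is the factor by which
`meeting` is normalized. -/
theorem commitMean_isFree_free (i : ℕ) (w : Fin I.nV) :
    commitMean isFree i w .free = 1 / (2 - I.headSum w i I.y) := by
  rw [commitMean, pickValue]
  simp [isFree, tailSum]
  norm_num

theorem commitMean_isCand_free (i : ℕ) (w : Fin I.nV) :
    commitMean (isCand e) i w .free = 0 := by
  rw [commitMean, pickValue]
  simp [isCand, tailSum]

theorem commitMean_isUsed_free (i : ℕ) (g : Fin I.nE) :
    commitMean (isUsed g) i (I.vtx g) .free =
      (if i ≤ (g : ℕ) then I.y g else 0) / (2 - I.headSum (I.vtx g) i I.y) := by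
  rw [commitMean, pickValue, ← tailSum_single]
  simp [isUsed]

/-- If `meeting` is positive in step `e`, then the target is `e'`. -/
theorem target_of_meeting_pos {s : I.State} (hs : I.Same e e')
    (hJ : CommitInv e s) (hpos : 0 < meeting e e' e s) :
    s (I.vtx e) = .free ∧ I.target s e I.nE = some e' ∧
      meeting e e' e s ≤ 1 / (2 - I.headSum (I.vtx e) e I.y) := by
  have hf : s (I.vtx e) = .free := by
    by_contra hf
    refine hpos.ne' ?_
    have h : commitMean isFree e (I.vtx e) (s (I.vtx e)) = 0 := by
      rw [commitMean_of_ne_free hf]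
      simp [isFree, hf]
    simp [meeting, h]
  have hc : ∃ b lam, s (I.vtx e') = .cand e' b lam := by
    by_contra hc
    refine hpos.ne' ?_
    have h : commitMean (isCand e') e (I.vtx e') (s (I.vtx e')) = 0 := by
      by_cases h' : s (I.vtx e') = .free
      · rw [h', commitMean_isCand_free]
      · rw [commitMean_of_ne_free h', isCand, if_neg hc]
    simp [meeting, h]
  obtain ⟨b, lam, hc⟩ := hc
  have h2 : 0 < 2 - I.headSum (I.vtx e) e I.y := by
    linarith [headSum_y_le_one (w := I.vtx e) (i := e)]
  have hm : meeting e e' e s = 1 / (2 - I.headSum (I.vtx e) e I.y) *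
      (1 - ∑ g ∈ rivals e e', commitMean (isUsed g) e (I.vtx g) (s (I.vtx g))) := by
    have h : commitMean (isCand e') e (I.vtx e') (s (I.vtx e')) = 1 := by
      rw [commitMean_of_ne_free (by simp [hc])]
      simp [isCand, hc]
    rw [meeting, h, hf, commitMean_isFree_free, ← Finset.mul_sum]
    ring
  -- A rival that is already chosen or a candidate would contribute a full `1` to this sum, so
  -- positivity of `meeting` excludes all of them.
  have hle : ∑ g ∈ rivals e e', commitMean (isUsed g) e (I.vtx g) (s (I.vtx g)) < 1 := by
    rw [hm] at hpos
    linarith [pos_of_mul_pos_right hpos (by positivity : 0 ≤ 1 / (2 - I.headSum (I.vtx e) e I.y))]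
  have hr : ∀ g ∈ rivals e e', ¬ (s (I.vtx g) = .done g ∨ ∃ b lam, s (I.vtx g) = .cand g b lam) := by
    intro g hg hu
    have h := Finset.single_le_sum (f := fun g => commitMean (isUsed g) e (I.vtx g) (s (I.vtx g)))
      (fun g _ => commitMean_isUsed_nonneg g _ _ _) hg
    have h' : s (I.vtx g) ≠ .free := by
      rcases hu with hu | ⟨b, lam, hu⟩ <;> simp [hu]
    rw [commitMean_of_ne_free h', isUsed, if_pos hu] at h
    linarith
  refine ⟨hf, ?_, ?_⟩
  -- An inactive `e'` would come with a chosen edge of its group. That edge is not `e`, whose vertex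
  -- is free, so it would be a used rival. Likewise a target other than `e'` would be a rival with
  -- candidate status.
  · obtain rfl : b = true := by
      by_contra hb
      obtain ⟨g, hg, hsg, hdone⟩ := (hJ _ _ _ _ hc).2.2.2.2 (by simpa using hb)
      refine hr g (mem_rivals.2 ⟨hs.trans hsg, ?_, hg⟩) (Or.inl hdone)
      rintro rfl
      rw [hf] at hdone
      cases hdone
    cases ht : I.target s e I.nE with
    | none => exact absurd ht (target_ne_none hc hs _ e'.2)
    | some a =>
      obtain ⟨⟨lam', h3⟩, h4⟩ := target_spec ht
      congr 1
      by_contra hae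
      refine hr a (mem_rivals.2 ⟨h4, ?_, hae⟩) (Or.inr ⟨_, _, h3⟩)
      rintro rfl
      exact target_vtx_ne hf ht rfl
  · rw [hm]
    refine mul_le_of_le_one_right (by positivity) ?_
    linarith [Finset.sum_nonneg fun g (_ : g ∈ rivals e e') =>
      commitMean_isUsed_nonneg g e (I.vtx g) (s (I.vtx g))]

/-- The decrease of the product in step `e` is `gain` times `1 / (2 - headSum)`. -/
def gain (e : Fin I.nE) : ℝ := I.y e * (2 - I.headSum (I.vtx e) e I.y - 2 * I.y e) / 4

theorem gain_nonneg (e : Fin I.nE) : 0 ≤ gain e := by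
  have h1 := headSum_add_y_le e
  have h2 := (I.y_mem e).2
  exact div_nonneg (mul_nonneg (y_nonneg e) (by linarith)) (by norm_num)

/-- The potential subtracts `gain e * meeting` until step `e`. Before this step `meeting` is a
martingale; in step `e` the subtracted amount is covered by the actual decrease of the product;
afterwards the product is still a supermartingale. -/
theorem expect_commitLoop_mul_le_sub (hs : I.Same e e') (hne : e ≠ e') {s : I.State}
    (hJ : CommitInv 0 s) :
    (I.commitLoop s).expect (fun s' => candRoundValue 0 e (s' (I.vtx e)) *
        candRoundValue 0 e' (s' (I.vtx e'))) ≤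
      commitValue 0 e (s (I.vtx e)) * commitValue 0 e' (s (I.vtx e')) -
        gain e * meeting e e' 0 s := by
  have h := CoinTree.expect_iter_le (J := CommitInv) (f := I.onEdges I.commitStep) (n := I.nE)
    (fun i hi s hs => onEdges_all (fun h => commitStep_inv (i := ⟨i, h⟩) hs) hi)
    (φ := fun i s => commitValue i e (s (I.vtx e)) * commitValue i e' (s (I.vtx e')) -
      if i ≤ (e : ℕ) then gain e * meeting e e' i s else 0)
    (fun i hi s hJ => ?_) I.nE 0 (zero_add _) s hJ
  · simpa [commitValue_nE, commitLoop, e.2.not_ge] using h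
  · rw [onEdges, dif_pos hi]
    have hle := commitStep_expect_mul_le (i := ⟨i, hi⟩) (s := s) hs.1 hne
    rcases lt_trichotomy i e with hie | hie | hie
    · simp only [if_pos (show i + 1 ≤ (e : ℕ) from hie), if_pos hie.le]
      rw [CoinTree.expect_sub, CoinTree.expect_const_mul,
        expect_meeting (i := ⟨i, hi⟩) hs hne]
      exact sub_le_sub_right hle _
    · subst hie
      simp only [if_neg (show ¬ (e : ℕ) + 1 ≤ e by omega), le_refl, if_true, sub_zero]
      simp only [Fin.eta] at hle ⊢
      by_cases hpos : 0 < meeting e e' e s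
      · obtain ⟨hf, ht, hm⟩ := target_of_meeting_pos hs hJ hpos
        rw [commitStep_expect_mul_eq hf ht]
        exact sub_le_sub_left (mul_le_mul_of_nonneg_left hm (gain_nonneg e)) _
      -- Nonpositive `meeting` claims no decrease, so the plain supermartingale inequality suffices.
      · exact hle.trans (le_sub_self_iff _ |>.2
          (mul_nonpos_of_nonneg_of_nonpos (gain_nonneg e) (not_lt.1 hpos)))
    · simp only [if_neg (show ¬ i + 1 ≤ (e : ℕ) by omega), if_neg (show ¬ i ≤ (e : ℕ) by omega),
        sub_zero]
      exact hle

end meeting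

theorem expect_candLoop_two {v w : Fin I.nV} (h : v ≠ w) (F G : Status I.nE → ℝ) :
    (I.candLoop fun _ => .free).expect (fun s => F (s v) * G (s w)) =
      candMean F v * candMean G w := by
  simpa [Fin.prod_univ_two] using expect_candLoop (injective_vec_two h) ![F, G]

theorem expect_candLoop_three {u v w : Fin I.nV} (h : u ≠ v) (h' : u ≠ w) (h'' : v ≠ w)
    (F G H : Status I.nE → ℝ) :
    (I.candLoop fun _ => .free).expect (fun s => F (s u) * G (s v) * H (s w)) =
      candMean F u * candMean G v * candMean H w := by
  simpa [Fin.prod_univ_three] using expect_candLoop (injective_vec_three h h' h'') ![F, G, H]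

theorem sum_single (e : Fin I.nE) :
    ∑ g with I.vtx g = I.vtx e, I.y g * (if g = e then 1 else 0) = I.y e := by
  rw [← tailSum_zero, tailSum_single, if_pos (Nat.zero_le _)]

/-- No candidate with probability `2/3`, and then no commitment with probability `1/2`. -/
theorem candMean_isFree (w : Fin I.nV) : candMean (commitMean isFree 0 w) w = 1 / 3 := by
  rw [candMean, commitMean_isFree_free, headSum_zero]
  simp [commitMean, isFree]

theorem candMean_isCand (e : Fin I.nE) :
    candMean (commitMean (isCand e) 0 (I.vtx e)) (I.vtx e) = I.y e / 3 := by
  rw [candMean, commitMean_isCand_free]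
  conv_rhs => rw [← sum_single e]
  simp [commitMean, isCand]

/-- Candidate with probability `y e / 3`, or committed with probability `2/3 * y e / 2`. -/
theorem candMean_isUsed (e : Fin I.nE) :
    candMean (commitMean (isUsed e) 0 (I.vtx e)) (I.vtx e) = 2 * I.y e / 3 := by
  rw [candMean, commitMean_isUsed_free, headSum_zero]
  have : ∑ g with I.vtx g = I.vtx e, I.y g * commitMean (isUsed e) 0 (I.vtx e)
      (.cand g true ((1 + I.y g) / 2)) = I.y e := by
    conv_rhs => rw [← sum_single e]
    simp [commitMean, isUsed]
  rw [this]
  simp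
  ring

theorem expect_candLoop_meeting {e e' : Fin I.nE} (hs : I.Same e e') (hne : e ≠ e') :
    (I.candLoop fun _ => .free).expect (meeting e e' 0) =
      1 / 3 * (I.y e' / 3) * (1 - ∑ g ∈ rivals e e', 2 * I.y g / 3) := by
  unfold meeting
  rw [CoinTree.expect_sub, CoinTree.expect_sum, expect_candLoop_two (vtx_ne_of_same hs hne),
    candMean_isFree, candMean_isCand, mul_sub, mul_one, Finset.mul_sum]
  congr 1
  refine Finset.sum_congr rfl fun g hg => ?_
  obtain ⟨h1, h2, h3⟩ := mem_rivals.1 hg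
  rw [expect_candLoop_three (vtx_ne_of_same hs hne) (vtx_ne_of_same h1 h2.symm)
    (vtx_ne_of_same (hs.symm.trans h1) h3.symm), candMean_isFree, candMean_isCand, candMean_isUsed]

theorem sum_rivals_le {e e' : Fin I.nE} (hs : I.Same e e') (hne : e ≠ e') :
    ∑ g ∈ rivals e e', I.y g ≤ 1 - I.y e - I.y e' := by
  classical
  have h1 := sum_same_le_one e
  have h2 : (Finset.univ.filter fun g => I.Same e g) = insert e (insert e' (rivals e e')) := by
    ext g
    simp only [Finset.mem_filter, Finset.mem_univ, true_and, Finset.mem_insert, mem_rivals]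
    constructor
    · intro h
      by_cases h3 : g = e
      · exact Or.inl h3
      by_cases h4 : g = e'
      · exact Or.inr (Or.inl h4)
      exact Or.inr (Or.inr ⟨h, h3, h4⟩)
    · rintro (rfl | rfl | h)
      exacts [hs.trans hs.symm, hs, h.1]
  rw [h2, Finset.sum_insert (by simp [mem_rivals, hne]),
    Finset.sum_insert (by simp [mem_rivals])] at h1
  linarith

/-! ### Probabilities of the result -/

theorem rounding_expect (f : I.State → ℝ) : I.rounding.expect f =
    (I.candLoop fun _ => .free).expect fun s => (I.commitLoop s).expect fun s' =>
      ((I.candRoundLoop s').bind I.roundLoop).expect f := by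
  simp only [rounding, CoinTree.expect_bind]

theorem expect_chosen (e : Fin I.nE) : I.rounding.expect (chosen e) = I.y e := by
  rw [rounding_expect]
  have h1 : ∀ s' : I.State, Valid s' → ((I.candRoundLoop s').bind I.roundLoop).expect (chosen e) =
      candRoundValue 0 e (s' (I.vtx e)) := by
    intro s' hs'
    simpa using expect_last_loops (ι := Unit) (e := fun _ => e)
      (fun _ _ _ => rfl) hs'
  have h2 := candLoop_inv.expect_congr (f := fun s => (I.commitLoop s).expect fun s' =>
      ((I.candRoundLoop s').bind I.roundLoop).expect (chosen e))
      (g := fun s => commitValue 0 e (s (I.vtx e))) fun s hs => by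
    rw [← expect_commitLoop]
    exact (commitLoop_inv hs.commitInv).expect_congr fun s' hs' => h1 s' hs'.valid
  rw [h2, ← candMean_commitValue e]
  simpa using expect_candLoop (ι := Unit) (w := fun _ => I.vtx e)
    (fun _ _ _ => rfl) fun _ => commitValue 0 e

/-- Given the state after the second loop, the two vertices are rounded independently. It remains to
bound the product of conditional probabilities over the second loop and to average over the first.
-/
theorem expect_chosen_mul_le_of_forall {e e' : Fin I.nE} (hv : I.vtx e ≠ I.vtx e')
    {φ : I.State → ℝ} (h : ∀ s, CandInv s → (I.commitLoop s).expect (fun s' =>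
      candRoundValue 0 e (s' (I.vtx e)) * candRoundValue 0 e' (s' (I.vtx e'))) ≤ φ s) :
    I.rounding.expect (fun s => chosen e s * chosen e' s) ≤
      (I.candLoop fun _ => .free).expect φ := by
  rw [rounding_expect]
  refine candLoop_inv.expect_le fun s hs => le_trans (le_of_eq ?_) (h s hs)
  refine (commitLoop_inv hs.commitInv).expect_congr fun s' hs' => ?_
  have := expect_last_loops (ι := Fin 2) (e := ![e, e']) (s := s') (fun i j hij => by
    refine injective_vec_two hv ?_
    fin_cases i <;> fin_cases j <;> exact hij) hs'.valid
  simpa [Fin.prod_univ_two] using this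

theorem expect_chosen_mul_le {e e' : Fin I.nE} (hu : (I.ends e).1 = (I.ends e').1)
    (hne : e ≠ e') :
    I.rounding.expect (fun s => chosen e s * chosen e' s) ≤ I.y e * I.y e' := by
  have hv : I.vtx e ≠ I.vtx e' := fun h => hne (edge_ext hu h)
  refine (expect_chosen_mul_le_of_forall hv
    fun s _ => expect_commitLoop_mul_le hu hne s).trans (le_of_eq ?_)
  rw [expect_candLoop_two hv, candMean_commitValue, candMean_commitValue]

/-- The constant is `1/4 * 1/9 * 1/3`: the first factor from `gain`, the second from the
probabilities that the vertex of `e` stays free and that `e'` is a candidate, the third from `h7`.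
-/
theorem expect_chosen_mul_le_of_le_half {e e' : Fin I.nE} (hs : I.Same e e') (hne : e ≠ e')
    (he : I.y e ≤ 1 / 2) :
    I.rounding.expect (fun s => chosen e s * chosen e' s) ≤
      (1 - 1 / 108) * (I.y e * I.y e') := by
  have hv : I.vtx e ≠ I.vtx e' := vtx_ne_of_same hs hne
  refine (expect_chosen_mul_le_of_forall hv
    fun s h => expect_commitLoop_mul_le_sub hs hne h.commitInv).trans ?_
  rw [CoinTree.expect_sub, CoinTree.expect_const_mul, expect_candLoop_two hv,
    candMean_commitValue, candMean_commitValue, expect_candLoop_meeting hs hne]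
  have h1 := sum_rivals_le hs hne
  have h2 := headSum_add_y_le e
  have h3 := y_nonneg e
  have h4 := y_nonneg e'
  have h5 : 1 / 3 + 2 / 3 * I.y e ≤ 1 - ∑ g ∈ rivals e e', 2 * I.y g / 3 := by
    rw [← Finset.sum_div, ← Finset.mul_sum]
    linarith
  have h6 : 1 - I.y e ≤ 2 - I.headSum (I.vtx e) e I.y - 2 * I.y e := by linarith
  have h7 : 1 / 3 ≤ (2 - I.headSum (I.vtx e) e I.y - 2 * I.y e) *
      (1 - ∑ g ∈ rivals e e', 2 * I.y g / 3) := by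
    refine le_trans ?_ (mul_le_mul h6 h5 (by linarith) (by linarith))
    -- Here `(1 - y) * (1 + 2 * y) = 1 + y * (1 - 2 * y) ≥ 1`, which is where `y e ≤ 1/2` enters.
    nlinarith
  have h8 := mul_le_mul_of_nonneg_left h7 (mul_nonneg h3 h4)
  unfold gain
  linarith

/-- The group has mass at most `1`, so one of the two edges has `y ≤ 1/2`, and the claim is
symmetric in them. -/
theorem expect_chosen_mul_le_of_same {e e' : Fin I.nE} (hs : I.Same e e') (hne : e ≠ e') :
    I.rounding.expect (fun s => chosen e s * chosen e' s) ≤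
      (1 - 1 / 108) * (I.y e * I.y e') := by
  have h1 := sum_rivals_le hs hne
  have h2 : 0 ≤ ∑ g ∈ rivals e e', I.y g := Finset.sum_nonneg fun g _ => y_nonneg g
  rcases le_total (I.y e) (1 / 2) with h | h
  · exact expect_chosen_mul_le_of_le_half hs hne h
  · have := expect_chosen_mul_le_of_le_half hs.symm hne.symm (by linarith)
    simpa only [mul_comm] using this

end RoundingInstance

/-! ### Bounds on the memory, and rules for simulating assignments and coins. -/

namespace RandRAM

/-- Natural numbers are at most `N`; real numbers lie in `L` and in `[-4,4]`. -/
def Mem.Bounded (L : AddSubgroup ℝ) (N : ℕ) (m : Mem) : Prop :=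
  (∀ a i, m.nat a i ≤ N) ∧ ∀ a i, m.real a i ∈ L ∧ |m.real a i| ≤ 4

theorem Mem.setNat_nat (m : Mem) (a i k b j : ℕ) :
    (m.setNat a i k).nat b j = if b = a ∧ j = i then k else m.nat b j := rfl

theorem Mem.setNat_real (m : Mem) (a i k : ℕ) : (m.setNat a i k).real = m.real := rfl

theorem Mem.setReal_real (m : Mem) (a i : ℕ) (x : ℝ) (b j : ℕ) :
    (m.setReal a i x).real b j = if b = a ∧ j = i then x else m.real b j := rfl

theorem Mem.setReal_nat (m : Mem) (a i : ℕ) (x : ℝ) : (m.setReal a i x).nat = m.nat := rfl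

section bounded

variable {L : AddSubgroup ℝ} {N : ℕ} {m : Mem}

theorem Mem.Bounded.setNat (h : m.Bounded L N) {a i k : ℕ} (hk : k ≤ N) :
    (m.setNat a i k).Bounded L N := by
  refine ⟨fun b j => ?_, h.2⟩
  rw [Mem.setNat_nat]
  split_ifs
  exacts [hk, h.1 b j]

theorem Mem.Bounded.setReal (h : m.Bounded L N) {a i : ℕ} {x : ℝ} (hx : x ∈ L) (h4 : |x| ≤ 4) :
    (m.setReal a i x).Bounded L N := by
  refine ⟨h.1, fun b j => ?_⟩
  rw [Mem.setReal_real]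
  split_ifs
  exacts [⟨hx, h4⟩, h.2 b j]

end bounded

namespace CoinTree

theorem bind_ret {α : Type} (t : CoinTree α) : t.bind ret = t := by
  induction t with
  | ret a => rfl
  | flip p t u ht hu => simp only [bind, ht, hu]

theorem iter_ret {α : Type} (s : α) : ∀ k i, iter (fun _ s => ret s) k i s = ret s
  | 0, _ => rfl
  | k + 1, i => iter_ret s k (i + 1)

end CoinTree

namespace Sim

variable {α : Type} {J : Mem → Prop} {R : α → Mem → Prop} {T : ℕ} {k : List Cmd} {m : Mem}
  {t u : CoinTree α}

theorem setNat_eval {a : ℕ} {i e : NExp} {x y : ℕ} (hm : J m) (hi : i.eval m = x)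
    (he : e.eval m = y) (h : Sim J R T (k, m.setNat a x y) t) :
    Sim J R (T + 1) (.setNat a i e :: k, m) t := by
  subst hi he
  exact setNat hm h

theorem setReal_eval {a : ℕ} {i : NExp} {e : RExp} {x : ℕ} {y : ℝ} (hm : J m)
    (hi : i.eval m = x) (he : e.eval m = y) (h : Sim J R T (k, m.setReal a x y) t) :
    Sim J R (T + 1) (.setReal a i e :: k, m) t := by
  subst hi he
  exact setReal hm h

theorem ite_pos {b : BExp} {c d : Cmd} (hm : J m) (hb : b.eval m)
    (h : Sim J R T (c :: k, m) t) : Sim J R (T + 1) (.ite b c d :: k, m) t :=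
  ite hm (fun _ => h) fun h' => absurd hb h'

theorem ite_neg {b : BExp} {c d : Cmd} (hm : J m) (hb : ¬ b.eval m)
    (h : Sim J R T (d :: k, m) t) : Sim J R (T + 1) (.ite b c d :: k, m) t :=
  ite hm (fun h' => absurd h' hb) fun _ => h

/-- Tossing a coin into the cell `0` of the array `a` and branching. -/
theorem flip_ite {a : ℕ} {r : RExp} {p : ℝ} {c d : Cmd} (hm : J m) (hp : r.eval m = p)
    (h1 : J (m.setNat a 0 1)) (h0 : J (m.setNat a 0 0))
    (hc : Sim J R T (c :: k, m.setNat a 0 1) t) (hd : Sim J R T (d :: k, m.setNat a 0 0) u) :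
    Sim J R (T + 3) (.seq (.flip a (.const 0) r)
      (.ite (.neq (.get a (.const 0)) (.const 1)) c d) :: k, m) (.flip p t u) := by
  refine seq hm (.flip _ _ _ _ _ _ _ _ _ hm hp (ite_pos h1 ?_ hc) (ite_neg h0 ?_ hd))
  · simp [BExp.eval, NExp.eval, Mem.setNat_nat]
  · simp [BExp.eval, NExp.eval, Mem.setNat_nat]

end Sim

end RandRAM

/-! ### The program, and how the memory represents a state. -/

namespace RoundingInstance

open RandRAM

/-! ### The program -/

/-- The current edge. -/
def curEdge : NExp := .get 8 (.const 0)

/-- The end point of the current edge. -/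
def curVtx : NExp := .get 2 curEdge

/-- The probability `y / (3 - S)`. -/
def pickExp : RExp := .div (.get 0 curEdge) (.sub (.const 3) (.get 1 curVtx))

def nextEdge : Cmd := .setNat 8 (.const 0) (.add curEdge (.const 1))

/-- Perform `c` for all edges. -/
def forEdges (c : Cmd) : Cmd :=
  .seq (.setNat 8 (.const 0) (.const 0))
    (.loop (.nlt curEdge (.get 0 (.const 2))) (.seq c nextEdge))

def isStatus (k : ℕ) : BExp := .neq (.get 6 curVtx) (.const k)

def addToSum : Cmd := .setReal 1 curVtx (.add (.get 1 curVtx) (.get 0 curEdge))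

def choose : Cmd := .seq (.setNat 5 curEdge (.const 1)) (.setNat 6 curVtx (.const 3))

/-- Toss a coin and branch. -/
def toss (r : RExp) (c d : Cmd) : Cmd :=
  .seq (.flip 9 (.const 0) r) (.ite (.neq (.get 9 (.const 0)) (.const 1)) c d)

/-- The initial sum `2 + y` of a candidate makes the formula `y / (3 - S)` of `pickExp` serve all
loops: the sum of a free vertex runs from `0` to `1`, `1` to `2` and `2` to `3` in the three loops
that use it, and that of a rejected candidate starts the last loop with normalization `1 - y a`. -/
def candBody : Cmd :=
  .ite (isStatus 0)
    (toss pickExp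
      (.seq (.setNat 6 curVtx (.const 1))
        (.seq (.setNat 7 curVtx curEdge)
          (.seq (.setReal 2 curVtx (.div (.add (.const 1) (.get 0 curEdge)) (.const 2)))
            (.setReal 1 curVtx (.add (.const 2) (.get 0 curEdge))))))
      addToSum)
    .skip

def scanEdge : NExp := .get 10 (.const 0)

/-- The last conjunct is needed because edges outside all groups share the label `0`. -/
def isTarget : BExp :=
  .and (.neq (.get 6 (.get 2 scanEdge)) (.const 1))
    (.and (.neq (.get 7 (.get 2 scanEdge)) scanEdge)
      (.and (.neq (.get 1 curEdge) (.get 1 scanEdge))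
        (.and (.neq (.get 3 curEdge) (.get 3 scanEdge))
          (.not (.neq (.get 3 curEdge) (.const 0))))))

/-- Scanning upwards and overwriting keeps the last match. The cell holds the edge number plus one,
so that `0` can stand for no target. -/
def findTarget : Cmd :=
  .seq (.setNat 11 (.const 0) (.const 0))
    (.seq (.setNat 10 (.const 0) (.const 0))
      (.loop (.nlt scanEdge (.get 0 (.const 2)))
        (.seq (.ite isTarget (.setNat 11 (.const 0) (.add scanEdge (.const 1))) .skip)
          (.setNat 10 (.const 0) (.add scanEdge (.const 1))))))

def noTarget : BExp := .neq (.get 11 (.const 0)) (.const 0)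

def targetVtx : NExp := .get 2 (.sub (.get 11 (.const 0)) (.const 1))

def commitBody : Cmd :=
  .ite (isStatus 0)
    (.seq findTarget
      (toss pickExp
        (.seq
          (.ite noTarget .skip
            (.seq
              (.setReal 2 targetVtx (.sub (.get 2 targetVtx)
                (.div (.sub (.sub (.const 3) (.get 1 curVtx)) (.get 0 curEdge)) (.const 4))))
              (.setNat 6 targetVtx (.const 2))))
          choose)
        (.seq
          (.ite noTarget .skip
            (.setReal 2 targetVtx (.add (.get 2 targetVtx) (.div (.get 0 curEdge) (.const 4)))))
          addToSum)))
    .skip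

def candRoundBody : Cmd :=
  .ite (.and (.not (isStatus 0)) (.and (.not (isStatus 3)) (.neq (.get 7 curVtx) curEdge)))
    (toss (.get 2 curVtx) choose .skip)
    .skip

def roundBody : Cmd :=
  .ite (.and (.not (isStatus 3)) (.not (.and (.not (isStatus 0)) (.neq (.get 7 curVtx) curEdge))))
    (toss pickExp choose addToSum)
    .skip

def program : Cmd :=
  .seq (forEdges candBody) (.seq (forEdges commitBody)
    (.seq (forEdges candRoundBody) (forEdges roundBody)))

/-! ### Representation of states in the memory -/

variable (I : RoundingInstance)

/-- A status is represented by its kind `k`, its edge `c`, its probability `x` and the sum `S` of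
the weights that were already used in choices. -/
def StatusRep (k c : ℕ) (x S : ℝ) (sf : ℝ) (sc : Fin I.nE → ℝ) : Status I.nE → Prop
  | .free => k = 0 ∧ S = sf
  | .cand a b lam => k = (if b = true then 1 else 2) ∧ c = a ∧ x = lam ∧ S = sc a
  | .done _ => k = 3

/-- The memory `m` represents the state `s`, with current edge `i` and sums `sf` and `sc` at free
vertices and at vertices with candidates. -/
structure Rep (i : ℕ) (sf : Fin I.nV → ℝ) (sc : Fin I.nV → Fin I.nE → ℝ) (s : I.State)
    (m : Mem) : Prop where
  nat_input : ∀ a ≤ 4, m.nat a = I.input.nat a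
  real_input : m.real 0 = I.input.real 0
  cur : m.nat 8 0 = i
  status : ∀ v : Fin I.nV,
    I.StatusRep (m.nat 6 v) (m.nat 7 v) (m.real 2 v) (m.real 1 v) (sf v) (sc v) (s v)
  out : ∀ e : Fin I.nE, m.nat 5 e ≠ 0 ↔ s (I.vtx e) = .done e

variable {I}

namespace Rep

variable {i : ℕ} {sf sf' : Fin I.nV → ℝ} {sc sc' : Fin I.nV → Fin I.nE → ℝ} {s : I.State} {m : Mem}

theorem nat_zero (h : I.Rep i sf sc s m) : m.nat 0 2 = I.nE := by
  rw [h.nat_input 0 (by norm_num)]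
  simp [input]

theorem nat_one (h : I.Rep i sf sc s m) (e : Fin I.nE) : m.nat 1 e = (I.ends e).1 := by
  rw [h.nat_input 1 (by norm_num)]
  simp [input]

theorem nat_two (h : I.Rep i sf sc s m) (e : Fin I.nE) : m.nat 2 e = I.vtx e := by
  rw [h.nat_input 2 (by norm_num)]
  simp [input, vtx]

theorem nat_three (h : I.Rep i sf sc s m) (e : Fin I.nE) : m.nat 3 e = I.label e := by
  rw [h.nat_input 3 (by norm_num)]
  simp [input]

theorem real_zero (h : I.Rep i sf sc s m) (e : Fin I.nE) : m.real 0 e = I.y e := by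
  rw [h.real_input]
  simp [input]

/-- Changing the status of one vertex. -/
theorem update (h : I.Rep i sf sc s m) {v : Fin I.nV} {σ : Status I.nE} {m' : Mem}
    (h4 : ∀ a ≤ 4, m'.nat a = m.nat a) (h8 : m'.nat 8 0 = m.nat 8 0) (h0 : m'.real 0 = m.real 0)
    (hne : ∀ w : ℕ, w ≠ v → m'.nat 6 w = m.nat 6 w ∧ m'.nat 7 w = m.nat 7 w ∧
      m'.real 2 w = m.real 2 w ∧ m'.real 1 w = m.real 1 w)
    (hv : I.StatusRep (m'.nat 6 v) (m'.nat 7 v) (m'.real 2 v) (m'.real 1 v) (sf' v) (sc' v) σ)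
    (hsf : ∀ w, w ≠ v → sf' w = sf w) (hsc : ∀ w, w ≠ v → sc' w = sc w)
    (ho : ∀ e, I.vtx e = v → (m'.nat 5 e ≠ 0 ↔ σ = .done e))
    (ho' : ∀ e, I.vtx e ≠ v → m'.nat 5 e = m.nat 5 e) :
    I.Rep i sf' sc' (Function.update s v σ) m' where
  nat_input a ha := (h4 a ha).trans (h.nat_input a ha)
  real_input := h0.trans h.real_input
  cur := h8.trans h.cur
  status w := by
    rcases eq_or_ne w v with rfl | hw
    · rwa [Function.update_self]
    · obtain ⟨h1, h2, h3, h5⟩ := hne w fun h => hw (Fin.ext h)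
      rw [Function.update_of_ne hw, h1, h2, h3, h5, hsf w hw, hsc w hw]
      exact h.status w
  out e := by
    by_cases he : I.vtx e = v
    · rw [he, Function.update_self]
      exact ho e he
    · rw [Function.update_of_ne he, ho' e he]
      exact h.out e

theorem congr_sums (h : I.Rep i sf sc s m) (hsf : ∀ v, s v = .free → sf' v = sf v)
    (hsc : ∀ v a b lam, s v = .cand a b lam → sc' v a = sc v a) : I.Rep i sf' sc' s m :=
  { h with
    status := fun v => by
      have h1 := h.status v
      cases hs : s v with
      | free =>
        rw [hs] at h1
        exact ⟨h1.1, h1.2.trans (hsf v hs).symm⟩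
      | cand a b lam =>
        rw [hs] at h1
        exact ⟨h1.1, h1.2.1, h1.2.2.1, h1.2.2.2.trans (hsc v a b lam hs).symm⟩
      | done a =>
        rw [hs] at h1
        exact h1 }

theorem setNat_temp (h : I.Rep i sf sc s m) {a : ℕ} (ha : 9 ≤ a) (j k : ℕ) :
    I.Rep i sf sc s (m.setNat a j k) where
  nat_input b hb := by
    rw [← h.nat_input b hb]
    funext x
    rw [Mem.setNat_nat, if_neg (by omega)]
  real_input := h.real_input
  cur := by rw [Mem.setNat_nat, if_neg (by omega), h.cur]
  status v := by
    rw [Mem.setNat_nat, if_neg (by omega), Mem.setNat_nat, if_neg (by omega)]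
    exact h.status v
  out e := by
    rw [Mem.setNat_nat, if_neg (by omega)]
    exact h.out e

theorem setNat_cur (h : I.Rep i sf sc s m) (k : ℕ) : I.Rep k sf sc s (m.setNat 8 0 k) where
  nat_input b hb := by
    rw [← h.nat_input b hb]
    funext x
    rw [Mem.setNat_nat, if_neg (by omega)]
  real_input := h.real_input
  cur := by rw [Mem.setNat_nat, if_pos ⟨rfl, rfl⟩]
  status v := by
    rw [Mem.setNat_nat, if_neg (by omega), Mem.setNat_nat, if_neg (by omega)]
    exact h.status v
  out e := by
    rw [Mem.setNat_nat, if_neg (by omega)]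
    exact h.out e

variable {e : Fin I.nE}

theorem eval_curEdge (h : I.Rep e sf sc s m) : curEdge.eval m = e := h.cur

theorem eval_curVtx (h : I.Rep e sf sc s m) : curVtx.eval m = I.vtx e := by
  rw [curVtx, NExp.eval, h.eval_curEdge, h.nat_two]

theorem eval_isStatus (h : I.Rep e sf sc s m) (k : ℕ) :
    (isStatus k).eval m ↔ m.nat 6 (I.vtx e) = k := by
  simp only [isStatus, BExp.eval, NExp.eval, h.eval_curVtx]

theorem eval_pickExp (h : I.Rep e sf sc s m) :
    pickExp.eval m = I.y e / (3 - m.real 1 (I.vtx e)) := by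
  simp only [pickExp, RExp.eval, h.eval_curVtx, h.eval_curEdge, h.real_zero]
  norm_num

end Rep

/-! ### Simulation of the loops -/

/-- The assumptions on the bounds of the numbers in the memory. -/
structure Bounds (I : RoundingInstance) (L : AddSubgroup ℝ) (N : ℕ) : Prop where
  nE_lt : I.nE < N
  three_le : 3 ≤ N
  half_mem : (1 / 2 : ℝ) ∈ L
  y_mem : ∀ e, I.y e / 4 ∈ L

section sim

variable {L : AddSubgroup ℝ} {N : ℕ} {T : ℕ}

/-- The expected sums `sf` and `sc` depend on the loop counter: the body moves them from `i` to `i +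
1` while the current edge is still `i`, and only then the counter advances. -/
theorem forEdges_sim (hB : Bounds I L N) {c : Cmd} {f : Fin I.nE → I.State → CoinTree I.State}
    {Inv : ℕ → I.State → Prop} {sf : ℕ → Fin I.nV → ℝ} {sc : ℕ → Fin I.nV → Fin I.nE → ℝ}
    (hInv : ∀ (i : Fin I.nE) s, Inv i s → (f i s).All (Inv ((i : ℕ) + 1)))
    (hc : ∀ (i : Fin I.nE) s m, m.Bounded L N → Inv i s → I.Rep i (sf i) (sc i) s m →
      Sim (Mem.Bounded L N) (I.Rep i (sf ((i : ℕ) + 1)) (sc ((i : ℕ) + 1))) T ([c], m) (f i s))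
    {i : ℕ} {s : I.State} {m : Mem} (hm : m.Bounded L N) (hs : Inv 0 s)
    (hR : I.Rep i (sf 0) (sc 0) s m) :
    Sim (Mem.Bounded L N) (fun s m => Inv I.nE s ∧ I.Rep I.nE (sf I.nE) (sc I.nE) s m)
      (I.nE * (T + 3) + 3) ([forEdges c], m) (.iter (I.onEdges f) I.nE 0 s) := by
  have hm' : (m.setNat 8 0 0).Bounded L N := hm.setNat (by omega)
  refine Sim.seq hm (Sim.setNat_eval (x := 0) (y := 0) hm rfl rfl ?_)
  refine Sim.loop_iter (R := fun i s m => Inv i s ∧ I.Rep i (sf i) (sc i) s m) (n := I.nE)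
    (T := T + 2) ?_ ?_ I.nE 0 (zero_add _) s _ hm' ⟨hs, hR.setNat_cur 0⟩
  · intro i s m h
    simp [BExp.eval, NExp.eval, curEdge, h.2.nat_zero, h.2.cur]
  · rintro i hi s m hm ⟨hs, hR⟩
    rw [onEdges, dif_pos hi]
    have h1 := (hc ⟨i, hi⟩ s m hm hs hR).and_all (hInv ⟨i, hi⟩ s hs)
    refine Sim.seq hm ?_
    refine ((h1.cons (T' := 1) (g := .ret)) fun s' m' hm' hR' => ?_).of_eq (CoinTree.bind_ret _)
    have he : NExp.eval m' (.add curEdge (.const 1)) = i + 1 := by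
      rw [NExp.eval, hR'.2.eval_curEdge, NExp.eval]
    exact Sim.setNat_eval hm' rfl he (.ret _ _ _ (hm'.setNat (by have := hB.nE_lt; omega))
      ⟨hR'.1, hR'.2.setNat_cur _⟩)

theorem Bounds.y_mem' (hB : Bounds I L N) (e : Fin I.nE) : I.y e ∈ L := by
  have h := L.nsmul_mem (hB.y_mem e) 4
  have h' : 4 • (I.y e / 4) = I.y e := by rw [nsmul_eq_mul]; push_cast; ring
  rwa [h'] at h

theorem Bounds.one_mem (hB : Bounds I L N) : (1 : ℝ) ∈ L := by
  have h := L.add_mem hB.half_mem hB.half_mem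
  norm_num at h
  exact h

theorem Bounds.headSum_mem (hB : Bounds I L N) (w : Fin I.nV) (i : ℕ) : I.headSum w i I.y ∈ L :=
  L.sum_mem fun g _ => hB.y_mem' g

end sim

end RoundingInstance

/-! ### Simulation of the loops whose steps touch one vertex only. -/

namespace RoundingInstance

open RandRAM

variable {I : RoundingInstance} {L : AddSubgroup ℝ} {N : ℕ}

theorem abs_le_four {x : ℝ} (h0 : 0 ≤ x) (h4 : x ≤ 4) : |x| ≤ 4 := by rwa [abs_of_nonneg h0]

theorem edge_coe_ne {e g : Fin I.nE} (h : I.vtx g ≠ I.vtx e) : (g : ℕ) ≠ e :=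
  fun h' => h (by rw [Fin.ext h'])

section own

variable {e : Fin I.nE} {s : I.State} {m : Mem} {sf sf' : Fin I.nV → ℝ}
  {sc sc' : Fin I.nV → Fin I.nE → ℝ} {T : ℕ}

/-- Choosing the current edge. -/
theorem choose_sim (hB : Bounds I L N) (hm : m.Bounded L N) (hR : I.Rep e sf sc s m)
    (hsf : ∀ w, w ≠ I.vtx e → sf' w = sf w) (hsc : ∀ w, w ≠ I.vtx e → sc' w = sc w)
    (hne : ∀ a, s (I.vtx e) ≠ .done a) :
    Sim (Mem.Bounded L N) (I.Rep e sf' sc') 3 ([choose], m)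
      (.ret (Function.update s (I.vtx e) (.done e))) := by
  have h3 := hB.three_le
  have hm' : (m.setNat 5 e 1).Bounded L N := hm.setNat (by omega)
  have he : curEdge.eval m = e := hR.eval_curEdge
  have hv : curVtx.eval (m.setNat 5 e 1) = I.vtx e := by
    simp [curVtx, curEdge, NExp.eval, Mem.setNat_nat, hR.cur, hR.nat_two]
  refine Sim.seq hm (Sim.setNat_eval hm he rfl (Sim.setNat_eval hm' hv rfl
    (.ret _ _ _ (hm'.setNat h3) ?_)))
  refine hR.update (fun a ha => ?_) ?_ ?_ (fun w hw => ?_) ?_ hsf hsc (fun g hg => ?_)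
    (fun g hg => ?_)
  · funext x
    simp only [Mem.setNat_nat]
    rw [if_neg (by omega), if_neg (by omega)]
  · simp [Mem.setNat_nat, NExp.eval]
  · rfl
  · simp [Mem.setNat_nat, NExp.eval, Mem.setNat_real, hw]
  · simp [Mem.setNat_nat, NExp.eval, StatusRep]
  · have h1 := hR.out g
    simp only [Mem.setNat_nat, NExp.eval]
    by_cases hge : g = e
    · subst hge
      simp
    · have hge' : (g : ℕ) ≠ e := fun h => hge (Fin.ext h)
      -- The vertex had not chosen before, so the output cells of its other edges are still zero.
      rw [hg] at h1
      simp [hge', Ne.symm hge, hne] at h1 ⊢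
      exact h1
  · simp [Mem.setNat_nat, NExp.eval, edge_coe_ne hg]

/-- Adding the weight of the current edge to the sum of its end point. -/
theorem addToSum_sim (hm : m.Bounded L N) (hR : I.Rep e sf sc s m)
    (hsf : ∀ w, w ≠ I.vtx e → sf' w = sf w) (hsc : ∀ w, w ≠ I.vtx e → sc' w = sc w)
    (hf : s (I.vtx e) = .free → sf' (I.vtx e) = sf (I.vtx e) + I.y e)
    (hc : ∀ a b lam, s (I.vtx e) = .cand a b lam →
      sc' (I.vtx e) a = sc (I.vtx e) a + I.y e)
    (hmem : m.real 1 (I.vtx e) + I.y e ∈ L) (habs : |m.real 1 (I.vtx e) + I.y e| ≤ 4) :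
    Sim (Mem.Bounded L N) (I.Rep e sf' sc') 1 ([addToSum], m) (.ret s) := by
  have hval : RExp.eval m (.add (.get 1 curVtx) (.get 0 curEdge)) =
      m.real 1 (I.vtx e) + I.y e := by
    simp only [RExp.eval, hR.eval_curVtx, hR.eval_curEdge, hR.real_zero]
  refine Sim.setReal_eval hm hR.eval_curVtx hval (.ret _ _ _ (hm.setReal hmem habs) ?_)
  -- The state does not change, but as a trivial update it falls under `Rep.update`, which allows
  -- the sums at this vertex to change.
  rw [← Function.update_eq_self (I.vtx e) s]
  refine hR.update (fun a ha => rfl) rfl ?_ (fun w hw => ?_) ?_ hsf hsc (fun g hg => ?_)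
    (fun g hg => rfl)
  · funext x
    simp [Mem.setReal_real]
  · simp [Mem.setReal_nat, Mem.setReal_real, hw]
  · have h1 := hR.status (I.vtx e)
    cases hs : s (I.vtx e) with
    | free =>
      rw [hs] at h1
      refine ⟨h1.1, ?_⟩
      rw [hf hs, ← h1.2]
      simp [Mem.setReal_real]
    | cand a b lam =>
      rw [hs] at h1
      refine ⟨h1.1, h1.2.1, ?_, ?_⟩
      · rw [← h1.2.2.1]
        simp [Mem.setReal_real]
      · rw [hc a b lam hs, ← h1.2.2.2]
        simp [Mem.setReal_real]
    | done a =>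
      rw [hs] at h1
      exact h1
  · rw [← hg]
    exact hR.out g

theorem Rep.isStatus_zero (hR : I.Rep e sf sc s m) :
    (isStatus 0).eval m ↔ s (I.vtx e) = .free := by
  rw [hR.eval_isStatus]
  have h1 := hR.status (I.vtx e)
  cases hs : s (I.vtx e) with
  | free =>
    rw [hs] at h1
    simp [h1.1]
  | cand a b lam =>
    rw [hs] at h1
    rw [h1.1]
    cases b <;> simp
  | done a =>
    rw [hs] at h1
    simp [show m.nat 6 (I.vtx e) = 3 from h1]

theorem Rep.isStatus_three (hR : I.Rep e sf sc s m) :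
    (isStatus 3).eval m ↔ ∃ a, s (I.vtx e) = .done a := by
  rw [hR.eval_isStatus]
  have h1 := hR.status (I.vtx e)
  cases hs : s (I.vtx e) with
  | free =>
    rw [hs] at h1
    simp [h1.1]
  | cand a b lam =>
    rw [hs] at h1
    rw [h1.1]
    cases b <;> simp
  | done a =>
    rw [hs] at h1
    simp [show m.nat 6 (I.vtx e) = 3 from h1]

theorem Rep.sum_free (hR : I.Rep e sf sc s m) {v : Fin I.nV} (hs : s v = .free) :
    m.real 1 v = sf v := by
  have h1 := hR.status v
  rw [hs] at h1
  exact h1.2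

theorem Rep.of_cand (hR : I.Rep e sf sc s m) {v : Fin I.nV} {a : Fin I.nE} {b : Bool} {lam : ℝ}
    (hs : s v = .cand a b lam) : m.nat 6 v = (if b = true then 1 else 2) ∧ m.nat 7 v = a ∧
      m.real 2 v = lam ∧ m.real 1 v = sc v a := by
  have h1 := hR.status v
  rwa [hs] at h1

/-- Steps in which nothing happens. -/
theorem skip_sim (hm : m.Bounded L N) (hR : I.Rep e sf sc s m)
    (hsf : ∀ w, s w = .free → sf' w = sf w)
    (hsc : ∀ w a b lam, s w = .cand a b lam → sc' w a = sc w a) :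
    Sim (Mem.Bounded L N) (I.Rep e sf' sc') 1 ([.skip], m) (.ret s) :=
  Sim.skip hm (.ret _ _ _ hm (hR.congr_sums hsf hsc))

end own

theorem headSum_succ_self (e : Fin I.nE) (x : Fin I.nE → ℝ) :
    I.headSum (I.vtx e) ((e : ℕ) + 1) x = I.headSum (I.vtx e) e x + x e :=
  headSum_succ e.2 rfl

theorem headSum_succ_of_vtx_ne {e : Fin I.nE} {w : Fin I.nV} (h : w ≠ I.vtx e)
    (x : Fin I.nE → ℝ) : I.headSum w ((e : ℕ) + 1) x = I.headSum w e x :=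
  headSum_succ_of_ne e.2 (Ne.symm h)

/-- The sums at vertices with candidates during the first three loops. -/
def candSum (_ : Fin I.nV) (a : Fin I.nE) : ℝ := 2 + I.y a

theorem ownStep_ret {v : Fin I.nV} {κ : Status I.nE → CoinTree (Status I.nE)} {s : I.State}
    (h : κ (s v) = .ret (s v)) : I.ownStep v κ s = .ret s := by
  rw [ownStep, h, CoinTree.ret_bind, Function.update_eq_self]

theorem candBody_sim (hB : Bounds I L N) (e : Fin I.nE) (s : I.State) (m : Mem)
    (hm : m.Bounded L N) (hR : I.Rep e (fun v => I.headSum v e I.y) candSum s m) :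
    Sim (Mem.Bounded L N) (I.Rep e (fun v => I.headSum v ((e : ℕ) + 1) I.y) candSum) 11
      ([candBody], m) (I.ownStep (I.vtx e) (I.candKernel e) s) := by
  have hsf := fun w (hw : w ≠ I.vtx e) => headSum_succ_of_vtx_ne hw I.y
  have h3 := hB.three_le
  have hy := I.y_mem e
  by_cases hf : s (I.vtx e) = .free
  swap
  · refine Sim.ite_neg hm (fun h => hf (hR.isStatus_zero.1 h)) ?_
    refine ((skip_sim hm hR (fun w hw => hsf w ?_) fun _ _ _ _ _ => rfl).mono
      (by norm_num)).of_eq (ownStep_ret ?_).symm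
    · rintro rfl
      exact hf hw
    · cases hs : s (I.vtx e) with
      | free => exact absurd hs hf
      | cand a b lam => rfl
      | done a => rfl
  · refine Sim.ite_pos hm (hR.isStatus_zero.2 hf) ?_
    have hp := hR.eval_pickExp
    rw [hR.sum_free hf] at hp
    rw [ownStep, hf, candKernel, CoinTree.flip_bind, CoinTree.ret_bind, CoinTree.ret_bind, ← hf,
      Function.update_eq_self]
    have hm1 : (m.setNat 9 0 1).Bounded L N := hm.setNat (by omega)
    have hm0 : (m.setNat 9 0 0).Bounded L N := hm.setNat (by omega)
    have hR1 := hR.setNat_temp (a := 9) le_rfl 0 1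
    have hR0 := hR.setNat_temp (a := 9) le_rfl 0 0
    refine Sim.flip_ite (T := 7) hm hp hm1 hm0 ?_ ?_
    · generalize m.setNat 9 0 1 = m at hm1 hR1
      have hm2 : (m.setNat 6 (I.vtx e) 1).Bounded L N := hm1.setNat (by omega)
      have hm3 : ((m.setNat 6 (I.vtx e) 1).setNat 7 (I.vtx e) e).Bounded L N :=
        hm2.setNat (e.2.trans hB.nE_lt).le
      have hx : (1 + I.y e) / 2 ∈ L := by
        have := L.add_mem hB.half_mem (L.nsmul_mem (hB.y_mem e) 2)
        convert this using 1
        rw [nsmul_eq_mul]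
        push_cast
        ring
      have hm4 := hm3.setReal (a := 2) (i := I.vtx e) hx
        (abs_le_four (by linarith [hy.1]) (by linarith [hy.2]))
      have hx' : 2 + I.y e ∈ L := by
        have := L.add_mem (L.add_mem hB.one_mem hB.one_mem) (hB.y_mem' e)
        norm_num at this
        exact this
      have hm5 := hm4.setReal (a := 1) (i := I.vtx e) hx'
        (abs_le_four (by linarith [hy.1]) (by linarith [hy.2]))
      refine Sim.seq hm1 (Sim.setNat_eval hm1 hR1.eval_curVtx rfl
        (Sim.seq hm2 (Sim.setNat_eval (x := I.vtx e) (y := e) hm2 ?_ ?_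
        (Sim.seq hm3 (Sim.setReal_eval (x := I.vtx e) (y := (1 + I.y e) / 2) hm3 ?_ ?_
        (Sim.setReal_eval (x := I.vtx e) (y := 2 + I.y e) hm4 ?_ ?_
        (.ret _ _ _ hm5 ?_)))))))
      · simp [curVtx, curEdge, NExp.eval, Mem.setNat_nat, hR1.cur, hR1.nat_two]
      · simp [curEdge, NExp.eval, Mem.setNat_nat, hR1.cur]
      · simp [curVtx, curEdge, NExp.eval, Mem.setNat_nat, hR1.cur, hR1.nat_two]
      · simp [curEdge, RExp.eval, NExp.eval, Mem.setNat_nat, Mem.setNat_real, hR1.cur,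
          hR1.real_zero]
      · simp [curVtx, curEdge, NExp.eval, Mem.setNat_nat, Mem.setReal_nat, hR1.cur, hR1.nat_two]
      · simp [curEdge, RExp.eval, NExp.eval, Mem.setNat_nat, Mem.setNat_real, Mem.setReal_real,
          Mem.setReal_nat, hR1.cur, hR1.real_zero]
      · refine hR1.update (fun a ha => ?_) ?_ ?_ (fun w hw => ?_) ?_ hsf (fun _ _ => rfl)
          (fun g hg => ?_) (fun g hg => ?_)
        · funext x
          simp only [Mem.setReal_nat, Mem.setNat_nat]
          rw [if_neg (by omega), if_neg (by omega)]
        · simp [Mem.setReal_nat, Mem.setNat_nat]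
        · funext x
          simp [Mem.setReal_real, Mem.setNat_real]
        · simp [Mem.setReal_nat, Mem.setNat_nat, Mem.setReal_real, Mem.setNat_real, NExp.eval, hw]
        · simp [StatusRep, Mem.setReal_nat, Mem.setNat_nat, Mem.setReal_real,
            NExp.eval, candSum]
        · have h1 := hR1.out g
          rw [hg, hf] at h1
          simp only [reduceCtorEq, iff_false] at h1 ⊢
          simpa [Mem.setReal_nat, Mem.setNat_nat] using h1
        · simp [Mem.setReal_nat, Mem.setNat_nat]
    · refine (addToSum_sim hm0 hR0 hsf (fun _ _ => rfl) (fun _ => headSum_succ_self e I.y)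
        (fun a b lam h => ?_) ?_ ?_).mono (by norm_num)
      · rw [hf] at h
        cases h
      · rw [hR0.sum_free hf]
        exact L.add_mem (hB.headSum_mem _ _) (hB.y_mem' e)
      · rw [hR0.sum_free hf]
        have := headSum_add_y_le e
        have := headSum_nonneg (w := I.vtx e) (i := e) (x := I.y) y_nonneg
        exact abs_le_four (by linarith [hy.1]) (by linarith)

theorem candRoundBody_sim (hB : Bounds I L N) (e : Fin I.nE) (s : I.State) (m : Mem)
    (hm : m.Bounded L N) (hR : I.Rep e (fun _ => 2) candSum s m) :
    Sim (Mem.Bounded L N) (I.Rep e (fun _ => 2) candSum) 9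
      ([candRoundBody], m) (I.ownStep (I.vtx e) (I.candRoundKernel e) s) := by
  have h3 := hB.three_le
  by_cases hc : ∃ b lam, s (I.vtx e) = .cand e b lam
  · obtain ⟨b, lam, hc⟩ := hc
    obtain ⟨-, h7, h2, -⟩ := hR.of_cand hc
    refine Sim.ite_pos hm ⟨fun h => ?_, fun h => ?_, ?_⟩ ?_
    · rw [hR.isStatus_zero.1 h] at hc
      cases hc
    · obtain ⟨a, ha⟩ := hR.isStatus_three.1 h
      rw [ha] at hc
      cases hc
    · simp only [BExp.eval, NExp.eval, hR.eval_curVtx, hR.eval_curEdge, h7]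
    have hm1 : (m.setNat 9 0 1).Bounded L N := hm.setNat (by omega)
    have hm0 : (m.setNat 9 0 0).Bounded L N := hm.setNat (by omega)
    have hR1 := hR.setNat_temp (a := 9) le_rfl 0 1
    have hR0 := hR.setNat_temp (a := 9) le_rfl 0 0
    have hp : RExp.eval m (.get 2 curVtx) = lam := by
      rw [RExp.eval, hR.eval_curVtx, h2]
    rw [ownStep, hc, candRoundKernel, if_pos rfl, CoinTree.flip_bind, CoinTree.ret_bind,
      CoinTree.ret_bind, ← hc, Function.update_eq_self]
    exact Sim.flip_ite (T := 5) hm hp hm1 hm0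
      ((choose_sim hB hm1 hR1 (fun _ _ => rfl) (fun _ _ => rfl)
        (fun a h => by rw [hc] at h; cases h)).mono (by norm_num))
      ((skip_sim hm0 hR0 (fun _ _ => rfl) fun _ _ _ _ _ => rfl).mono (by norm_num))
  · refine Sim.ite_neg hm ?_ ?_
    · rintro ⟨h0, h1, h2⟩
      cases hs : s (I.vtx e) with
      | free => exact h0 (hR.isStatus_zero.2 hs)
      | cand a b lam =>
        simp only [BExp.eval, NExp.eval, hR.eval_curVtx, hR.eval_curEdge,
          (hR.of_cand hs).2.1] at h2
        exact hc ⟨b, lam, by rw [hs, Fin.ext h2]⟩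
      | done a => exact h1 (hR.isStatus_three.2 ⟨a, hs⟩)
    · refine ((skip_sim hm hR (fun _ _ => rfl) fun _ _ _ _ _ => rfl).mono
        (by norm_num)).of_eq (ownStep_ret ?_).symm
      cases hs : s (I.vtx e) with
      | free => rfl
      | cand a b lam =>
        rw [candRoundKernel, if_neg]
        rintro rfl
        exact hc ⟨b, lam, hs⟩
      | done a => rfl

/-- The sums at free vertices during the last loop. -/
def roundFreeSum (i : ℕ) (v : Fin I.nV) : ℝ := 2 + I.headSum v i I.y

/-- The sums at vertices with candidates during the last loop. -/
def roundCandSum (i : ℕ) (v : Fin I.nV) (a : Fin I.nE) : ℝ :=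
  2 + I.y a + I.headSum v i (I.yExcept a)

theorem Bounds.yExcept_mem (hB : Bounds I L N) (a g : Fin I.nE) : I.yExcept a g ∈ L := by
  unfold yExcept
  split_ifs
  exacts [L.zero_mem, hB.y_mem' g]

theorem roundBody_sim (hB : Bounds I L N) (e : Fin I.nE) (s : I.State) (m : Mem)
    (hm : m.Bounded L N) (hs : Valid s)
    (hR : I.Rep e (roundFreeSum e) (roundCandSum e) s m) :
    Sim (Mem.Bounded L N) (I.Rep e (roundFreeSum ((e : ℕ) + 1)) (roundCandSum ((e : ℕ) + 1))) 9
      ([roundBody], m) (I.ownStep (I.vtx e) (I.roundKernel e) s) := by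
  have h3 := hB.three_le
  have hy := I.y_mem e
  have h2L : (2 : ℝ) ∈ L := by
    have := L.add_mem hB.one_mem hB.one_mem
    norm_num at this
    exact this
  have hsf : ∀ w, w ≠ I.vtx e → roundFreeSum ((e : ℕ) + 1) w = roundFreeSum e w := fun w hw => by
    rw [roundFreeSum, headSum_succ_of_vtx_ne hw, roundFreeSum]
  have hsc : ∀ w, w ≠ I.vtx e → roundCandSum ((e : ℕ) + 1) w = roundCandSum e w := fun w hw => by
    funext a
    rw [roundCandSum, headSum_succ_of_vtx_ne hw, roundCandSum]
  have hm1 : (m.setNat 9 0 1).Bounded L N := hm.setNat (by omega)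
  have hm0 : (m.setNat 9 0 0).Bounded L N := hm.setNat (by omega)
  have hR1 := hR.setNat_temp (a := 9) le_rfl 0 1
  have hR0 := hR.setNat_temp (a := 9) le_rfl 0 0
  have hp := hR.eval_pickExp
  cases hσ : s (I.vtx e) with
  | done a =>
    refine Sim.ite_neg hm (fun h => h.1 (hR.isStatus_three.2 ⟨a, hσ⟩)) ?_
    refine ((skip_sim hm hR (fun w hw => hsf w ?_) (fun w a b lam hw => ?_)).mono
      (by norm_num)).of_eq (ownStep_ret ?_).symm
    · rintro rfl
      rw [hσ] at hw
      cases hw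
    · rw [hsc]
      rintro rfl
      rw [hσ] at hw
      cases hw
    · rw [hσ]
      rfl
  | free =>
    refine Sim.ite_pos hm ⟨fun h => ?_, fun h => h.1 (hR.isStatus_zero.2 hσ)⟩ ?_
    · obtain ⟨a, ha⟩ := hR.isStatus_three.1 h
      rw [hσ] at ha
      cases ha
    rw [hR.sum_free hσ, roundFreeSum, show ∀ x : ℝ, 3 - (2 + x) = 1 - x by intro x; ring] at hp
    rw [ownStep, hσ, roundKernel, CoinTree.flip_bind, CoinTree.ret_bind, CoinTree.ret_bind, ← hσ,
      Function.update_eq_self]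
    refine Sim.flip_ite (T := 5) hm hp hm1 hm0
      ((choose_sim hB hm1 hR1 hsf hsc (fun a h => by rw [hσ] at h; cases h)).mono (by norm_num))
      ((addToSum_sim hm0 hR0 hsf hsc (fun _ => ?_) (fun a b lam h => ?_) ?_ ?_).mono
        (by norm_num))
    · rw [roundFreeSum, headSum_succ_self, roundFreeSum]
      ring
    · rw [hσ] at h
      cases h
    · rw [hR0.sum_free hσ]
      exact L.add_mem (L.add_mem h2L (hB.headSum_mem _ _)) (hB.y_mem' e)
    · rw [hR0.sum_free hσ, roundFreeSum]
      have := headSum_add_y_le e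
      have := headSum_nonneg (w := I.vtx e) (i := e) (x := I.y) y_nonneg
      exact abs_le_four (by linarith [hy.1]) (by linarith)
  | cand a b lam =>
    obtain ⟨-, h7, -, h1⟩ := hR.of_cand hσ
    obtain ⟨-, -, -, h1'⟩ := hR0.of_cand hσ
    by_cases hae : a = e
    · subst hae
      refine Sim.ite_neg hm (fun h => h.2 ⟨fun h0 => ?_, ?_⟩) ?_
      · rw [hR.isStatus_zero.1 h0] at hσ
        cases hσ
      · simp only [BExp.eval, NExp.eval, hR.eval_curVtx, hR.eval_curEdge, h7]
      refine ((skip_sim hm hR (fun w hw => hsf w ?_) (fun w a' b' lam' hw => ?_)).mono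
        (by norm_num)).of_eq (ownStep_ret ?_).symm
      · rintro rfl
        rw [hσ] at hw
        cases hw
      · rcases eq_or_ne w (I.vtx a) with rfl | hne
        · obtain rfl : a = a' := by
            rw [hσ] at hw
            exact (Status.cand.inj hw).1
          -- The program leaves the sum alone in step `a`; this is consistent because `yExcept a`
          -- vanishes at `a`.
          rw [roundCandSum, headSum_succ_self, yExcept_self, add_zero, roundCandSum]
        · rw [hsc w hne]
      · rw [hσ, roundKernel, if_pos rfl]
    · have hva := (hs _ _ _ _ hσ).1
      refine Sim.ite_pos hm ⟨fun h => ?_, fun h => ?_⟩ ?_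
      · obtain ⟨a, ha⟩ := hR.isStatus_three.1 h
        rw [hσ] at ha
        cases ha
      · have h2 := h.2
        simp only [BExp.eval, NExp.eval, hR.eval_curVtx, hR.eval_curEdge, h7] at h2
        exact hae (Fin.ext h2)
      rw [h1, roundCandSum, show ∀ x y : ℝ, 3 - (2 + x + y) = 1 - x - y by intro x y; ring] at hp
      rw [ownStep, hσ, roundKernel, if_neg hae, CoinTree.flip_bind, CoinTree.ret_bind,
        CoinTree.ret_bind, ← hσ, Function.update_eq_self]
      refine Sim.flip_ite (T := 5) hm hp hm1 hm0
        ((choose_sim hB hm1 hR1 hsf hsc (fun a h => by rw [hσ] at h; cases h)).mono (by norm_num))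
        ((addToSum_sim hm0 hR0 hsf hsc (fun h => ?_) (fun a' b' lam' h => ?_) ?_ ?_).mono
          (by norm_num))
      · rw [hσ] at h
        cases h
      · obtain rfl : a = a' := by
          rw [hσ] at h
          exact (Status.cand.inj h).1
        rw [roundCandSum, headSum_succ_self, yExcept_of_ne (Ne.symm hae), roundCandSum]
        ring
      · rw [h1']
        exact L.add_mem (L.add_mem (L.add_mem h2L (hB.y_mem' a))
          (L.sum_mem fun g _ => hB.yExcept_mem a g)) (hB.y_mem' e)
      · rw [h1', roundCandSum]
        have h4 := headSum_add_tailSum_yExcept (i := e) hva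
        have h5 := le_tailSum (i := e) (x := I.yExcept a) (yExcept_nonneg a) (e := e) rfl le_rfl
        rw [yExcept_of_ne (Ne.symm hae)] at h5
        have h6 := headSum_nonneg (w := I.vtx e) (i := e) (x := I.yExcept a) (yExcept_nonneg a)
        have h7 := y_nonneg a
        exact abs_le_four (by linarith [hy.1]) (by linarith)

end RoundingInstance

/-! ### Simulation of the second loop, with the search for the target. -/

namespace RoundingInstance

open RandRAM

variable {I : RoundingInstance} {L : AddSubgroup ℝ} {N : ℕ}

/-- The sums at free vertices during the second loop. -/
def commitFreeSum (i : ℕ) (v : Fin I.nV) : ℝ := 1 + I.headSum v i I.y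

def targetCode : Option (Fin I.nE) → ℕ
  | none => 0
  | some a => a + 1

section commit

variable {e : Fin I.nE} {s : I.State} {m : Mem} {sf : Fin I.nV → ℝ}

theorem isTarget_iff {sc : Fin I.nV → Fin I.nE → ℝ} (hR : I.Rep e sf sc s m) (j : Fin I.nE)
    (hj : m.nat 10 0 = j) : isTarget.eval m ↔
      (∃ lam, s (I.vtx j) = .cand j true lam) ∧ I.Same e j := by
  have h1 := hR.status (I.vtx j)
  have h2 : (m.nat 6 (I.vtx j) = 1 ∧ m.nat 7 (I.vtx j) = j) ↔
      ∃ lam, s (I.vtx j) = .cand j true lam := by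
    constructor
    · rintro ⟨h6, h7⟩
      cases hs : s (I.vtx j) with
      | free =>
        rw [hs] at h1
        exact absurd (h6.symm.trans h1.1) (by norm_num)
      | cand a b lam =>
        rw [hs] at h1
        obtain rfl : a = j := Fin.ext (h1.2.1.symm.trans h7)
        have hb := h6.symm.trans h1.1
        cases b
        · simp at hb
        · exact ⟨lam, rfl⟩
      | done a =>
        rw [hs] at h1
        exact absurd (h6.symm.trans h1) (by norm_num)
    · rintro ⟨lam, hs⟩
      rw [hs] at h1
      exact ⟨h1.1, h1.2.1⟩
  rw [← h2]
  simp only [isTarget, scanEdge, BExp.eval, NExp.eval, hj, hR.nat_two, hR.eval_curEdge, hR.nat_one,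
    hR.nat_three, Same, Fin.val_inj, and_assoc, ne_eq]

theorem findTarget_sim {sc : Fin I.nV → Fin I.nE → ℝ} (hB : Bounds I L N) (hm : m.Bounded L N)
    (hR : I.Rep e sf sc s m) :
    Sim (Mem.Bounded L N)
      (fun (_ : Unit) m' => I.Rep e sf sc s m' ∧ m'.nat 11 0 = targetCode (I.target s e I.nE))
      (I.nE * 5 + 5) ([findTarget], m) (.ret ()) := by
  have hN := hB.nE_lt
  have hm1 : (m.setNat 11 0 0).Bounded L N := hm.setNat (by omega)
  have hm2 : ((m.setNat 11 0 0).setNat 10 0 0).Bounded L N := hm1.setNat (by omega)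
  refine Sim.seq hm (Sim.setNat_eval (x := 0) (y := 0) hm rfl rfl
    (Sim.seq hm1 (Sim.setNat_eval (x := 0) (y := 0) hm1 rfl rfl ?_)))
  have h := Sim.loop_iter (J := Mem.Bounded L N) (T := 4) (n := I.nE) (f := fun _ => .ret)
    (b := .nlt scanEdge (.get 0 (.const 2)))
    (c := .seq (.ite isTarget (.setNat 11 (.const 0) (.add scanEdge (.const 1))) .skip)
      (.setNat 10 (.const 0) (.add scanEdge (.const 1))))
    (R := fun j (_ : Unit) m' => I.Rep e sf sc s m' ∧ m'.nat 10 0 = j ∧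
      m'.nat 11 0 = targetCode (I.target s e j)) ?_ ?_ I.nE 0 (zero_add _) () _ hm2
    ⟨(hR.setNat_temp (by norm_num) _ _).setNat_temp (by norm_num) _ _,
      by simp [Mem.setNat_nat], by simp [Mem.setNat_nat, target, targetCode]⟩
  · rw [CoinTree.iter_ret] at h
    exact h.imp fun _ m' _ h => ⟨h.1, h.2.2⟩
  · rintro j - m' ⟨hR', hj, -⟩
    simp [BExp.eval, NExp.eval, scanEdge, hR'.nat_zero, hj]
  · rintro j hj - m' hm' ⟨hR', hj', ht⟩
    have hcase := isTarget_iff hR' ⟨j, hj⟩ hj'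
    have hscan : NExp.eval m' (.add scanEdge (.const 1)) = j + 1 := by
      simp [NExp.eval, scanEdge, hj']
    refine Sim.seq hm' (Sim.ite hm' (fun hb => ?_) fun hb => ?_)
    · have hm3 : (m'.setNat 11 0 (j + 1)).Bounded L N := hm'.setNat (by omega)
      refine Sim.setNat_eval hm' rfl hscan (Sim.setNat_eval (x := 0) (y := j + 1) (T := 0) hm3 rfl ?_
        (.ret _ _ _ (hm3.setNat (by omega)) ⟨(hR'.setNat_temp (by norm_num) _ _).setNat_temp
          (by norm_num) _ _, by simp [Mem.setNat_nat], ?_⟩))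
      · simp [NExp.eval, scanEdge, Mem.setNat_nat, hj']
      · rw [target, dif_pos ⟨hj, hcase.1 hb⟩]
        simp [Mem.setNat_nat, targetCode, NExp.eval]
    · refine Sim.skip hm' (Sim.setNat_eval (T := 0) hm' rfl hscan
        (.ret _ _ _ (hm'.setNat (by omega)) ⟨hR'.setNat_temp (by norm_num) _ _,
          by simp [Mem.setNat_nat, NExp.eval], ?_⟩))
      rw [target, dif_neg fun h => hb (hcase.2 h.2), ← ht]
      simp [Mem.setNat_nat]

/-- Writing the new status of a candidate. -/
theorem Rep.update_cand {sc : Fin I.nV → Fin I.nE → ℝ} (hR : I.Rep e sf sc s m) {a : Fin I.nE}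
    {lam lam' : ℝ} (hs : s (I.vtx a) = .cand a true lam) {b : Bool} {m' : Mem}
    (h4 : ∀ a ≤ 4, m'.nat a = m.nat a) (h5 : m'.nat 5 = m.nat 5) (h7 : m'.nat 7 = m.nat 7)
    (h8 : m'.nat 8 0 = m.nat 8 0) (h0 : m'.real 0 = m.real 0) (h1 : m'.real 1 = m.real 1)
    (h6 : ∀ w, w ≠ (I.vtx a : ℕ) → m'.nat 6 w = m.nat 6 w)
    (h6' : m'.nat 6 (I.vtx a) = if b = true then 1 else 2)
    (h2 : ∀ w, w ≠ (I.vtx a : ℕ) → m'.real 2 w = m.real 2 w)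
    (h2' : m'.real 2 (I.vtx a) = lam') :
    I.Rep e sf sc (Function.update s (I.vtx a) (.cand a b lam')) m' := by
  obtain ⟨-, h9, -, h10⟩ := hR.of_cand hs
  refine hR.update h4 h8 h0 (fun w hw => ⟨h6 w hw, by rw [h7], h2 w hw, by rw [h1]⟩)
    ⟨h6', by rw [h7, h9], h2', by rw [h1, h10]⟩ (fun _ _ => rfl) (fun _ _ => rfl) (fun g hg => ?_)
    fun g _ => by rw [h5]
  rw [h5, hR.out g, hg, hs]
  simp

theorem adjust_some {t : Fin I.nE} {lam : ℝ} (hs : s (I.vtx t) = .cand t true lam) (b : Bool)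
    (δ : ℝ) : I.adjust s (some t) b δ = Function.update s (I.vtx t) (.cand t b (lam + δ)) := by
  simp [adjust, hs]

theorem noTarget_iff {t : Option (Fin I.nE)} (h : m.nat 11 0 = targetCode t) :
    noTarget.eval m ↔ t = none := by
  cases t <;> simp [noTarget, BExp.eval, NExp.eval, h, targetCode]

theorem eval_targetVtx {sc : Fin I.nV → Fin I.nE → ℝ} (hR : I.Rep e sf sc s m) {t : Fin I.nE}
    (h : m.nat 11 0 = targetCode (some t)) : targetVtx.eval m = I.vtx t := by
  simp only [targetVtx, NExp.eval, h, targetCode, Nat.add_sub_cancel, hR.nat_two]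

theorem lower_sim (hB : Bounds I L N) (hm : m.Bounded L N)
    (hR : I.Rep e (commitFreeSum e) candSum s m) (hf : s (I.vtx e) = .free)
    (hJ : CommitInv e s) (ht : m.nat 11 0 = targetCode (I.target s e I.nE)) :
    Sim (Mem.Bounded L N) (I.Rep e (commitFreeSum e) candSum) 4
      ([.ite noTarget .skip
        (.seq
          (.setReal 2 targetVtx (.sub (.get 2 targetVtx)
            (.div (.sub (.sub (.const 3) (.get 1 curVtx)) (.get 0 curEdge)) (.const 4))))
          (.setNat 6 targetVtx (.const 2)))], m)
      (.ret (I.adjust s (I.target s e I.nE) false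
        (-((2 - I.headSum (I.vtx e) e I.y - I.y e) / 4)))) := by
  have h3 := hB.three_le
  cases htgt : I.target s e I.nE with
  | none =>
    rw [htgt] at ht
    exact Sim.ite_pos hm ((noTarget_iff ht).2 rfl) (Sim.skip hm (.ret _ _ _ hm hR))
  | some a =>
    rw [htgt] at ht
    obtain ⟨⟨lam, hlam⟩, -⟩ := target_spec htgt
    rw [adjust_some hlam]
    have hL := (hR.of_cand hlam).2.2.1
    have hmem := (hm.2 2 (I.vtx a)).1
    rw [hL] at hmem
    have hall := commitStep_inv hJ
    rw [commitStep_free hf] at hall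
    -- The bounds on the probability about to be written are read off from the invariant of the
    -- state after the full step.
    obtain ⟨-, hv0, hv1⟩ := CommitInv.valid hall.1 _ _ _ _ (afterHit_apply_target hf htgt hlam)
    set δ := -((2 - I.headSum (I.vtx e) e I.y - I.y e) / 4) with hδ
    have hδL : δ ∈ L := by
      -- `L` is only an additive group, so quarters have to be taken termwise; then `δ = H / 4 + y e
      -- / 4 - 1 / 2`.
      have hh : I.headSum (I.vtx e) e I.y / 4 ∈ L := by
        rw [headSum, Finset.sum_div]
        exact L.sum_mem fun g _ => hB.y_mem g
      have := L.sub_mem (L.add_mem hh (hB.y_mem e)) hB.half_mem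
      convert this using 1
      rw [hδ]
      ring
    have hm1 : (m.setReal 2 (I.vtx a) (lam + δ)).Bounded L N :=
      hm.setReal (L.add_mem hmem hδL) (abs_le_four hv0 (hv1.trans (by norm_num)))
    refine Sim.ite_neg hm (fun h => by simpa using (noTarget_iff ht).1 h) (Sim.seq hm
      (Sim.setReal_eval (y := lam + δ) hm (eval_targetVtx hR ht) ?_
      (Sim.setNat_eval (T := 0) (x := I.vtx a) (y := 2) hm1 ?_ rfl
        (.ret _ _ _ (hm1.setNat (by omega)) ?_))))
    · simp only [RExp.eval, eval_targetVtx hR ht, hR.eval_curVtx, hR.eval_curEdge, hL,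
        hR.sum_free hf, hR.real_zero, commitFreeSum, hδ]
      push_cast
      ring
    · simp only [targetVtx, NExp.eval, Mem.setReal_nat, ht, targetCode, Nat.add_sub_cancel,
        hR.nat_two]
    · refine hR.update_cand hlam (fun a ha => ?_) ?_ ?_ ?_ ?_ ?_ (fun w hw => ?_) ?_
        (fun w hw => ?_) ?_
      · funext x
        simp only [Mem.setNat_nat, Mem.setReal_nat]
        rw [if_neg (by omega)]
      · funext x
        simp [Mem.setNat_nat, Mem.setReal_nat]
      · funext x
        simp [Mem.setNat_nat, Mem.setReal_nat]
      · simp [Mem.setNat_nat, Mem.setReal_nat]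
      · funext x
        simp [Mem.setNat_real, Mem.setReal_real]
      · funext x
        simp [Mem.setNat_real, Mem.setReal_real]
      · simp [Mem.setNat_nat, Mem.setReal_nat, hw]
      · simp [Mem.setNat_nat]
      · simp [Mem.setNat_real, Mem.setReal_real, hw]
      · simp [Mem.setNat_real, Mem.setReal_real]

theorem raise_sim (hB : Bounds I L N) (hm : m.Bounded L N)
    (hR : I.Rep e (commitFreeSum e) candSum s m) (hf : s (I.vtx e) = .free)
    (hJ : CommitInv e s) (ht : m.nat 11 0 = targetCode (I.target s e I.nE)) :
    Sim (Mem.Bounded L N) (I.Rep e (commitFreeSum e) candSum) 2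
      ([.ite noTarget .skip
        (.setReal 2 targetVtx (.add (.get 2 targetVtx) (.div (.get 0 curEdge) (.const 4))))], m)
      (.ret (I.afterMiss e s)) := by
  rw [afterMiss]
  cases htgt : I.target s e I.nE with
  | none =>
    rw [htgt] at ht
    exact Sim.ite_pos hm ((noTarget_iff ht).2 rfl) (Sim.skip hm (.ret _ _ _ hm hR))
  | some a =>
    rw [htgt] at ht
    obtain ⟨⟨lam, hlam⟩, -⟩ := target_spec htgt
    rw [adjust_some hlam]
    have hL := (hR.of_cand hlam).2.2.1
    have hmem := (hm.2 2 (I.vtx a)).1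
    rw [hL] at hmem
    have hall := commitStep_inv hJ
    rw [commitStep_free hf] at hall
    obtain ⟨-, hv0, hv1⟩ := CommitInv.valid hall.2 _ _ _ _ (afterMiss_apply_target htgt hlam)
    have hm1 : (m.setReal 2 (I.vtx a) (lam + I.y e / 4)).Bounded L N :=
      hm.setReal (L.add_mem hmem (hB.y_mem e)) (abs_le_four hv0 (hv1.trans (by norm_num)))
    refine Sim.ite_neg hm (fun h => by simpa using (noTarget_iff ht).1 h)
      (Sim.setReal_eval (T := 0) (y := lam + I.y e / 4) hm (eval_targetVtx hR ht) ?_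
        (.ret _ _ _ hm1 ?_))
    · simp only [RExp.eval, eval_targetVtx hR ht, hR.eval_curEdge, hL, hR.real_zero]
      push_cast
      ring
    · refine hR.update_cand hlam (fun a ha => rfl) rfl rfl rfl ?_ ?_ (fun w hw => rfl)
        (hR.of_cand hlam).1 (fun w hw => ?_) ?_
      · funext x
        simp [Mem.setReal_real]
      · funext x
        simp [Mem.setReal_real]
      · simp [Mem.setReal_real, hw]
      · simp [Mem.setReal_real]

end commit

theorem commitBody_sim (hB : Bounds I L N) (e : Fin I.nE) (s : I.State) (m : Mem)
    (hm : m.Bounded L N) (hJ : CommitInv e s) (hR : I.Rep e (commitFreeSum e) candSum s m) :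
    Sim (Mem.Bounded L N) (I.Rep e (commitFreeSum ((e : ℕ) + 1)) candSum) (I.nE * 5 + 18)
      ([commitBody], m) (I.commitStep e s) := by
  have h3 := hB.three_le
  have hy := I.y_mem e
  have hsf : ∀ w, w ≠ I.vtx e → commitFreeSum ((e : ℕ) + 1) w = commitFreeSum e w :=
    fun w hw => by rw [commitFreeSum, headSum_succ_of_vtx_ne hw, commitFreeSum]
  by_cases hf : s (I.vtx e) = .free
  swap
  · rw [commitStep_of_ne_free hf]
    refine Sim.ite_neg hm (fun h => hf (hR.isStatus_zero.1 h)) ?_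
    refine (skip_sim hm hR (fun w hw => hsf w ?_) fun _ _ _ _ _ => rfl).mono (by omega)
    rintro rfl
    exact hf hw
  rw [commitStep_free hf]
  refine Sim.ite_pos hm (hR.isStatus_zero.2 hf) (Sim.seq hm ?_)
  refine Sim.mono (T := (I.nE * 5 + 5) + 11) ?_ (by omega)
  refine (findTarget_sim hB hm hR).cons_ret fun m hm ⟨hR, ht⟩ => ?_
  have hp := hR.eval_pickExp
  rw [hR.sum_free hf, commitFreeSum, show ∀ x : ℝ, 3 - (1 + x) = 2 - x by intro x; ring] at hp
  have hm1 : (m.setNat 9 0 1).Bounded L N := hm.setNat (by omega)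
  have hm0 : (m.setNat 9 0 0).Bounded L N := hm.setNat (by omega)
  refine Sim.flip_ite (T := 8) hm hp hm1 hm0 (Sim.seq hm1 ?_) (Sim.seq hm0 ?_)
  · have ht1 : (m.setNat 9 0 1).nat 11 0 = targetCode (I.target s e I.nE) := by
      simpa [Mem.setNat_nat] using ht
    refine Sim.cons_ret (T' := 3)
      (lower_sim hB hm1 (hR.setNat_temp le_rfl 0 1) hf hJ ht1) fun m' hm' hR' => ?_
    refine choose_sim hB hm' hR' hsf (fun _ _ => rfl) fun a h => ?_
    rw [adjust_apply_of_ne fun a ha => target_vtx_ne hf ha, hf] at h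
    cases h
  · have ht0 : (m.setNat 9 0 0).nat 11 0 = targetCode (I.target s e I.nE) := by
      simpa [Mem.setNat_nat] using ht
    have hf' := afterMiss_apply_self hf
    refine Sim.mono (Sim.cons_ret (T' := 1)
      (raise_sim hB hm0 (hR.setNat_temp le_rfl 0 0) hf hJ ht0) fun m' hm' hR' => ?_) (by norm_num)
    refine addToSum_sim hm' hR' hsf (fun _ _ => rfl) (fun _ => ?_) (fun a b lam h => ?_) ?_ ?_
    · rw [commitFreeSum, headSum_succ_self, commitFreeSum]
      ring
    · rw [hf'] at h
      cases h
    · rw [hR'.sum_free hf']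
      exact L.add_mem (L.add_mem hB.one_mem (hB.headSum_mem _ _)) (hB.y_mem' e)
    · rw [hR'.sum_free hf', commitFreeSum]
      have := headSum_add_y_le e
      have := headSum_nonneg (w := I.vtx e) (i := e) (x := I.y) y_nonneg
      exact abs_le_four (by linarith [hy.1]) (by linarith)

end RoundingInstance

/-! ### Assembly: running time, bit lengths and output distribution. -/

namespace RoundingInstance

open RandRAM

variable {I : RoundingInstance} {L : AddSubgroup ℝ} {N : ℕ}

/-! ### The whole program -/

/-- The loops fit together because `headSum` is `1` at the end: the final sums of each loop are the
initial sums of the next. The quadratic term of the time bound comes from searching a target for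
every edge. -/
theorem program_sim (hB : Bounds I L N) {m : Mem} (hm : m.Bounded L N)
    (hR : I.Rep 0 (fun v => I.headSum v 0 I.y) candSum (fun _ => .free) m) :
    Sim (Mem.Bounded L N) (fun s m => ∀ e : Fin I.nE, m.nat 5 e ≠ 0 ↔ s (I.vtx e) = .done e)
      (5 * I.nE ^ 2 + 59 * I.nE + 15) ([program], m) I.rounding := by
  have hone : ∀ v, I.headSum v I.nE I.y = 1 := fun v => headSum_y_nE
  refine Sim.mono (T := (((I.nE * (9 + 3) + 3) + 0 + (I.nE * (9 + 3) + 3) + 1) +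
    (I.nE * (I.nE * 5 + 18 + 3) + 3) + 1) + (I.nE * (11 + 3) + 3) + 1) ?_ (by nlinarith)
  refine Sim.seq hm ?_
  rw [add_comm _ (I.nE * (11 + 3) + 3)]
  refine (forEdges_sim hB (Inv := fun _ => CandInv) (sf := fun i v => I.headSum v i I.y)
    (sc := fun _ => candSum) (fun i s hs => candStep_inv hs)
    (fun i s m hm _ hR => candBody_sim hB i s m hm hR) hm (fun _ => Or.inl rfl) hR).cons
    fun s m hm ⟨hs, hR⟩ => ?_
  refine Sim.seq hm ?_
  rw [add_comm _ (I.nE * (I.nE * 5 + 18 + 3) + 3)]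
  refine (forEdges_sim hB (Inv := CommitInv) (sf := commitFreeSum)
    (sc := fun _ => candSum) (fun i s hs => commitStep_inv hs)
    (fun i s m hm hs hR => commitBody_sim hB i s m hm hs hR) hm hs.commitInv
    (hR.congr_sums (fun v _ => ?_) fun _ _ _ _ _ => rfl)).cons
    fun s m hm ⟨hs, hR⟩ => ?_
  · rw [commitFreeSum, headSum_zero, hone, add_zero]
  refine Sim.seq hm ?_
  rw [add_zero]
  refine (forEdges_sim hB (Inv := fun _ => Valid) (sf := fun _ _ => 2)
    (sc := fun _ => candSum) (fun i s hs => candRoundStep_valid hs)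
    (fun i s m hm hs hR => candRoundBody_sim hB i s m hm hR) hm hs.valid
    (hR.congr_sums (fun v _ => ?_) fun _ _ _ _ _ => rfl)).cons
    fun s m hm ⟨hs, hR⟩ => ?_
  · rw [commitFreeSum, hone]
    norm_num
  refine (forEdges_sim hB (Inv := fun _ => Valid) (sf := roundFreeSum)
    (sc := roundCandSum) (fun i s hs => roundStep_valid hs)
    (fun i s m hm hs hR => roundBody_sim hB i s m hm hs hR) hm hs
    (hR.congr_sums (fun v _ => ?_) fun _ _ _ _ _ => ?_)).imp fun s m _ h => h.2.out
  · rw [roundFreeSum, headSum_zero, add_zero]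
  · rw [roundCandSum, headSum_zero, add_zero, candSum]

theorem input_rep : I.Rep 0 (fun v => I.headSum v 0 I.y) candSum (fun _ => .free) I.input where
  nat_input _ _ := rfl
  real_input := rfl
  cur := rfl
  status v := ⟨rfl, headSum_zero.symm⟩
  out e := by simp [input]

theorem label_le (e : Fin I.nE) : I.label e ≤ I.κ (I.ends e).1 := by
  by_cases h : I.label e = 0
  · omega
  · obtain ⟨l, hl⟩ := exists_mem_grp h
    rw [label_of_mem hl]
    exact l.2

theorem kappa_le_size (u : Fin I.nU) : I.κ u ≤ I.size := by
  have := Finset.single_le_sum (f := I.κ) (fun _ _ => Nat.zero_le _) (Finset.mem_univ u)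
  unfold size
  omega

theorem nE_le_size : I.nE ≤ I.size := by
  unfold size
  omega

theorem input_bounded (hB : Bounds I L N) (hN : I.size ≤ N) : I.input.Bounded L N := by
  have hU : I.nU ≤ N ∧ I.nV ≤ N := by
    unfold size at hN
    omega
  refine ⟨fun a i => ?_, fun a i => ?_⟩
  · match a with
    | 0 =>
      simp only [input]
      split_ifs
      exacts [hU.1, hU.2, hB.nE_lt.le, Nat.zero_le _]
    | 1 =>
      simp only [input]
      split_ifs with h
      exacts [(I.ends ⟨i, h⟩).1.2.le.trans hU.1, Nat.zero_le _]
    | 2 =>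
      simp only [input]
      split_ifs with h
      exacts [(I.ends ⟨i, h⟩).2.2.le.trans hU.2, Nat.zero_le _]
    | 3 =>
      simp only [input]
      split_ifs with h
      exacts [((label_le _).trans (kappa_le_size _)).trans hN, Nat.zero_le _]
    | 4 =>
      simp only [input]
      split_ifs with h
      exacts [(kappa_le_size _).trans hN, Nat.zero_le _]
    | _ + 5 => exact Nat.zero_le _
  · match a with
    | 0 =>
      simp only [input]
      split_ifs with h
      · exact ⟨hB.y_mem' _, abs_le_four (y_nonneg _) ((I.y_mem _).2.trans (by norm_num))⟩
      · exact ⟨L.zero_mem, by norm_num⟩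
    | _ + 1 => exact ⟨L.zero_mem, by simp [input]⟩

/-! ### Sizes of rational numbers -/

/-- The reduced denominator divides `D`, and the numerator is at most four times the denominator;
this gives `b + 1` and `b + 3` bits. -/
theorem ratBits_le {D k : ℤ} {b : ℕ} (hD : 0 < D) (hDb : D ≤ 2 ^ b)
    (hk : |(k : ℝ) / D| ≤ 4) : ratBits ((k : ℚ) / D) ≤ 2 * b + 4 := by
  have hden : (((k : ℚ) / D).den : ℤ) ≤ D := by
    refine Int.le_of_dvd hD ?_
    rw [← Rat.divInt_eq_div]
    exact Rat.den_dvd k D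
  have hnum : (((k : ℚ) / D).num.natAbs : ℤ) ≤ 4 * D := by
    have h1 : |(k : ℚ) / D| ≤ 4 := by exact_mod_cast hk
    rw [Int.natCast_natAbs]
    set q := (k : ℚ) / D with hq
    have h2 : (|q.num| : ℚ) = |q| * q.den := by
      rw [← abs_of_nonneg (Nat.cast_nonneg (α := ℚ) q.den), ← abs_mul, Rat.mul_den_eq_num]
    have h3 : (|q.num| : ℚ) ≤ 4 * q.den := by
      rw [h2]
      exact mul_le_mul_of_nonneg_right h1 (Nat.cast_nonneg _)
    have h4 : |q.num| ≤ 4 * (q.den : ℤ) := by exact_mod_cast h3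
    linarith
  have h1 : ((k : ℚ) / D).den < 2 ^ (b + 1) := by
    zify
    rw [pow_succ]
    have : (0 : ℤ) < 2 ^ b := by positivity
    linarith
  have h2 : ((k : ℚ) / D).num.natAbs < 2 ^ (b + 3) := by
    zify
    rw [Int.natCast_natAbs] at hnum
    rw [pow_add]
    have : (0 : ℤ) < 2 ^ b := by positivity
    linarith
  have h3 := Nat.size_le.2 h1
  have h4 := Nat.size_le.2 h2
  unfold ratBits
  omega

theorem prod_den_le {n : ℕ} (z : Fin n → ℚ) :
    ∏ e, (z e).den ≤ 2 ^ ∑ e, ratBits (z e) := by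
  rw [← Finset.prod_pow_eq_pow_sum]
  refine Finset.prod_le_prod' fun e _ => ?_
  have h1 : (z e).den < 2 ^ (z e).den.size := Nat.lt_size_self _
  refine h1.le.trans (Nat.pow_le_pow_right (by norm_num) ?_)
  unfold ratBits
  omega

/-- The common denominator of the numbers that the program computes. -/
def commonDen (z : Fin I.nE → ℚ) : ℕ := 4 * ∏ e, (z e).den

theorem commonDen_pos (z : Fin I.nE → ℚ) : 0 < commonDen z :=
  Nat.mul_pos (by norm_num) (Finset.prod_pos fun e _ => (z e).pos)

/-- The factor `4` in `commonDen` accommodates the quarters `y e / 4` and also yields `1/2`. -/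
theorem bounds_of_rat {z : Fin I.nE → ℚ} (hz : ∀ e, I.y e = (z e : ℝ)) :
    Bounds I (AddSubgroup.zmultiples (1 / (commonDen z : ℝ))) (I.size + 4) where
  nE_lt := by
    have := nE_le_size (I := I)
    omega
  three_le := by omega
  half_mem := by
    have h := commonDen_pos z
    refine AddSubgroup.mem_zmultiples_iff.2 ⟨2 * ∏ e, ((z e).den : ℤ), ?_⟩
    have h1 : ((∏ e, (z e).den : ℕ) : ℝ) ≠ 0 :=
      Nat.cast_ne_zero.2 (Finset.prod_pos fun e _ => (z e).pos).ne'
    unfold commonDen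
    push_cast at h1 ⊢
    rw [zsmul_eq_mul]
    push_cast
    field_simp
    norm_num
  y_mem e := by
    refine AddSubgroup.mem_zmultiples_iff.2
      ⟨(z e).num * ∏ g ∈ Finset.univ.erase e, ((z g).den : ℤ), ?_⟩
    have h1 : ∀ g, ((z g).den : ℝ) ≠ 0 := fun g => Nat.cast_ne_zero.2 (z g).den_ne_zero
    have h2 : ∏ g ∈ Finset.univ.erase e, ((z g).den : ℝ) ≠ 0 :=
      Finset.prod_ne_zero_iff.2 fun g _ => h1 g
    have h3 := h1 e
    rw [hz, zsmul_eq_mul, Rat.cast_def]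
    unfold commonDen
    push_cast
    rw [← Finset.prod_erase_mul _ _ (Finset.mem_univ e)]
    field_simp

theorem Mem.bitsLE_of_bounded {z : Fin I.nE → ℚ} {m : Mem}
    (hm : m.Bounded (AddSubgroup.zmultiples (1 / (commonDen z : ℝ))) (I.size + 4)) :
    m.BitsLE (2 * (I.size + ∑ e, ratBits (z e)) + 8) := by
  intro a i
  constructor
  · have h1 := hm.1 a i
    have h2 : (m.nat a i).size ≤ m.nat a i := Nat.size_le.2 Nat.lt_two_pow_self
    omega
  · obtain ⟨hL, habs⟩ := hm.2 a i
    obtain ⟨k, hk⟩ := AddSubgroup.mem_zmultiples_iff.1 hL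
    have hD := commonDen_pos z
    have hx : m.real a i = (k : ℝ) / ((commonDen z : ℤ) : ℝ) := by
      rw [← hk, zsmul_eq_mul]
      push_cast
      ring
    refine ⟨(k : ℚ) / ((commonDen z : ℤ) : ℚ), by rw [hx]; push_cast; rfl, ?_⟩
    rw [hx] at habs
    refine (ratBits_le (b := 2 + ∑ e, ratBits (z e)) (by exact_mod_cast hD) ?_ habs).trans
      (by omega)
    have h3 := prod_den_le z
    have h4 : commonDen z ≤ 2 ^ (2 + ∑ e, ratBits (z e)) := by
      unfold commonDen
      rw [pow_add]
      exact Nat.mul_le_mul (by norm_num) h3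
    exact_mod_cast h4

/-- For arbitrary real data no arithmetic restriction is wanted; the same simulation with the full
group gives halting and probabilities. -/
theorem bounds_top : Bounds I ⊤ (I.size + 4) where
  nE_lt := by
    have := nE_le_size (I := I)
    omega
  three_le := by omega
  half_mem := trivial
  y_mem _ := trivial

/-! ### Probabilities of the output -/

open Classical in
-- The event depends on the output only, which the final representation identifies with the edges of
-- status `done`.
theorem prob_outputDist {T : ℕ} (hT : 5 * I.nE ^ 2 + 59 * I.nE + 15 ≤ T)
    {A : Set (Finset (Fin I.nE))} {f : I.State → ℝ}
    (hf : ∀ s, f s = if (Finset.univ.filter fun e => s (I.vtx e) = .done e) ∈ A then 1 else 0) :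
    prob (I.outputDist program T) A = I.rounding.expect f := by
  have hsim := (program_sim bounds_top (input_bounded bounds_top (Nat.le_add_right _ 4))
    input_rep).mono hT
  rw [← hsim.prob_eq (A := {x | I.output x.2 ∈ A})]
  · rw [prob, outputDist, PMF.toOuterMeasure_map_apply]
    rfl
  · intro s m hR
    have : I.output m = Finset.univ.filter fun e => s (I.vtx e) = .done e :=
      Finset.filter_congr fun e _ => hR e
    rw [hf, Set.mem_ofPred_eq, this]

end RoundingInstance

open RoundingInstance RandRAM in
theorem theorem2 :
    ∃ (P : RandRAM.Cmd) (p q : Polynomial ℕ), ∀ I : RoundingInstance,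
      -- the number of steps is polynomial in the size of the graph and of the families of groups
      RandRAM.HaltsWithin P I.input (p.eval I.size) ∧
      -- on rational data, the numbers in the memory have polynomially many bits
      (∀ z : Fin I.nE → ℚ, (∀ e, I.y e = (z e : ℝ)) →
        RandRAM.BitsLE P I.input (q.eval (I.size + ∑ e, RandRAM.ratBits (z e)))) ∧
      -- property (a)
      (∀ v : Fin I.nV,
        RandRAM.prob (I.outputDist P (p.eval I.size)) {S | (S ∩ I.deltaV v).card = 1} = 1) ∧
      -- property (b)
      (∀ e : Fin I.nE,
        RandRAM.prob (I.outputDist P (p.eval I.size)) {S | e ∈ S} = I.y e) ∧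
      -- property (c)
      (∀ u : Fin I.nU, ∀ e ∈ I.deltaU u, ∀ e' ∈ I.deltaU u, e ≠ e' →
        RandRAM.prob (I.outputDist P (p.eval I.size)) {S | e ∈ S ∧ e' ∈ S} ≤ I.y e * I.y e' ∧
        ((∃ l : Fin (I.κ u), e ∈ I.grp u l ∧ e' ∈ I.grp u l) →
          RandRAM.prob (I.outputDist P (p.eval I.size)) {S | e ∈ S ∧ e' ∈ S} ≤
            (1 - 1 / 108) * (I.y e * I.y e'))) := by
  classical
  refine ⟨program, 5 * Polynomial.X ^ 2 + 59 * Polynomial.X + 15, 2 * Polynomial.X + 8, fun I => ?_⟩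
  have hp : (5 * Polynomial.X ^ 2 + 59 * Polynomial.X + 15 : Polynomial ℕ).eval I.size =
      5 * I.size ^ 2 + 59 * I.size + 15 := by simp
  have hq : ∀ n, (2 * Polynomial.X + 8 : Polynomial ℕ).eval n = 2 * n + 8 := by simp
  rw [hp]
  have hT : 5 * I.nE ^ 2 + 59 * I.nE + 15 ≤ 5 * I.size ^ 2 + 59 * I.size + 15 := by
    have := nE_le_size (I := I)
    gcongr
  have hpair : ∀ e e' : Fin I.nE, prob (I.outputDist program (5 * I.size ^ 2 + 59 * I.size + 15))
      {S | e ∈ S ∧ e' ∈ S} = I.rounding.expect fun s => chosen e s * chosen e' s := by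
    refine fun e e' => prob_outputDist hT fun s => ?_
    by_cases h : s (I.vtx e) = .done e <;> by_cases h' : s (I.vtx e') = .done e' <;>
      simp [chosen, h, h']
  refine ⟨?_, fun z hz => ?_, fun v => ?_, fun e => ?_, fun u e he e' he' hne => ⟨?_, ?_⟩⟩
  · exact ((program_sim bounds_top (input_bounded bounds_top (Nat.le_add_right _ 4))
      input_rep).mono hT).halts
  · rw [hq]
    intro t x hx
    have hB := bounds_of_rat hz
    exact Mem.bitsLE_of_bounded ((program_sim hB (input_bounded hB (Nat.le_add_right _ 4))
      input_rep).invariant t x hx)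
  -- At most one edge per vertex is chosen, so the indicator of exactly one is the number of chosen
  -- edges. Its expectation is `∑ y e = 1`, and no separate argument is needed that every vertex
  -- makes a choice.
  · rw [prob_outputDist hT (f := fun s => ∑ e ∈ I.deltaV v, chosen e s) fun s => ?_,
      CoinTree.expect_sum]
    · simp only [expect_chosen]
      exact I.y_sum v
    · have hcard : ∑ e ∈ I.deltaV v, chosen e s =
          (((Finset.univ.filter fun e => s (I.vtx e) = .done e) ∩ I.deltaV v).card : ℝ) := by
        have h : (Finset.univ.filter fun e => s (I.vtx e) = .done e) ∩ I.deltaV v =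
            (I.deltaV v).filter fun e => s (I.vtx e) = .done e := by
          ext e
          simp [and_comm]
        rw [h]
        simp [chosen]
      have hle : ((Finset.univ.filter fun e => s (I.vtx e) = .done e) ∩ I.deltaV v).card ≤ 1 := by
        refine Finset.card_le_one.2 fun a ha b hb => ?_
        simp only [Finset.mem_inter, Finset.mem_filter, Finset.mem_univ, true_and, deltaV] at ha hb
        have hab : I.vtx a = I.vtx b := ha.2.trans hb.2.symm
        have h := ha.1
        rw [hab, hb.1] at h
        exact (Status.done.inj h).symm
      rw [hcard, Set.mem_ofPred_eq]
      interval_cases h : ((Finset.univ.filter fun e => s (I.vtx e) = .done e) ∩ I.deltaV v).card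
      · simp
      · simp
  · rw [prob_outputDist hT (f := chosen e) fun s => by simp [chosen]]
    exact expect_chosen e
  · rw [hpair]
    exact expect_chosen_mul_le (((by simpa [deltaU] using he : (I.ends e).1 = u)).trans
      ((by simpa [deltaU] using he' : (I.ends e').1 = u)).symm) hne
  · rintro ⟨l, hl, hl'⟩
    rw [hpair]
    exact expect_chosen_mul_le_of_same (same_of_mem hl hl') hne

end
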